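/- **Model.** Let $d\ge 1$, and let $l(r)=\sum_{k=0}^{K-1}A_k r^{\beta_k}\mathbf 1(R_k\le r<R_{k+1})$ be a multi-slope pathloss function: $K\ge1$, $0=R_0<R_1<\dots<R_K=R_\infty<\infty$, $\beta_0\ge 0$, $\beta_k\ge d-1$ for $k\ge1$, $\beta_k<\beta_{k+1}$, $A_k>0$, and $A_kR_{k+1}^{\beta_k}=A_{k+1}R_{k+1}^{\beta_{k+1}}$ for $k\le K-2$. Let $F_m$ be a probability law on $[0,\infty)$, not the point mass at $0$ (the law of the channel power $m$), and let $0\le W<\infty$ be the noise power. Let $B$ be the ball of radius $R_\infty$ around the origin of $\mathbb R^d$. For $\lambda\ge0$ let $\Phi_\lambda=\{(x_i,m_i)\}$ be the homogeneous Poisson point process of intensity $\lambda$ on $B$ with independent marks of law $F_m$, i.e. the Poisson point process on $B\times[0,\infty)$ with intensity measure $\lambda\,dx\otimes F_m$; all $\Phi_\lambda$ live on one probability space. Put $P_i=m_i/l(\|x_i\|)$ and, under strongest-cell association, $$\mathrm{SINR}(\lambda)=\max_i\frac{P_i}{\sum_{j\ne i}P_j+W}\in[0,\infty]$$ (the maximum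 over the empty set is $0$). Let $\bar F_m(t)=\mathbb P(m>t)$ and let $\bar F_P(t)=\mathbb P(P>t)$, where $P=m/l(\|x\|)$ with $x$ uniform on $B$ and $m\sim F_m$ independent of $x$. For a positive Lebesgue measurable function $h$ on $(0,\infty)$ write $h\in\mathcal R_\rho$ if $h(tx)/h(x)\to t^\rho$ as $x\to\infty$ for every $t>0$, where $\rho\in[-\infty,\infty)$ and $t^{-\infty}$ means $0$ for $t>1$, $1$ for $t=1$ and $\infty$ for $t<1$. **Theorem.** As $\lambda\to\infty$: 1. If $\bar F_P\in\mathcal R_0$, then $\mathrm{SINR}(\lambda)\to\infty$ in probability. 2. If $\bar F_P\in\mathcal R_{-\alpha}$ with $0<\alpha<1$, then $\mathrm{SINR}(\lambda)$ converges in distribution to a random variable $D$ that is almost surely finite and has a non-degenerate distribution. 3. Suppose that $\bar F_m$ or $\bar F_P$ belongs to one of the following classes of tails: $\mathcal R_{-\alpha}$ with $0\le\alpha\le\infty$, or functions that are $o(\bar H)$ at $\infty$ for some $\bar H\in\mathcal R_{-\infty}$. If $\bar F_P\notin\mathcal R_{-\alpha}$ for every $\alpha\in[0,1]$, and if densification adds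 nodes, i.e. almost surely $\Phi_\lambda\subseteq\Phi_{\lambda'}$ for all $\lambda\le\lambda'$, then $\mathrm{SINR}(\lambda)\to0$ almost surely. -/

import Mathlib

open MeasureTheory ProbabilityTheory Filter Topology
open scoped NNReal ENNReal

/-- Positive, Lebesgue measurable function on `(0, ∞)` with `h (t x) / h x → t ^ ρ` as `x → ∞`,
for every `t > 0`: regular variation at `∞` with index `ρ` (slow variation if `ρ = 0`). -/
def RegularlyVarying (h : ℝ → ℝ) (ρ : ℝ) : Prop :=
  (∀ x, 0 < x → 0 < h x) ∧ AEMeasurable h (volume.restrict (Set.Ioi 0)) ∧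
    ∀ t : ℝ, 0 < t → Tendsto (fun x => h (t * x) / h x) atTop (𝓝 (t ^ ρ))

/-- Rapid variation, i.e. regular variation with index `-∞`: the limit of `h (t x) / h x` is
`t ^ (-∞)`, that is, `0` for `t > 1` and `∞` for `0 < t < 1`. -/
def RapidlyVarying (h : ℝ → ℝ) : Prop :=
  (∀ x, 0 < x → 0 < h x) ∧ AEMeasurable h (volume.restrict (Set.Ioi 0)) ∧
    (∀ t : ℝ, 1 < t → Tendsto (fun x => h (t * x) / h x) atTop (𝓝 0)) ∧
    (∀ t : ℝ, 0 < t → t < 1 → Tendsto (fun x => h (t * x) / h x) atTop atTop)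

/-- The tail behaviours under consideration: regularly varying with an index `-α ∈ (-∞, 0]`,
rapidly varying, or negligible with respect to a rapidly varying function. -/
def ClassifiedTail (h : ℝ → ℝ) : Prop :=
  (∃ α : ℝ, 0 ≤ α ∧ RegularlyVarying h (-α)) ∨ RapidlyVarying h ∨
    ∃ H : ℝ → ℝ, RapidlyVarying H ∧ Asymptotics.IsLittleO atTop h H

/-- The parameters of a multi-slope pathloss function in dimension `d`: number of slopes `K`,
breakpoints `0 = R 0 < ⋯ < R K = R_∞`, exponents `β k` and scales `A k` (`k < K`); only these
values matter. -/
structure Pathloss (d : ℕ) where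
  K : ℕ
  R : ℕ → ℝ
  β : ℕ → ℝ
  A : ℕ → ℝ
  one_le_K : 1 ≤ K
  R_zero : R 0 = 0
  R_lt : ∀ k, k < K → R k < R (k + 1)
  β_zero : 0 ≤ β 0
  le_β : ∀ k, 1 ≤ k → k < K → (d : ℝ) - 1 ≤ β k
  β_lt : ∀ k, k + 1 < K → β k < β (k + 1)
  A_pos : ∀ k, k < K → 0 < A k
  continuity : ∀ k, k + 1 < K → A k * R (k + 1) ^ β k = A (k + 1) * R (k + 1) ^ β (k + 1)

namespace Pathloss

variable {d : ℕ}

/-- The radius `R_∞` of the network domain. -/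
def Rinf (L : Pathloss d) : ℝ := L.R L.K

/-- The pathloss function `l r = ∑ k < K, A k * r ^ β k * 1 (R k ≤ r < R (k + 1))`. -/
noncomputable def l (L : Pathloss d) (r : ℝ) : ℝ :=
  ∑ k ∈ Finset.range L.K,
    (Set.Ico (L.R k) (L.R (k + 1))).indicator (fun s => L.A k * s ^ L.β k) r

/-- The network domain: the ball of radius `R_∞` around the user, who sits at the origin. -/
def domain (L : Pathloss d) : Set (EuclideanSpace ℝ (Fin d)) :=
  Metric.closedBall 0 L.Rinf

/-- The power `m / l ‖x‖` received at the origin from a node `p = (x, m)` at position `x` with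
channel power `m`. -/
noncomputable def power (L : Pathloss d) (p : EuclideanSpace ℝ (Fin d) × ℝ≥0) : ℝ≥0∞ :=
  (p.2 : ℝ≥0∞) / ENNReal.ofReal (L.l ‖p.1‖)

/-- The tail distribution of the power received from a random node, whose position is uniform on
the network domain and whose channel power has law `F` and is independent of the position. -/
noncomputable def powerTail (L : Pathloss d) (F : Measure ℝ≥0) (t : ℝ) : ℝ :=
  (((cond volume L.domain).prod F) {p | ENNReal.ofReal t < L.power p}).toReal

/-- The signal to interference plus noise ratio `max_i P_i / (∑_{j ≠ i} P_j + W)` at the origin,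
for the set `Φ` of nodes `(x, m)` and the noise power `W`. -/
noncomputable def sinr (L : Pathloss d) (W : ℝ≥0)
    (Φ : Set (EuclideanSpace ℝ (Fin d) × ℝ≥0)) : ℝ≥0∞ :=
  ⨆ p ∈ Φ, L.power p / ((∑' q : ↥(Φ \ {p}), L.power q) + (W : ℝ≥0∞))

end Pathloss

/-- The tail distribution of the channel power. -/
noncomputable def channelTail (F : Measure ℝ≥0) (t : ℝ) : ℝ :=
  (F {m | t < (m : ℝ)}).toReal

/-- The random set `Φ` is a (simple) Poisson point process with intensity measure `Λ`: the number
of points in a measurable set `A` is a random variable, Poisson distributed with mean `Λ A` if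
`Λ A` is finite, and the numbers of points in disjoint sets are independent. -/
structure IsPoissonProcess {Ω E : Type*} [MeasurableSpace Ω] [MeasurableSpace E]
    (Φ : Ω → Set E) (Λ : Measure E) (μ : Measure Ω) : Prop where
  measurable_count : ∀ A : Set E, MeasurableSet A → Measurable fun ω => (Φ ω ∩ A).encard
  count_law : ∀ A : Set E, MeasurableSet A → Λ A ≠ ∞ → ∀ k : ℕ,
    μ {ω | (Φ ω ∩ A).encard = k} = poissonMeasure (Λ A).toNNReal {k}
  indep : ∀ (n : ℕ) (A : Fin n → Set E), (∀ i, MeasurableSet (A i)) →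
    (∀ i j, i ≠ j → Disjoint (A i) (A j)) →
      iIndepFun (fun i ω => (Φ ω ∩ A i).encard) μ

/-! Let M be the largest received power, S the sum of all received powers, T the tail of a single
power and c = λ|B| the mean number of nodes. The strongest node realises the SINR, so 1/SINR + 1 =
(S + W)/M whenever M > 0. Parts 1 and 2 come from the Laplace transform of the right-hand side.

Write g(u, y) = E[exp(-uP); P ≤ y]. The Laplace functional of the Poisson process
(`lintegral_expNeg_tsum`) gives E[exp(-uS); M ≤ y] = exp(-c(1 - g(u, y))), because a test function
equal to ∞ above y kills the configurations with M > y. Cut the range of M along a geometric grid of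
ratio θ > 1. On a cell M is constant up to a factor θ, so u = s/x with x an endpoint of the cell,
and the cell contributes a difference of two such exponentials. If T is regularly varying with index
-α, 0 ≤ α < 1, then 1 - g(s/x, x) ~ φ(s) T(x) with φ = `limitFactor α`
(`tendsto_one_sub_truncLaplace_div`). Each contribution is then comparable to exp(-s)/φ(s) times an
increment of exp(-c φ(s) T), and the sum telescopes. Letting c → ∞ and then θ → 1 gives E
exp(-s/SINR) → 1/φ(s).

For α = 0, φ = 1, so 1/SINR → 0 in probability. For 0 < α < 1 the integrals of exp(-n/x), n ∈ ℕ,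
determine a law on the compact space [0, ∞] by Stone–Weierstrass, so the laws converge. The limit
has no mass at ∞ since φ(s) → ∞, and is no point mass since φ grows at most linearly while exp(-n/x)
decays geometrically.

Part 3 reduces to E P < ∞. Then along λ = 2^n Borel–Cantelli makes M = o(λ) and S at least of order
λ, and monotonicity in λ fills the gaps. For E P < ∞, with P independent factors m and 1/l, the law
of l near 0 is an exact power with exponent γ = d/β₀ (or l is bounded below if β₀ = 0). A finite
moment of order γ of m makes T regularly varying with index -γ; an infinite one makes small
pathlosses negligible, so that T inherits the index of the channel tail. Excluding indices in [-1,
0] leaves only cases of finite mean (`lintegral_power_ne_top`). -/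

/-! ### The exponential function on the extended half-line -/

/-- The function `x ↦ exp (-x)` on `[0, ∞]`. -/
noncomputable def expNeg (x : ℝ≥0∞) : ℝ≥0∞ := EReal.exp (-(x : EReal))

@[simp] lemma expNeg_zero : expNeg 0 = 1 := by simp [expNeg]

@[simp] lemma expNeg_top : expNeg ∞ = 0 := by simp [expNeg]

lemma expNeg_add (x y : ℝ≥0∞) : expNeg (x + y) = expNeg x * expNeg y := by
  unfold expNeg
  rw [← EReal.exp_add, EReal.coe_ennreal_add, EReal.neg_add, sub_eq_add_neg]
  · left; simp
  · right; simp

lemma expNeg_ofReal {r : ℝ} (hr : 0 ≤ r) :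
    expNeg (ENNReal.ofReal r) = ENNReal.ofReal (Real.exp (-r)) := by
  unfold expNeg
  rw [EReal.coe_ennreal_ofReal, max_eq_left hr, ← EReal.coe_neg, EReal.exp_coe]

lemma expNeg_coe (r : ℝ≥0) : expNeg r = ENNReal.ofReal (Real.exp (-r)) := by
  simpa using expNeg_ofReal r.2

lemma expNeg_strictAnti : StrictAnti expNeg := by
  intro x y hxy
  unfold expNeg
  rw [EReal.exp_lt_exp_iff, EReal.neg_lt_neg_iff]
  exact_mod_cast hxy

lemma expNeg_antitone : Antitone expNeg := expNeg_strictAnti.antitone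

lemma expNeg_le_one (x : ℝ≥0∞) : expNeg x ≤ 1 := by
  simpa using expNeg_antitone (zero_le (a := x))

lemma expNeg_ne_top (x : ℝ≥0∞) : expNeg x ≠ ∞ := ne_top_of_le_ne_top (by simp) (expNeg_le_one x)

lemma continuous_expNeg : Continuous expNeg :=
  EReal.expHomeomorph.continuous.comp (continuous_neg.comp continuous_coe_ennreal_ereal)

lemma measurable_expNeg : Measurable expNeg := continuous_expNeg.measurable

lemma expNeg_nat_mul (n : ℕ) (x : ℝ≥0∞) : expNeg (n * x) = expNeg x ^ n := by
  induction n with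
  | zero => simp
  | succ n ih => rw [Nat.cast_succ, add_mul, one_mul, expNeg_add, ih, pow_succ]

lemma expNeg_sum {ι : Type*} (s : Finset ι) (f : ι → ℝ≥0∞) :
    expNeg (∑ i ∈ s, f i) = ∏ i ∈ s, expNeg (f i) := by
  classical
  induction s using Finset.induction_on with
  | empty => simp
  | insert a s ha ih => rw [Finset.sum_insert ha, Finset.prod_insert ha, expNeg_add, ih]

/-! ### Sums over point sets as integrals -/

section PointMeasure

variable {E : Type*} [MeasurableSpace E]

/-- The counting measure of a set of points. -/
noncomputable def pointMeasure (S : Set E) : Measure E :=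
  Measure.sum fun q : S => Measure.dirac (q : E)

/-- Turns sums over a configuration into integrals, so that measurability and monotone convergence
apply to them. -/
lemma lintegral_pointMeasure (S : Set E) {f : E → ℝ≥0∞} (hf : Measurable f) :
    ∫⁻ q, f q ∂pointMeasure S = ∑' q : S, f q := by
  simp [pointMeasure, lintegral_sum_measure, lintegral_dirac' _ hf]

lemma pointMeasure_apply (S : Set E) {A : Set E} (hA : MeasurableSet A) :
    pointMeasure S A = (S ∩ A).encard := by
  rw [← lintegral_indicator_one hA, lintegral_pointMeasure S (measurable_one.indicator hA),
    ← ENNReal.tsum_set_one, tsum_subtype S, tsum_subtype (S ∩ A) (fun _ => (1 : ℝ≥0∞)),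
    ← Set.indicator_indicator]
  rfl

end PointMeasure

/-! ### Laplace functional of a Poisson process -/

namespace IsPoissonProcess

variable {Ω E : Type*} [MeasurableSpace Ω] [MeasurableSpace E]
  {Φ : Ω → Set E} {Λ : Measure E} {μ : Measure Ω}

lemma measurable_pointMeasure (h : IsPoissonProcess Φ Λ μ) :
    Measurable fun ω => pointMeasure (Φ ω) := by
  refine Measure.measurable_of_measurable_coe _ fun A hA => ?_
  simp_rw [pointMeasure_apply _ hA]
  exact (Measurable.of_discrete (f := fun n : ℕ∞ => (n : ℝ≥0∞))).comp (h.measurable_count A hA)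

lemma measurable_tsum (h : IsPoissonProcess Φ Λ μ) {f : E → ℝ≥0∞} (hf : Measurable f) :
    Measurable fun ω => ∑' q : Φ ω, f q := by
  simp_rw [← lintegral_pointMeasure _ hf]
  exact (Measure.measurable_lintegral hf).comp h.measurable_pointMeasure

variable [IsProbabilityMeasure μ]

/-- The definition prescribes only the probabilities of finite counts. These already sum to one, so
one inequality between probability measures suffices, and the value `⊤` is left without mass. -/
lemma map_encard (h : IsPoissonProcess Φ Λ μ) {A : Set E} (hA : MeasurableSet A)
    (hA' : Λ A ≠ ∞) :
    μ.map (fun ω => (Φ ω ∩ A).encard) =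
      (poissonMeasure (Λ A).toNNReal).map (Nat.cast : ℕ → ℕ∞) := by
  have hm := h.measurable_count A hA
  have : IsProbabilityMeasure (μ.map (fun ω => (Φ ω ∩ A).encard)) :=
    Measure.isProbabilityMeasure_map hm.aemeasurable
  symm
  refine Measure.eq_of_le_of_isProbabilityMeasure ?_
  rw [Measure.le_iff]
  intro s hs
  rw [Measure.map_apply Measurable.of_discrete hs,
    ← Measure.tsum_indicator_apply_singleton _ _ .of_discrete,
    ← Measure.tsum_indicator_apply_singleton (μ.map _) s hs]
  have hinj : Function.Injective (Nat.cast : ℕ → ℕ∞) := Nat.cast_injective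
  refine le_trans (ENNReal.tsum_le_tsum fun k => ?_) (ENNReal.tsum_comp_le_tsum_of_injective hinj _)
  by_cases hk : (k : ℕ∞) ∈ s
  · rw [Set.indicator_of_mem (show k ∈ Nat.cast ⁻¹' s from hk), Set.indicator_of_mem hk,
      Measure.map_apply hm .of_discrete]
    exact (h.count_law A hA hA' k).ge
  · rw [Set.indicator_of_notMem (show k ∉ Nat.cast ⁻¹' s from hk)]
    exact zero_le

/-- The Poisson generating function E u^N = exp(-(1 - u)r) at u = exp(-v). The value v = ∞ is
allowed and gives the void probability. -/
lemma lintegral_expNeg_mul_encard (h : IsPoissonProcess Φ Λ μ) {A : Set E} (hA : MeasurableSet A)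
    (hA' : Λ A ≠ ∞) (v : ℝ≥0∞) :
    ∫⁻ ω, expNeg (v * (Φ ω ∩ A).encard) ∂μ = expNeg ((1 - expNeg v) * Λ A) := by
  have h1 : ∫⁻ ω, expNeg (v * (Φ ω ∩ A).encard) ∂μ =
      ∫⁻ n : ℕ∞, expNeg (v * n) ∂(μ.map (fun ω => (Φ ω ∩ A).encard)) :=
    (lintegral_map (f := fun n : ℕ∞ => expNeg (v * n)) .of_discrete (h.measurable_count A hA)).symm
  rw [h1, h.map_encard hA hA', lintegral_map .of_discrete .of_discrete, poissonMeasure,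
    lintegral_sum_measure]
  simp only [lintegral_smul_measure, lintegral_dirac, smul_eq_mul]
  set r : ℝ≥0 := (Λ A).toNNReal
  have hr : Λ A = r := (ENNReal.coe_toNNReal hA').symm
  obtain ⟨u, hu⟩ : ∃ u : ℝ≥0, expNeg v = u := ⟨_, (ENNReal.coe_toNNReal (expNeg_ne_top v)).symm⟩
  have hu1 : u ≤ 1 := by exact_mod_cast hu ▸ expNeg_le_one v
  have h2 : ∀ n : ℕ, ENNReal.ofReal (Real.exp (-r) * r ^ n / n.factorial) *
      expNeg (v * ((n : ℕ∞) : ℝ≥0∞)) =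
      ENNReal.ofReal (Real.exp (-r) * ((r * u) ^ n / n.factorial)) := by
    intro n
    rw [ENat.toENNReal_coe, mul_comm v, expNeg_nat_mul, hu, ← ENNReal.ofReal_coe_nnreal,
      ← ENNReal.ofReal_pow (NNReal.coe_nonneg u), ← ENNReal.ofReal_mul (by positivity)]
    congr 1
    rw [mul_pow]; ring
  simp_rw [h2]
  have hs : HasSum (fun n : ℕ => Real.exp (-r) * (((r : ℝ) * u) ^ n / n.factorial))
      (Real.exp (-r) * Real.exp (r * u)) := by
    rw [Real.exp_eq_exp_ℝ]
    exact (NormedSpace.expSeries_div_hasSum_exp ((r : ℝ) * u)).mul_left _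
  rw [← ENNReal.ofReal_tsum_of_nonneg (fun n => by positivity) hs.summable, hs.tsum_eq,
    ← Real.exp_add, hu, hr]
  have : (1 - (u : ℝ≥0∞)) * r = (((1 - u) * r : ℝ≥0) : ℝ≥0∞) := by push_cast; rfl
  rw [this, expNeg_coe]
  congr 2
  rw [NNReal.coe_mul, NNReal.coe_sub hu1]
  simp; ring

/-- The Laplace functional of a Poisson process at a simple function. -/
lemma lintegral_expNeg_simpleFunc [IsFiniteMeasure Λ] (h : IsPoissonProcess Φ Λ μ)
    (f : SimpleFunc E ℝ≥0∞) :
    ∫⁻ ω, expNeg (∑' q : Φ ω, f q) ∂μ = expNeg (∫⁻ q, (1 - expNeg (f q)) ∂Λ) := by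
  classical
  let e := f.range.equivFin
  let A : Fin f.range.card → Set E := fun i => f ⁻¹' {(e.symm i : ℝ≥0∞)}
  have hA : ∀ i, MeasurableSet (A i) := fun i => f.measurableSet_fiber _
  have hdisj : ∀ i j, i ≠ j → Disjoint (A i) (A j) := by
    intro i j hij
    refine Disjoint.preimage _ ?_
    simpa [Subtype.coe_inj] using hij
  have hsum : ∀ (ν : Measure E) (g : ℝ≥0∞ → ℝ≥0∞),
      ∫⁻ q, g (f q) ∂ν = ∑ i, g (e.symm i) * ν (A i) := by
    intro ν g
    have : ∫⁻ q, g (f q) ∂ν = ∫⁻ q, (f.map g) q ∂ν := by simp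
    rw [this, SimpleFunc.lintegral_eq_lintegral, SimpleFunc.map_lintegral,
      ← Finset.sum_coe_sort f.range, ← e.symm.sum_comp]
  have h1 : ∀ ω, expNeg (∑' q : Φ ω, f q) =
      ∏ i, expNeg (e.symm i * (Φ ω ∩ A i).encard) := by
    intro ω
    rw [← lintegral_pointMeasure _ f.measurable, hsum _ (fun x => x), expNeg_sum]
    simp_rw [pointMeasure_apply _ (hA _)]
  simp_rw [h1]
  -- The fibres of `f` are disjoint, so their counts are independent and the expectation of the
  -- product factorises.
  have hind := (h.indep _ A hA hdisj).comp (fun i (n : ℕ∞) => expNeg (e.symm i * n))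
    (fun i => .of_discrete)
  have := lintegral_prod_eq_prod_lintegral_of_indepFun Finset.univ _ hind (fun i =>
    (Measurable.of_discrete (f := fun n : ℕ∞ => expNeg (e.symm i * n))).comp
      (h.measurable_count (A i) (hA i)))
  simp only [Function.comp_apply] at this
  rw [this, hsum Λ (fun x => 1 - expNeg x), expNeg_sum]
  refine Finset.prod_congr rfl fun i _ => ?_
  exact h.lintegral_expNeg_mul_encard (hA i) (measure_ne_top _ _) _

/-- The Laplace functional of a Poisson process. -/
theorem lintegral_expNeg_tsum [IsFiniteMeasure Λ] (h : IsPoissonProcess Φ Λ μ)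
    {f : E → ℝ≥0∞} (hf : Measurable f) :
    ∫⁻ ω, expNeg (∑' q : Φ ω, f q) ∂μ = expNeg (∫⁻ q, (1 - expNeg (f q)) ∂Λ) := by
  have hlim : ∀ ν : Measure E, Tendsto (fun n => ∫⁻ q, SimpleFunc.eapprox f n q ∂ν) atTop
      (𝓝 (∫⁻ q, f q ∂ν)) := fun ν =>
    lintegral_tendsto_of_tendsto_of_monotone (fun n => (SimpleFunc.eapprox f n).aemeasurable)
      (.of_forall fun q _ _ hnm => SimpleFunc.monotone_eapprox f hnm q)
      (.of_forall fun q => SimpleFunc.tendsto_eapprox hf q)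
  have h1 : Tendsto (fun n => ∫⁻ ω, expNeg (∑' q : Φ ω, SimpleFunc.eapprox f n q) ∂μ) atTop
      (𝓝 (∫⁻ ω, expNeg (∑' q : Φ ω, f q) ∂μ)) := by
    refine tendsto_lintegral_of_dominated_convergence (fun _ => 1)
      (fun n => measurable_expNeg.comp (h.measurable_tsum (SimpleFunc.eapprox f n).measurable))
      (fun n => .of_forall fun ω => expNeg_le_one _) (by simp) (.of_forall fun ω => ?_)
    simp_rw [← lintegral_pointMeasure _ hf,
      ← lintegral_pointMeasure _ (SimpleFunc.eapprox f _).measurable]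
    exact (continuous_expNeg.tendsto _).comp (hlim _)
  have h2 : Tendsto (fun n => ∫⁻ ω, expNeg (∑' q : Φ ω, SimpleFunc.eapprox f n q) ∂μ) atTop
      (𝓝 (expNeg (∫⁻ q, (1 - expNeg (f q)) ∂Λ))) := by
    simp_rw [h.lintegral_expNeg_simpleFunc]
    refine (continuous_expNeg.tendsto _).comp ?_
    refine tendsto_lintegral_of_dominated_convergence (fun _ => 1)
      (fun n => measurable_const.sub
        (measurable_expNeg.comp (SimpleFunc.eapprox f n).measurable))
      (fun n => .of_forall fun ω => tsub_le_self) (by simp) (.of_forall fun q => ?_)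
    exact ((ENNReal.continuous_sub_left ENNReal.one_ne_top).comp continuous_expNeg).tendsto _
      |>.comp (SimpleFunc.tendsto_eapprox hf q)
  exact tendsto_nhds_unique h1 h2

end IsPoissonProcess

/-! ### The SINR in terms of the sum and the maximum of the powers -/

section MaxRatio

variable {E : Type*}

/-- The largest ratio between one of the received powers `P p`, `p ∈ S`, and the sum of the other
ones and of the noise power `W`. -/
noncomputable def maxRatio (P : E → ℝ≥0∞) (W : ℝ≥0) (S : Set E) : ℝ≥0∞ :=
  ⨆ p ∈ S, P p / ((∑' q : ↥(S \ {p}), P q) + (W : ℝ≥0∞))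

variable {P : E → ℝ≥0∞} {W : ℝ≥0} {S : Set E}

lemma tsum_eq_add_tsum_sdiff {p : E} (hp : p ∈ S) :
    ∑' q : S, P q = P p + ∑' q : ↥(S \ {p}), P q := by
  have h := ENNReal.summable.tsum_union_disjoint (f := P) (s := {p}) (t := S \ {p})
    Set.disjoint_sdiff_right ENNReal.summable
  rw [Set.union_sdiff_cancel (Set.singleton_subset_iff.2 hp)] at h
  rw [h, tsum_singleton p P]

/-- One half of 1/SINR + 1 = (S + W)/M: each ratio satisfies S/y ≤ S/P p = T/P p + 1, where T is the
sum of the other powers. The noise can only help. -/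
lemma tsum_div_le_inv_maxRatio_add_one {y : ℝ≥0∞} (hy' : y ≠ ∞)
    (h : ∀ p ∈ S, P p ≤ y) : (∑' q : S, P q) / y ≤ (maxRatio P W S)⁻¹ + 1 := by
  simp only [maxRatio, ENNReal.inv_iSup, ENNReal.iInf_add]
  refine le_iInf₂ fun p hp => ?_
  rw [tsum_eq_add_tsum_sdiff hp]
  set T := ∑' q : ↥(S \ {p}), P q
  rcases eq_or_ne (P p) 0 with h0 | h0
  · simp [h0]
  have hi : P p ≠ ∞ := ne_top_of_le_ne_top hy' (h p hp)
  rw [ENNReal.inv_div (.inr hi) (.inr h0)]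
  calc (P p + T) / y ≤ (P p + T) / P p := ENNReal.div_le_div_left (h p hp) _
    _ = T / P p + 1 := by rw [ENNReal.add_div, ENNReal.div_self h0 hi, add_comm]
    _ ≤ _ := by gcongr; exact le_self_add

/-- The other half of the identity: a single node with power above y bounds the supremum from below.
-/
lemma inv_maxRatio_add_one_le {y : ℝ≥0∞} {p : E} (hp : p ∈ S) (h : y < P p) :
    (maxRatio P W S)⁻¹ + 1 ≤ ((∑' q : S, P q) + W) / y := by
  rw [tsum_eq_add_tsum_sdiff hp]
  rcases eq_or_ne (P p) ∞ with hi | hi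
  · rw [hi, top_add, top_add, ENNReal.top_div_of_ne_top h.ne_top]
    exact le_top
  have h0 : P p ≠ 0 := h.ne_bot
  have h1 : P p / ((∑' q : ↥(S \ {p}), P q) + (W : ℝ≥0∞)) ≤ maxRatio P W S :=
    le_iSup₂ (f := fun p (_ : p ∈ S) => P p / ((∑' q : ↥(S \ {p}), P q) + (W : ℝ≥0∞))) p hp
  set T := ∑' q : ↥(S \ {p}), P q
  calc (maxRatio P W S)⁻¹ + 1 ≤ (P p / (T + W))⁻¹ + 1 := by gcongr
    _ = (T + W) / P p + P p / P p := by
        rw [ENNReal.inv_div (.inr hi) (.inr h0), ENNReal.div_self h0 hi]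
    _ = (P p + T + W) / P p := by rw [← ENNReal.add_div]; congr 1; ring
    _ ≤ _ := ENNReal.div_le_div_left h.le _

/-- Add t·P p to both sides of t(T + W) < P p, where T is the sum of the other powers; finiteness
lets this term be cancelled again. The new condition involves only the total sum and the supremum,
which are measurable functions of the configuration. -/
lemma lt_maxRatio_iff (hS : ∑' q : S, P q ≠ ∞) (t : ℝ≥0) :
    t < maxRatio P W S ↔ t * ((∑' q : S, P q) + W) < (1 + t) * ⨆ p ∈ S, P p := by
  simp only [maxRatio, ENNReal.mul_iSup, lt_iSup_iff]
  refine exists_congr fun p => exists_congr fun hp => ?_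
  rw [tsum_eq_add_tsum_sdiff hp] at hS ⊢
  set T := ∑' q : ↥(S \ {p}), P q
  have hP : P p ≠ ∞ := fun h => hS (by simp [h])
  have hT : T + W ≠ ∞ := ENNReal.add_ne_top.2 ⟨fun h => hS (by simp [h]), by simp⟩
  have htP : t * P p ≠ ∞ := ENNReal.mul_ne_top (by simp) hP
  have h1 : (t : ℝ≥0∞) * (P p + T + W) = t * (T + W) + t * P p := by ring
  have h2 : (1 + (t : ℝ≥0∞)) * P p = P p + t * P p := by ring
  rw [h1, h2, ENNReal.add_lt_add_iff_right htP]
  rcases eq_or_ne (T + W) 0 with h0 | h0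
  · rw [h0, mul_zero]
    rcases eq_or_ne (P p) 0 with hp0 | hp0
    · simp [hp0]
    · simp [ENNReal.div_zero hp0, pos_iff_ne_zero, hp0]
  · rw [ENNReal.lt_div_iff_mul_lt (.inl h0) (.inl hT)]

end MaxRatio

/-! ### Measurability and almost sure finiteness -/

namespace IsPoissonProcess

variable {Ω E : Type*} [MeasurableSpace Ω] [MeasurableSpace E]
  {Φ : Ω → Set E} {Λ : Measure E} {μ : Measure Ω} {P : E → ℝ≥0∞}

lemma measurableSet_forall_le (h : IsPoissonProcess Φ Λ μ) (hP : Measurable P) (y : ℝ≥0∞) :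
    MeasurableSet {ω | ∀ p ∈ Φ ω, P p ≤ y} := by
  have : {ω | ∀ p ∈ Φ ω, P p ≤ y} = (fun ω => (Φ ω ∩ {p | y < P p}).encard) ⁻¹' {0} := by
    ext ω
    simp [Set.eq_empty_iff_forall_notMem]
  rw [this]
  exact h.measurable_count _ (measurableSet_lt measurable_const hP) .of_discrete

lemma measurable_iSup (h : IsPoissonProcess Φ Λ μ) (hP : Measurable P) :
    Measurable fun ω => ⨆ p ∈ Φ ω, P p := by
  refine measurable_of_Iic fun y => ?_
  convert h.measurableSet_forall_le hP y using 1
  ext ω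
  simp

variable [IsProbabilityMeasure μ]

lemma ae_disjoint (h : IsPoissonProcess Φ Λ μ) {A : Set E} (hA : MeasurableSet A) (h0 : Λ A = 0) :
    ∀ᵐ ω ∂μ, Disjoint (Φ ω) A := by
  have h1 := h.count_law A hA (by simp [h0]) 0
  rw [h0, poissonMeasure_singleton] at h1
  have h2 : ∀ᵐ ω ∂μ, (Φ ω ∩ A).encard = (0 : ℕ) := by
    rw [ae_iff_prob_eq_one]
    · rw [h1]; simp
    · exact (h.measurable_count A hA).eq measurable_const
  filter_upwards [h2] with ω hω
  rw [Set.disjoint_iff_inter_eq_empty]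
  simpa using hω

lemma ae_finite [IsFiniteMeasure Λ] (h : IsPoissonProcess Φ Λ μ) : ∀ᵐ ω ∂μ, (Φ ω).Finite := by
  have h1 := h.map_encard MeasurableSet.univ (measure_ne_top Λ _)
  have h2 : μ {ω | (Φ ω ∩ Set.univ).encard = ⊤} = 0 := by
    have := congrArg (fun ν => ν {⊤}) h1
    rw [Measure.map_apply (h.measurable_count _ .univ) .of_discrete,
      Measure.map_apply .of_discrete .of_discrete] at this
    rw [show {ω | (Φ ω ∩ Set.univ).encard = ⊤} =
      (fun ω => (Φ ω ∩ Set.univ).encard) ⁻¹' {⊤} from rfl, this]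
    convert measure_empty (μ := poissonMeasure _)
    ext n; simp
  filter_upwards [measure_eq_zero_iff_ae_notMem.1 h2] with ω hω
  simpa [Set.encard_eq_top_iff] using hω

lemma ae_forall_ne_top (h : IsPoissonProcess Φ Λ μ) (hP : Measurable P)
    (hPt : ∀ᵐ p ∂Λ, P p ≠ ∞) : ∀ᵐ ω ∂μ, ∀ p ∈ Φ ω, P p ≠ ∞ := by
  have h0 : Λ {p | P p = ∞} = 0 := by simpa [ae_iff] using hPt
  filter_upwards [h.ae_disjoint (hP (measurableSet_singleton ∞)) h0] with ω hω p hp hp'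
  exact Set.disjoint_left.1 hω hp hp'

lemma ae_tsum_ne_top [IsFiniteMeasure Λ] (h : IsPoissonProcess Φ Λ μ) (hP : Measurable P)
    (hPt : ∀ᵐ p ∂Λ, P p ≠ ∞) : ∀ᵐ ω ∂μ, ∑' q : Φ ω, P q ≠ ∞ := by
  filter_upwards [h.ae_finite, h.ae_forall_ne_top hP hPt] with ω h1 h2
  have := h1.fintype
  rw [tsum_fintype]
  exact ENNReal.sum_ne_top.2 fun q _ => h2 q q.2

lemma aemeasurable_maxRatio [IsFiniteMeasure Λ] (h : IsPoissonProcess Φ Λ μ) (hP : Measurable P)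
    (hPt : ∀ᵐ p ∂Λ, P p ≠ ∞) (W : ℝ≥0) : AEMeasurable (fun ω => maxRatio P W (Φ ω)) μ := by
  -- `lt_maxRatio_iff` needs a finite sum, which holds only almost surely; hence null measurability
  -- instead of measurability.
  suffices NullMeasurable (fun ω => maxRatio P W (Φ ω)) μ from this.aemeasurable
  refine measurable_of_Ioi (δ := NullMeasurableSpace Ω μ) fun t => ?_
  induction t using ENNReal.recTopCoe with
  | top =>
    rw [Set.Ioi_top]
    exact MeasurableSet.empty
  | coe t =>
    have hm : MeasurableSet {ω | t * ((∑' q : Φ ω, P q) + W) < (1 + t) * ⨆ p ∈ Φ ω, P p} :=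
      measurableSet_lt (((h.measurable_tsum hP).add_const _).const_mul _)
        ((h.measurable_iSup hP).const_mul _)
    refine NullMeasurableSet.congr hm.nullMeasurableSet ?_
    filter_upwards [h.ae_tsum_ne_top hP hPt] with ω hω
    exact propext (lt_maxRatio_iff hω t).symm

end IsPoissonProcess

/-! ### Tails and truncated Laplace transforms of a single power -/

section Tail

variable {E : Type*} [MeasurableSpace E] {π : Measure E} {P : E → ℝ≥0∞}

/-- The tail distribution of a random variable with values in `[0, ∞]`. -/
noncomputable def tailProb (π : Measure E) (P : E → ℝ≥0∞) (t : ℝ) : ℝ :=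
  (π {p | ENNReal.ofReal t < P p}).toReal

/-- The Laplace transform at `u` of the law of `P`, truncated at `y`. -/
noncomputable def truncLaplace (π : Measure E) (P : E → ℝ≥0∞) (u y : ℝ) : ℝ :=
  (∫⁻ p in {p | P p ≤ ENNReal.ofReal y}, expNeg (ENNReal.ofReal u * P p) ∂π).toReal

lemma tailProb_nonneg (t : ℝ) : 0 ≤ tailProb π P t := ENNReal.toReal_nonneg

lemma measurableSet_le_const (hP : Measurable P) (y : ℝ≥0∞) : MeasurableSet {p | P p ≤ y} :=
  measurableSet_le hP measurable_const

lemma measurableSet_const_lt (hP : Measurable P) (y : ℝ≥0∞) : MeasurableSet {p | y < P p} :=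
  measurableSet_lt measurable_const hP

variable [IsProbabilityMeasure π]

lemma ofReal_tailProb (t : ℝ) :
    ENNReal.ofReal (tailProb π P t) = π {p | ENNReal.ofReal t < P p} :=
  ENNReal.ofReal_toReal (measure_ne_top _ _)

lemma tailProb_le_one (t : ℝ) : tailProb π P t ≤ 1 := ENNReal.toReal_mono (by simp) prob_le_one

lemma tailProb_antitone : Antitone (tailProb π P) := fun _ _ h =>
  ENNReal.toReal_mono (measure_ne_top _ _)
    (measure_mono fun _ hp => (ENNReal.ofReal_le_ofReal h).trans_lt hp)

lemma tendsto_tailProb (hP : Measurable P) (hPt : ∀ᵐ p ∂π, P p ≠ ∞) :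
    Tendsto (tailProb π P) atTop (𝓝 0) := by
  have h := tendsto_measure_iInter_atTop (μ := π) (s := fun t : ℝ => {p | ENNReal.ofReal t < P p})
    (fun t => (measurableSet_const_lt hP _).nullMeasurableSet)
    (fun _ _ h _ hp => (ENNReal.ofReal_le_ofReal h).trans_lt hp) ⟨0, measure_ne_top _ _⟩
  have h0 : π (⋂ t : ℝ, {p | ENNReal.ofReal t < P p}) = 0 := by
    rw [measure_eq_zero_iff_ae_notMem]
    filter_upwards [hPt] with p hp hmem
    have := Set.mem_iInter.1 hmem (P p).toReal
    rw [Set.mem_ofPred_eq, ENNReal.ofReal_toReal hp] at this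
    exact lt_irrefl _ this
  rw [h0] at h
  exact (ENNReal.tendsto_toReal ENNReal.zero_ne_top).comp h

lemma lintegral_truncLaplace_ne_top (u : ℝ) (s : Set E) :
    ∫⁻ p in s, expNeg (ENNReal.ofReal u * P p) ∂π ≠ ∞ :=
  ne_top_of_le_ne_top (b := 1) (by simp) <| by
    calc ∫⁻ p in s, expNeg (ENNReal.ofReal u * P p) ∂π ≤ ∫⁻ p in s, 1 ∂π :=
          lintegral_mono fun p => expNeg_le_one _
      _ ≤ 1 := by simpa using prob_le_one

lemma truncLaplace_le_one (u y : ℝ) : truncLaplace π P u y ≤ 1 := by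
  refine ENNReal.toReal_le_of_le_ofReal zero_le_one ?_
  calc ∫⁻ p in {p | P p ≤ ENNReal.ofReal y}, expNeg (ENNReal.ofReal u * P p) ∂π
      ≤ ∫⁻ p in {p | P p ≤ ENNReal.ofReal y}, 1 ∂π := lintegral_mono fun p => expNeg_le_one _
    _ ≤ ENNReal.ofReal 1 := by simpa using prob_le_one

lemma tailProb_sub_eq (hP : Measurable P) {x y : ℝ} (hxy : x ≤ y) :
    tailProb π P x - tailProb π P y =
      (π {p | ENNReal.ofReal x < P p ∧ P p ≤ ENNReal.ofReal y}).toReal := by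
  have hsub : {p | ENNReal.ofReal y < P p} ⊆ {p | ENNReal.ofReal x < P p} := fun _ hp =>
    (ENNReal.ofReal_le_ofReal hxy).trans_lt hp
  have := measureReal_sdiff (μ := π) hsub (measurableSet_const_lt hP _)
  rw [tailProb, tailProb, ← measureReal_def, ← measureReal_def, ← measureReal_def, ← this]
  congr 1
  ext p; simp

/-- The difference is the integral of exp(-uP) over x < P ≤ y, where the integrand lies between
exp(-uy) and exp(-ux). -/
lemma truncLaplace_sub_bounds (hP : Measurable P) {u x y : ℝ} (hu : 0 ≤ u) (hx : 0 ≤ x)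
    (hxy : x ≤ y) :
    Real.exp (-(u * y)) * (tailProb π P x - tailProb π P y) ≤
        truncLaplace π P u y - truncLaplace π P u x ∧
      truncLaplace π P u y - truncLaplace π P u x ≤
        Real.exp (-(u * x)) * (tailProb π P x - tailProb π P y) := by
  set A := {p | ENNReal.ofReal x < P p ∧ P p ≤ ENNReal.ofReal y}
  have hA : MeasurableSet A := (measurableSet_const_lt hP _).inter (measurableSet_le_const hP _)
  have hunion : {p | P p ≤ ENNReal.ofReal y} = {p | P p ≤ ENNReal.ofReal x} ∪ A := by
    ext p
    have := ENNReal.ofReal_le_ofReal hxy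
    simp only [A, Set.mem_ofPred_eq, Set.mem_union]
    constructor
    · intro h; rcases le_or_gt (P p) (ENNReal.ofReal x) with h' | h' <;> tauto
    · rintro (h | h); exacts [h.trans this, h.2]
  have hdisj : Disjoint {p | P p ≤ ENNReal.ofReal x} A :=
    Set.disjoint_left.2 fun p h1 h2 => (h2.1.trans_le h1).false
  have hsub : truncLaplace π P u y - truncLaplace π P u x =
      (∫⁻ p in A, expNeg (ENNReal.ofReal u * P p) ∂π).toReal := by
    rw [truncLaplace, truncLaplace, hunion, lintegral_union hA hdisj,
      ENNReal.toReal_add (lintegral_truncLaplace_ne_top _ _) (lintegral_truncLaplace_ne_top _ _)]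
    ring
  have hmul : ∀ z : ℝ, 0 ≤ z → expNeg (ENNReal.ofReal u * ENNReal.ofReal z) =
      ENNReal.ofReal (Real.exp (-(u * z))) := fun z hz => by
    rw [← ENNReal.ofReal_mul hu, expNeg_ofReal (mul_nonneg hu hz)]
  rw [hsub, tailProb_sub_eq hP hxy]
  have hlow : ENNReal.ofReal (Real.exp (-(u * y))) * π A ≤
      ∫⁻ p in A, expNeg (ENNReal.ofReal u * P p) ∂π := by
    rw [← hmul y (hx.trans hxy), ← setLIntegral_const]
    exact setLIntegral_mono' hA fun p hp => expNeg_antitone (by gcongr; exact hp.2)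
  have hup : ∫⁻ p in A, expNeg (ENNReal.ofReal u * P p) ∂π ≤
      ENNReal.ofReal (Real.exp (-(u * x))) * π A := by
    rw [← hmul x hx, ← setLIntegral_const]
    exact setLIntegral_mono' hA fun p hp => expNeg_antitone (by gcongr; exact hp.1.le)
  constructor
  · have := ENNReal.toReal_mono (lintegral_truncLaplace_ne_top _ _) hlow
    rwa [ENNReal.toReal_mul, ENNReal.toReal_ofReal (Real.exp_nonneg _)] at this
  · have := ENNReal.toReal_mono (ENNReal.mul_ne_top (by simp) (measure_ne_top _ _)) hup
    rwa [ENNReal.toReal_mul, ENNReal.toReal_ofReal (Real.exp_nonneg _)] at this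

lemma integral_mul_exp_neg (s v : ℝ) :
    ∫ u in (0 : ℝ)..v, s * Real.exp (-(s * u)) = 1 - Real.exp (-(s * v)) := by
  have : ∀ u ∈ Set.uIcc 0 v, HasDerivAt (fun u => -Real.exp (-(s * u)))
      (s * Real.exp (-(s * u))) u := by
    intro u _
    have h : HasDerivAt (fun u => -(s * u)) (-s) u := by
      simpa using ((hasDerivAt_id' u).const_mul s).fun_neg
    convert! h.exp.neg using 1
    ring
  rw [intervalIntegral.integral_eq_sub_of_hasDerivAt this
    (Continuous.intervalIntegrable (by fun_prop) _ _)]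
  simp; ring

lemma lintegral_mul_exp_neg {s v : ℝ} (hs : 0 ≤ s) (hv : 0 ≤ v) :
    ∫⁻ u in Set.Ioo 0 v, ENNReal.ofReal (s * Real.exp (-(s * u))) =
      ENNReal.ofReal (1 - Real.exp (-(s * v))) := by
  rw [restrict_Ioo_eq_restrict_Ioc, ← integral_mul_exp_neg, intervalIntegral.integral_of_le hv,
    ofReal_integral_eq_lintegral_ofReal]
  · exact (Continuous.integrableOn_Icc (by fun_prop)).mono_set Set.Ioc_subset_Icc_self
  · exact .of_forall fun u => by positivity

/-- A layer-cake formula: for P ≤ x, 1 - exp(-sP/x) is the integral of s·exp(-su) over 0 < u < P/x;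
for P > x, the integral over (0, 1) and exp(-s) add up to 1. Tonelli then leaves an expression in
the tail alone, into which regular variation can be inserted. -/
lemma one_sub_truncLaplace (hP : Measurable P) {s x : ℝ} (hs : 0 ≤ s) (hx : 0 < x) :
    1 - truncLaplace π P (s / x) x = Real.exp (-s) * tailProb π P x +
      ∫ u in (0 : ℝ)..1, s * Real.exp (-(s * u)) * tailProb π P (x * u) := by
  classical
  set u₀ := ENNReal.ofReal (s / x)
  have hset := measurableSet_le_const hP (ENNReal.ofReal x)
  have hpt : ∀ p, 1 - {p | P p ≤ ENNReal.ofReal x}.indicator (fun p => expNeg (u₀ * P p)) p =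
      {p | ENNReal.ofReal x < P p}.indicator (fun _ => ENNReal.ofReal (Real.exp (-s))) p +
      ∫⁻ u in Set.Ioo (0 : ℝ) 1, {u : ℝ | ENNReal.ofReal (x * u) < P p}.indicator
        (fun u => ENNReal.ofReal (s * Real.exp (-(s * u)))) u := by
    intro p
    have hmu : MeasurableSet {u : ℝ | ENNReal.ofReal (x * u) < P p} :=
      measurableSet_lt (by fun_prop) measurable_const
    rw [lintegral_indicator hmu, Measure.restrict_restrict hmu]
    rcases le_or_gt (P p) (ENNReal.ofReal x) with h | h
    · rw [Set.indicator_of_mem (show p ∈ {p | P p ≤ ENNReal.ofReal x} from h),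
        Set.indicator_of_notMem (show p ∉ {p | ENNReal.ofReal x < P p} from not_lt.2 h), zero_add]
      have hfin : P p ≠ ∞ := ne_top_of_le_ne_top (by simp) h
      set v := (P p).toReal with hv
      have hPv : P p = ENNReal.ofReal v := (ENNReal.ofReal_toReal hfin).symm
      have hv0 : 0 ≤ v := ENNReal.toReal_nonneg
      have hvx : v ≤ x := by rw [hPv] at h; exact (ENNReal.ofReal_le_ofReal_iff hx.le).1 h
      have hS : {u : ℝ | ENNReal.ofReal (x * u) < P p} ∩ Set.Ioo 0 1 = Set.Ioo 0 (v / x) := by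
        ext u
        simp only [Set.mem_inter_iff, Set.mem_ofPred_eq, Set.mem_Ioo, hPv]
        rw [lt_div_iff₀ hx]
        constructor
        · rintro ⟨h1, h2, h3⟩
          have := (ENNReal.ofReal_lt_ofReal_iff_of_nonneg (by positivity)).1 h1
          exact ⟨h2, by linarith⟩
        · rintro ⟨h1, h2⟩
          refine ⟨(ENNReal.ofReal_lt_ofReal_iff_of_nonneg (by positivity)).2 (by linarith), h1, ?_⟩
          nlinarith
      rw [hS, lintegral_mul_exp_neg hs (by positivity), hPv, ← ENNReal.ofReal_mul (by positivity),
        expNeg_ofReal (by positivity), ENNReal.ofReal_sub _ (Real.exp_nonneg _), ENNReal.ofReal_one]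
      congr 4; ring
    · rw [Set.indicator_of_notMem (show p ∉ {p | P p ≤ ENNReal.ofReal x} from not_le.2 h),
        Set.indicator_of_mem (show p ∈ {p | ENNReal.ofReal x < P p} from h)]
      have hS : {u : ℝ | ENNReal.ofReal (x * u) < P p} ∩ Set.Ioo 0 1 = Set.Ioo 0 1 := by
        refine Set.inter_eq_right.2 fun u hu => ?_
        exact (ENNReal.ofReal_le_ofReal (by nlinarith [hu.1, hu.2])).trans_lt h
      rw [hS, lintegral_mul_exp_neg hs zero_le_one, ← ENNReal.ofReal_add (Real.exp_nonneg _)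
        (by simpa using hs)]
      simp
  have hind : ∀ p, {p | P p ≤ ENNReal.ofReal x}.indicator (fun p => expNeg (u₀ * P p)) p ≤ 1 :=
    fun p => Set.indicator_le' (fun _ _ => expNeg_le_one _) (fun _ _ => zero_le_one) p
  have hmeas : Measurable ({p | P p ≤ ENNReal.ofReal x}.indicator (fun p => expNeg (u₀ * P p))) :=
    (measurable_expNeg.comp (hP.const_mul _)).indicator hset
  have hle : ∫⁻ p, {p | P p ≤ ENNReal.ofReal x}.indicator (fun p => expNeg (u₀ * P p)) p ∂π ≤ 1 :=
    (lintegral_mono hind).trans (by simp)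
  have hL : ENNReal.ofReal (1 - truncLaplace π P (s / x) x) =
      ∫⁻ p, (1 - {p | P p ≤ ENNReal.ofReal x}.indicator (fun p => expNeg (u₀ * P p)) p) ∂π := by
    rw [lintegral_sub hmeas (ne_top_of_le_ne_top (by simp) hle) (.of_forall hind),
      truncLaplace, ENNReal.ofReal_sub _ ENNReal.toReal_nonneg, lintegral_indicator hset,
      ENNReal.ofReal_toReal (lintegral_truncLaplace_ne_top _ _)]
    simp [u₀]
  have hanti : Antitone fun u : ℝ => tailProb π P (x * u) := fun a b hab =>
    tailProb_antitone (mul_le_mul_of_nonneg_left hab hx.le)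
  have hint : IntervalIntegrable (fun u => s * Real.exp (-(s * u)) * tailProb π P (x * u))
      volume 0 1 :=
    (hanti.intervalIntegrable).continuousOn_mul (by fun_prop)
  have hR : ∫⁻ p, ({p | ENNReal.ofReal x < P p}.indicator
        (fun _ => ENNReal.ofReal (Real.exp (-s))) p +
      ∫⁻ u in Set.Ioo (0 : ℝ) 1, {u : ℝ | ENNReal.ofReal (x * u) < P p}.indicator
        (fun u => ENNReal.ofReal (s * Real.exp (-(s * u)))) u) ∂π =
      ENNReal.ofReal (Real.exp (-s) * tailProb π P x +
        ∫ u in (0 : ℝ)..1, s * Real.exp (-(s * u)) * tailProb π P (x * u)) := by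
    have hnn : ∀ u : ℝ, 0 ≤ s * Real.exp (-(s * u)) * tailProb π P (x * u) := fun u =>
      mul_nonneg (by positivity) (tailProb_nonneg _)
    rw [lintegral_add_left (measurable_const.indicator (measurableSet_const_lt hP _)),
      lintegral_indicator (measurableSet_const_lt hP _), setLIntegral_const,
      ENNReal.ofReal_add (mul_nonneg (Real.exp_nonneg _) (tailProb_nonneg _))
        (intervalIntegral.integral_nonneg zero_le_one fun u _ => hnn u),
      ENNReal.ofReal_mul (Real.exp_nonneg _), ofReal_tailProb]
    congr 1
    rw [lintegral_lintegral_swap]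
    · rw [intervalIntegral.integral_of_le zero_le_one, ofReal_integral_eq_lintegral_ofReal
        ((intervalIntegrable_iff_integrableOn_Ioc_of_le zero_le_one).1 hint) (.of_forall hnn),
        ← restrict_Ioo_eq_restrict_Ioc]
      refine lintegral_congr fun u => ?_
      rw [ENNReal.ofReal_mul (by positivity), ofReal_tailProb, ← setLIntegral_const,
        ← lintegral_indicator (measurableSet_const_lt hP _)]
      rfl
    · have : Function.uncurry (fun p (u : ℝ) => {u : ℝ | ENNReal.ofReal (x * u) < P p}.indicator
          (fun u => ENNReal.ofReal (s * Real.exp (-(s * u)))) u) =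
          {q : E × ℝ | ENNReal.ofReal (x * q.2) < P q.1}.indicator
            (fun q => ENNReal.ofReal (s * Real.exp (-(s * q.2)))) := rfl
      rw [this]
      exact (Measurable.indicator (by fun_prop)
        (measurableSet_lt (by fun_prop) (by fun_prop))).aemeasurable
  have := hL.trans ((lintegral_congr hpt).trans hR)
  rwa [ENNReal.ofReal_eq_ofReal_iff (sub_nonneg.2 (truncLaplace_le_one _ _))] at this
  exact add_nonneg (mul_nonneg (Real.exp_nonneg _) (tailProb_nonneg _))
    (intervalIntegral.integral_nonneg zero_le_one fun u _ =>
      mul_nonneg (by positivity) (tailProb_nonneg _))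

end Tail

/-! ### Joint law of the sum and the maximum -/

namespace IsPoissonProcess

variable {Ω E : Type*} [MeasurableSpace Ω] [MeasurableSpace E]
  {Φ : Ω → Set E} {π : Measure E} {μ : Measure Ω} {P : E → ℝ≥0∞}
  [IsProbabilityMeasure π] [IsProbabilityMeasure μ] {c : ℝ≥0}

/-- Laplace functional at the function `f` equal to uP where P ≤ y and to ∞ elsewhere: one point
above y makes the sum infinite, so its exponential carries the indicator of the event that all
powers are at most y. -/
lemma setLIntegral_expNeg_mul_tsum (h : IsPoissonProcess Φ (c • π) μ) (hP : Measurable P)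
    (u y : ℝ) :
    ∫⁻ ω in {ω | ∀ p ∈ Φ ω, P p ≤ ENNReal.ofReal y}, expNeg (ENNReal.ofReal u * ∑' q : Φ ω, P q) ∂μ
      = ENNReal.ofReal (Real.exp (-(c * (1 - truncLaplace π P u y)))) := by
  classical
  have hset := measurableSet_le_const hP (ENNReal.ofReal y)
  set f : E → ℝ≥0∞ := fun p => if P p ≤ ENNReal.ofReal y then ENNReal.ofReal u * P p else ∞
  have hf : Measurable f := Measurable.ite hset (hP.const_mul _) measurable_const
  have h1 : ∀ ω, {ω | ∀ p ∈ Φ ω, P p ≤ ENNReal.ofReal y}.indicator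
      (fun ω => expNeg (ENNReal.ofReal u * ∑' q : Φ ω, P q)) ω = expNeg (∑' q : Φ ω, f q) := by
    intro ω
    by_cases hω : ∀ p ∈ Φ ω, P p ≤ ENNReal.ofReal y
    · rw [Set.indicator_of_mem (show ω ∈ {ω | ∀ p ∈ Φ ω, P p ≤ ENNReal.ofReal y} from hω),
        ← ENNReal.tsum_mul_left]
      congr 2
      funext q
      exact (if_pos (hω q q.2)).symm
    · rw [Set.indicator_of_notMem (show ω ∉ {ω | ∀ p ∈ Φ ω, P p ≤ ENNReal.ofReal y} from hω)]
      push Not at hω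
      obtain ⟨p, hp, hpy⟩ := hω
      have : ∑' q : Φ ω, f q = ∞ :=
        ENNReal.tsum_eq_top_of_eq_top ⟨⟨p, hp⟩, if_neg (not_le.2 hpy)⟩
      rw [this, expNeg_top]
  rw [← lintegral_indicator (h.measurableSet_forall_le hP _), lintegral_congr h1,
    h.lintegral_expNeg_tsum hf]
  have h2 : ∫⁻ p, (1 - expNeg (f p)) ∂π = ENNReal.ofReal (1 - truncLaplace π P u y) := by
    have h3 : ∀ p, expNeg (f p) = {p | P p ≤ ENNReal.ofReal y}.indicator
        (fun p => expNeg (ENNReal.ofReal u * P p)) p := by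
      intro p
      by_cases hp : P p ≤ ENNReal.ofReal y
      · simp [f, hp]
      · simp [f, hp]
    have h4 : ∫⁻ p, expNeg (f p) ∂π =
        ∫⁻ p in {p | P p ≤ ENNReal.ofReal y}, expNeg (ENNReal.ofReal u * P p) ∂π := by
      rw [lintegral_congr h3, lintegral_indicator hset]
    have h6 : Measurable fun p => expNeg (f p) := measurable_expNeg.comp hf
    rw [lintegral_sub h6
      (by rw [h4]; exact lintegral_truncLaplace_ne_top _ _) (.of_forall fun p => expNeg_le_one _),
      truncLaplace, ENNReal.ofReal_sub _ ENNReal.toReal_nonneg, h4,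
      ENNReal.ofReal_toReal (lintegral_truncLaplace_ne_top _ _)]
    simp
  rw [lintegral_smul_measure, h2]
  have h5 : c • ENNReal.ofReal (1 - truncLaplace π P u y) =
      ENNReal.ofReal (c * (1 - truncLaplace π P u y)) := by
    rw [ENNReal.ofReal_mul c.coe_nonneg, ENNReal.ofReal_coe_nnreal]; rfl
  rw [h5, expNeg_ofReal (mul_nonneg c.coe_nonneg (sub_nonneg.2 (truncLaplace_le_one _ _)))]

lemma setLIntegral_expNeg_mul_tsum_Ioc (h : IsPoissonProcess Φ (c • π) μ) (hP : Measurable P)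
    (u : ℝ) {x y : ℝ} (hxy : x ≤ y) :
    ∫⁻ ω in {ω | (∀ p ∈ Φ ω, P p ≤ ENNReal.ofReal y) ∧ ¬ ∀ p ∈ Φ ω, P p ≤ ENNReal.ofReal x},
        expNeg (ENNReal.ofReal u * ∑' q : Φ ω, P q) ∂μ
      = ENNReal.ofReal (Real.exp (-(c * (1 - truncLaplace π P u y))) -
          Real.exp (-(c * (1 - truncLaplace π P u x)))) := by
  have hx := h.measurableSet_forall_le hP (ENNReal.ofReal x)
  have hy := h.measurableSet_forall_le hP (ENNReal.ofReal y)
  rw [ENNReal.ofReal_sub _ (Real.exp_nonneg _), ← h.setLIntegral_expNeg_mul_tsum hP,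
    ← h.setLIntegral_expNeg_mul_tsum hP]
  have hunion : {ω | ∀ p ∈ Φ ω, P p ≤ ENNReal.ofReal y} = {ω | ∀ p ∈ Φ ω, P p ≤ ENNReal.ofReal x} ∪
      {ω | (∀ p ∈ Φ ω, P p ≤ ENNReal.ofReal y) ∧ ¬ ∀ p ∈ Φ ω, P p ≤ ENNReal.ofReal x} := by
    ext ω
    have := ENNReal.ofReal_le_ofReal hxy
    simp only [Set.mem_ofPred_eq, Set.mem_union]
    constructor
    · tauto
    · rintro (h | h)
      exacts [fun p hp => (h p hp).trans this, h.1]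
  have hdiff : MeasurableSet {ω | (∀ p ∈ Φ ω, P p ≤ ENNReal.ofReal y) ∧
      ¬ ∀ p ∈ Φ ω, P p ≤ ENNReal.ofReal x} := hy.inter hx.compl
  have hdisj : Disjoint {ω | ∀ p ∈ Φ ω, P p ≤ ENNReal.ofReal x}
      {ω | (∀ p ∈ Φ ω, P p ≤ ENNReal.ofReal y) ∧ ¬ ∀ p ∈ Φ ω, P p ≤ ENNReal.ofReal x} :=
    Set.disjoint_left.2 fun ω h1 h2 => h2.2 h1
  rw [hunion, lintegral_union hdiff hdisj, ENNReal.add_sub_cancel_left]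
  rw [h.setLIntegral_expNeg_mul_tsum hP]
  simp

/-- The case u = 0 of the joint transform. -/
lemma measure_forall_le (h : IsPoissonProcess Φ (c • π) μ) (hP : Measurable P) (y : ℝ) :
    μ {ω | ∀ p ∈ Φ ω, P p ≤ ENNReal.ofReal y} =
      ENNReal.ofReal (Real.exp (-(c * tailProb π P y))) := by
  have h1 := h.setLIntegral_expNeg_mul_tsum hP 0 y
  simp only [ENNReal.ofReal_zero, zero_mul, expNeg_zero, setLIntegral_one] at h1
  rw [h1]
  congr 4
  rw [truncLaplace, tailProb]
  simp only [ENNReal.ofReal_zero, zero_mul, expNeg_zero, setLIntegral_one]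
  have := prob_compl_eq_one_sub (μ := π) (measurableSet_const_lt hP (ENNReal.ofReal y))
  rw [show {p | P p ≤ ENNReal.ofReal y} = {p | ENNReal.ofReal y < P p}ᶜ by ext; simp, this,
    ENNReal.toReal_sub_of_le prob_le_one (by simp)]
  simp

end IsPoissonProcess

/-! ### Potter's bound and the limit factor -/

section RegularVariation

/-- Since β > α, eventually T(x) ≤ 2^β T(2x); iterating this from y up to x gives a power bound. It
serves as the dominating function in `tendsto_one_sub_truncLaplace_div`, where β < 1 makes u^(-β)
integrable at 0. -/
lemma RegularlyVarying.exists_potter_bound {T : ℝ → ℝ} {α β : ℝ} (hT : RegularlyVarying T (-α))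
    (hanti : Antitone T) (hle : ∀ x, T x ≤ 1) (hβ : 0 ≤ β) (hαβ : α < β) :
    ∃ C x₀ : ℝ, 0 < x₀ ∧ ∀ x, x₀ ≤ x → ∀ u, 0 < u → u ≤ 1 → T (x * u) ≤ C * u ^ (-β) * T x := by
  obtain ⟨hpos, -, hlim⟩ := hT
  have h2 : ∀ᶠ x in atTop, T x ≤ 2 ^ β * T (2 * x) := by
    have h3 : (2 : ℝ) ^ (-β) < 2 ^ (-α) := Real.rpow_lt_rpow_of_exponent_lt one_lt_two (by linarith)
    filter_upwards [(hlim 2 two_pos).eventually_const_lt h3, eventually_gt_atTop 0] with x hx hx0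
    rw [lt_div_iff₀ (hpos x hx0), Real.rpow_neg two_pos.le, inv_mul_lt_iff₀ (by positivity)] at hx
    exact hx.le
  obtain ⟨x₁, hx₁⟩ := eventually_atTop.1 h2
  set x₀ := max x₁ 1
  have hx₀ : 0 < x₀ := lt_max_of_lt_right one_pos
  have hiter : ∀ n : ℕ, ∀ y, x₀ ≤ y → T y ≤ (2 ^ β) ^ n * T (2 ^ n * y) := by
    intro n
    induction n with
    | zero => intro y _; simp
    | succ n ih =>
      intro y hy
      have h1 : x₀ ≤ 2 ^ n * y := hy.trans
        (le_mul_of_one_le_left (hx₀.le.trans hy) (one_le_pow₀ one_le_two))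
      calc T y ≤ (2 ^ β) ^ n * T (2 ^ n * y) := ih y hy
        _ ≤ (2 ^ β) ^ n * (2 ^ β * T (2 * (2 ^ n * y))) := by
            gcongr; exact hx₁ _ ((le_max_left _ _).trans h1)
        _ = _ := by rw [pow_succ, pow_succ]; ring_nf
  -- With 2^n ≤ x/y < 2^(n+1), use n + 1 doublings to pass x; the surplus doubling costs the leading
  -- factor 2^β.
  have hpot : ∀ x y, x₀ ≤ y → y ≤ x → T y ≤ 2 ^ β * (x / y) ^ β * T x := by
    intro x y hy hyx
    have hy0 : 0 < y := hx₀.trans_le hy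
    obtain ⟨n, hn1, hn2⟩ := exists_nat_pow_near ((one_le_div hy0).2 hyx) one_lt_two
    have hTx := (hpos x (hy0.trans_le hyx)).le
    calc T y ≤ (2 ^ β) ^ (n + 1) * T (2 ^ (n + 1) * y) := hiter _ y hy
      _ ≤ (2 ^ β) ^ (n + 1) * T x := by
          gcongr; exact hanti ((div_lt_iff₀ hy0).1 hn2).le
      _ = 2 ^ β * ((2 ^ n : ℝ) ^ β) * T x := by
          rw [pow_succ', ← Real.rpow_natCast (2 ^ β), ← Real.rpow_mul two_pos.le, mul_comm β,
            Real.rpow_mul two_pos.le, Real.rpow_natCast]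
      _ ≤ _ := by gcongr
  -- Division by T(x₀) ≤ 1 covers x·u < x₀, where the doubling estimate is not available and T ≤ 1
  -- is compared with T(x₀).
  refine ⟨2 ^ β / T x₀, x₀, hx₀, fun x hx u hu hu1 => ?_⟩
  have hx0 : 0 < x := hx₀.trans_le hx
  have hTx := hpos x hx0
  have hT0 := hpos x₀ hx₀
  rcases le_total x₀ (x * u) with h | h
  · calc T (x * u) ≤ 2 ^ β * (x / (x * u)) ^ β * T x := hpot _ _ h (by nlinarith)
      _ = 2 ^ β * u ^ (-β) * T x := by
          rw [Real.rpow_neg hu.le, ← Real.inv_rpow hu.le]; congr 3; field_simp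
      _ ≤ _ := by gcongr; exact le_div_self (by positivity) hT0 (hle _)
  · calc T (x * u) ≤ 1 := hle _
      _ = (T x₀)⁻¹ * T x₀ := by field_simp
      _ ≤ (T x₀)⁻¹ * (2 ^ β * (x / x₀) ^ β * T x) := by gcongr; exact hpot _ _ le_rfl hx
      _ ≤ (T x₀)⁻¹ * (2 ^ β * u ^ (-β) * T x) := by
          gcongr
          rw [Real.rpow_neg hu.le, ← Real.inv_rpow hu.le]
          gcongr
          rw [inv_eq_one_div, div_le_div_iff₀ hx₀ hu]
          linarith
      _ = _ := by ring

/-- The limit of `E[1 - exp (-s P / x) 1(P ≤ x)] / P(P > x)` as `x → ∞`, when `P` has a regularly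
varying tail of index `-α`. -/
noncomputable def limitFactor (α s : ℝ) : ℝ :=
  Real.exp (-s) + ∫ u in (0 : ℝ)..1, s * Real.exp (-(s * u)) * u ^ (-α)

variable {E : Type*} [MeasurableSpace E] {π : Measure E} {P : E → ℝ≥0∞} [IsProbabilityMeasure π]

lemma intervalIntegrable_exp_mul_rpow {α : ℝ} (hα1 : α < 1) (s : ℝ) :
    IntervalIntegrable (fun u => s * Real.exp (-(s * u)) * u ^ (-α)) volume 0 1 :=
  (intervalIntegral.intervalIntegrable_rpow' (by linarith)).continuousOn_mul (by fun_prop)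

/-- In the layer-cake formula T(xu)/T(x) tends to u^(-α); Potter's bound with an exponent between α
and 1 dominates it. -/
lemma tendsto_one_sub_truncLaplace_div (hP : Measurable P) {α : ℝ} (hα : 0 ≤ α) (hα1 : α < 1)
    (hT : RegularlyVarying (tailProb π P) (-α)) {s : ℝ} (hs : 0 ≤ s) :
    Tendsto (fun x => (1 - truncLaplace π P (s / x) x) / tailProb π P x) atTop
      (𝓝 (limitFactor α s)) := by
  obtain ⟨β, hαβ, hβ1⟩ := exists_between hα1
  obtain ⟨C, x₀, hx₀, hC⟩ := hT.exists_potter_bound tailProb_antitone tailProb_le_one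
    (hα.trans hαβ.le) hαβ
  obtain ⟨hpos, -, hlim⟩ := hT
  have h1 : Tendsto (fun x => Real.exp (-s) + ∫ u in (0 : ℝ)..1,
      s * Real.exp (-(s * u)) * (tailProb π P (x * u) / tailProb π P x)) atTop
      (𝓝 (limitFactor α s)) := by
    refine tendsto_const_nhds.add ?_
    refine intervalIntegral.tendsto_integral_filter_of_dominated_convergence
      (fun u => s * Real.exp (-(s * u)) * (C * u ^ (-β))) ?_ ?_ ?_ ?_
    · filter_upwards [eventually_gt_atTop 0] with x hx
      have hanti : Antitone fun u : ℝ => tailProb π P (x * u) := fun a b hab =>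
        tailProb_antitone (mul_le_mul_of_nonneg_left hab hx.le)
      exact (Measurable.mul (by fun_prop) (hanti.measurable.div_const _)).aestronglyMeasurable
    · filter_upwards [eventually_ge_atTop x₀] with x hx
      refine .of_forall fun u hu => ?_
      rw [Set.uIoc_of_le zero_le_one] at hu
      have hTx := hpos x (hx₀.trans_le hx)
      have hTu := tailProb_nonneg (π := π) (P := P) (x * u)
      rw [Real.norm_of_nonneg (by positivity)]
      gcongr
      rw [div_le_iff₀ hTx]
      exact hC x hx u hu.1 hu.2
    · have := (intervalIntegrable_exp_mul_rpow hβ1 s).const_mul C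
      refine this.congr fun u _ => ?_
      ring
    · refine .of_forall fun u hu => ?_
      rw [Set.uIoc_of_le zero_le_one] at hu
      refine Tendsto.const_mul _ ?_
      simpa only [mul_comm u] using hlim u hu.1
  refine h1.congr' ?_
  filter_upwards [eventually_gt_atTop 0] with x hx
  have hTx := hpos x hx
  rw [one_sub_truncLaplace hP hs hx, add_div, mul_div_cancel_right₀ _ hTx.ne',
    ← intervalIntegral.integral_div]
  congr 1
  refine intervalIntegral.integral_congr fun u _ => ?_
  ring

lemma one_le_limitFactor {α s : ℝ} (hα : 0 ≤ α) (hα1 : α < 1) (hs : 0 ≤ s) :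
    1 ≤ limitFactor α s := by
  have h1 : ∫ u in (0 : ℝ)..1, s * Real.exp (-(s * u)) = 1 - Real.exp (-s) := by
    rw [integral_mul_exp_neg, mul_one]
  have h2 : ∫ u in (0 : ℝ)..1, s * Real.exp (-(s * u)) ≤
      ∫ u in (0 : ℝ)..1, s * Real.exp (-(s * u)) * u ^ (-α) := by
    refine intervalIntegral.integral_mono_on_of_le_Ioo zero_le_one
      (Continuous.intervalIntegrable (by fun_prop) _ _)
      (intervalIntegrable_exp_mul_rpow hα1 s) fun u hu => ?_
    refine le_mul_of_one_le_right (by positivity) ?_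
    exact Real.one_le_rpow_of_pos_of_le_one_of_nonpos hu.1 hu.2.le (by linarith)
  unfold limitFactor
  linarith

lemma limitFactor_zero_left (s : ℝ) : limitFactor 0 s = 1 := by
  simp only [limitFactor, neg_zero, Real.rpow_zero, mul_one, integral_mul_exp_neg]
  ring

/-- Linear growth in s is what later rules out a point mass as limit law. -/
lemma limitFactor_le {α s : ℝ} (hα1 : α < 1) (hs : 0 ≤ s) :
    limitFactor α s ≤ 1 + s / (1 - α) := by
  have h1 : ∫ u in (0 : ℝ)..1, u ^ (-α) = 1 / (1 - α) := by
    rw [integral_rpow (.inl (by linarith))]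
    rw [Real.one_rpow, Real.zero_rpow (by linarith), neg_add_eq_sub, sub_zero]
  have h2 : ∫ u in (0 : ℝ)..1, s * Real.exp (-(s * u)) * u ^ (-α) ≤
      ∫ u in (0 : ℝ)..1, s * u ^ (-α) := by
    refine intervalIntegral.integral_mono_on_of_le_Ioo zero_le_one
      (intervalIntegrable_exp_mul_rpow hα1 s)
      ((intervalIntegral.intervalIntegrable_rpow' (by linarith)).const_mul s) fun u hu => ?_
    have : Real.exp (-(s * u)) ≤ 1 := Real.exp_le_one_iff.2 (by nlinarith [hu.1])
    have h0 : 0 ≤ u ^ (-α) := Real.rpow_nonneg hu.1.le _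
    gcongr
    nlinarith
  rw [intervalIntegral.integral_const_mul, h1] at h2
  have h3 : Real.exp (-s) ≤ 1 := Real.exp_le_one_iff.2 (by linarith)
  unfold limitFactor
  rw [mul_one_div] at h2
  linarith

/-- Keep only u ≤ 1/s, where exp(-su) ≥ 1/e and u^(-α) ≥ s^α. Divergence as s → ∞ later shows that
the limit law has no mass at ∞. -/
lemma rpow_div_exp_le_limitFactor {α s : ℝ} (hα : 0 ≤ α) (hα1 : α < 1) (hs : 1 ≤ s) :
    s ^ α / Real.exp 1 ≤ limitFactor α s := by
  have hs0 : 0 < s := by linarith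
  have h0 : ∀ u ∈ Set.Ioo (0 : ℝ) 1, 0 ≤ s * Real.exp (-(s * u)) * u ^ (-α) := fun u hu =>
    mul_nonneg (by positivity) (Real.rpow_nonneg hu.1.le _)
  have hint := intervalIntegrable_exp_mul_rpow hα1 s
  have hs1 : s⁻¹ ≤ 1 := inv_le_one_of_one_le₀ hs
  have hsi : (0 : ℝ) ≤ s⁻¹ := by positivity
  have h1 : ∫ u in (0 : ℝ)..s⁻¹, s * Real.exp (-(s * u)) * u ^ (-α) ≤
      ∫ u in (0 : ℝ)..1, s * Real.exp (-(s * u)) * u ^ (-α) := by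
    refine intervalIntegral.integral_mono_interval le_rfl hsi hs1 ?_ hint
    rw [← restrict_Ioo_eq_restrict_Ioc]
    exact (ae_restrict_mem measurableSet_Ioo).mono h0
  have h2 : ∫ u in (0 : ℝ)..s⁻¹, s * Real.exp (-1) * s ^ α ≤
      ∫ u in (0 : ℝ)..s⁻¹, s * Real.exp (-(s * u)) * u ^ (-α) := by
    refine intervalIntegral.integral_mono_on_of_le_Ioo hsi (by simp)
      (hint.mono_set ?_) fun u hu => ?_
    · rw [Set.uIcc_of_le hsi, Set.uIcc_of_le zero_le_one]
      exact Set.Icc_subset_Icc_right hs1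
    · have h3 : s * u ≤ 1 := by
        have := mul_le_mul_of_nonneg_left hu.2.le hs0.le
        rwa [mul_inv_cancel₀ hs0.ne'] at this
      gcongr
      rw [Real.rpow_neg hu.1.le, ← Real.inv_rpow hu.1.le]
      gcongr
      rw [le_inv_comm₀ hs0 hu.1]
      exact hu.2.le
  rw [intervalIntegral.integral_const] at h2
  have h4 : (s⁻¹ - 0) • (s * Real.exp (-1) * s ^ α) = s ^ α / Real.exp 1 := by
    rw [Real.exp_neg, smul_eq_mul]; field_simp; simp
  have := Real.exp_nonneg (-s)
  unfold limitFactor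
  linarith

end RegularVariation

/-! ### Two-sided bounds on the Laplace transform of 1/SINR + 1 -/

namespace IsPoissonProcess

variable {Ω E : Type*} [MeasurableSpace Ω] [MeasurableSpace E]
  {Φ : Ω → Set E} {Λ : Measure E} {μ : Measure Ω} {P : E → ℝ≥0∞}

lemma setLIntegral_forall_le_eq_add_sum (h : IsPoissonProcess Φ Λ μ) (hP : Measurable P)
    {x : ℕ → ℝ} (hx : Monotone x) (q : Ω → ℝ≥0∞) (K : ℕ) :
    ∫⁻ ω in {ω | ∀ p ∈ Φ ω, P p ≤ ENNReal.ofReal (x K)}, q ω ∂μ =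
      ∫⁻ ω in {ω | ∀ p ∈ Φ ω, P p ≤ ENNReal.ofReal (x 0)}, q ω ∂μ +
      ∑ k ∈ Finset.range K, ∫⁻ ω in {ω | (∀ p ∈ Φ ω, P p ≤ ENNReal.ofReal (x (k + 1))) ∧
        ¬ ∀ p ∈ Φ ω, P p ≤ ENNReal.ofReal (x k)}, q ω ∂μ := by
  induction K with
  | zero => simp
  | succ K ih =>
    rw [Finset.sum_range_succ, ← add_assoc, ← ih]
    have hx1 := h.measurableSet_forall_le hP (ENNReal.ofReal (x K))
    have hdiff : MeasurableSet {ω | (∀ p ∈ Φ ω, P p ≤ ENNReal.ofReal (x (K + 1))) ∧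
        ¬ ∀ p ∈ Φ ω, P p ≤ ENNReal.ofReal (x K)} :=
      (h.measurableSet_forall_le hP (ENNReal.ofReal (x (K + 1)))).inter hx1.compl
    have hdisj : Disjoint {ω | ∀ p ∈ Φ ω, P p ≤ ENNReal.ofReal (x K)}
        {ω | (∀ p ∈ Φ ω, P p ≤ ENNReal.ofReal (x (K + 1))) ∧
          ¬ ∀ p ∈ Φ ω, P p ≤ ENNReal.ofReal (x K)} :=
      Set.disjoint_left.2 fun ω h1 h2 => h2.2 h1
    rw [← lintegral_union hdiff hdisj]
    congr 2
    ext ω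
    have := ENNReal.ofReal_le_ofReal (hx (Nat.le_add_right K 1))
    simp only [Set.mem_ofPred_eq, Set.mem_union]
    constructor
    · tauto
    · rintro (h | h)
      exacts [fun p hp => (h p hp).trans this, h.1]

variable {π : Measure E} [IsProbabilityMeasure π] [IsProbabilityMeasure μ] {c : ℝ≥0}

/-- Decompose by the cell x_k < M ≤ x_(k+1) of the grid x_k = θ^k x₀ and replace M by x_k. With `a`
bounding (1 - g)/T and `b` bounding T(x)/T(θx), each cell dominates a multiple of an increment of
exp(-cabT), and the sum over the cells telescopes. -/
lemma lintegral_expNeg_inv_maxRatio_ge (h : IsPoissonProcess Φ (c • π) μ) (hP : Measurable P)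
    (hPt : ∀ᵐ p ∂π, P p ≠ ∞) (W : ℝ≥0) {s θ x₀ a b : ℝ} (hs : 0 ≤ s) (hθ : 1 < θ) (hx₀ : 0 < x₀)
    (ha : 0 < a) (hb : 0 < b)
    (h1 : ∀ x, x₀ ≤ x → 1 - truncLaplace π P (s / x) x ≤ a * tailProb π P x)
    (h2 : ∀ x, x₀ ≤ x → tailProb π P x ≤ b * tailProb π P (θ * x)) :
    ENNReal.ofReal (Real.exp (-(s * W / x₀)) * Real.exp (-(s * θ)) * (a * b)⁻¹ *
        (1 - Real.exp (-(c * a * b * tailProb π P x₀)))) ≤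
      ∫⁻ ω, expNeg (ENNReal.ofReal s * ((maxRatio P W (Φ ω))⁻¹ + 1)) ∂μ := by
  set T := tailProb π P with hTdef
  have hTanti : Antitone T := tailProb_antitone
  set x : ℕ → ℝ := fun k => θ ^ k * x₀ with hxdef
  have hθ0 : 0 < θ := one_pos.trans hθ
  have hxm : Monotone x := fun i j hij =>
    mul_le_mul_of_nonneg_right (pow_le_pow_right₀ hθ.le hij) hx₀.le
  have hx0 : x 0 = x₀ := by simp [x]
  have hxge : ∀ k, x₀ ≤ x k := fun k => hx0 ▸ hxm (Nat.zero_le k)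
  have hxpos : ∀ k, 0 < x k := fun k => hx₀.trans_le (hxge k)
  have hxs : ∀ k, x (k + 1) = θ * x k := fun k => by simp only [x, pow_succ]; ring
  have hxt : Tendsto x atTop atTop :=
    (tendsto_pow_atTop_atTop_of_one_lt hθ).atTop_mul_const hx₀
  set D := Real.exp (-(s * W / x₀)) * Real.exp (-(s * θ)) * (a * b)⁻¹ with hD
  have hD0 : 0 ≤ D := by positivity
  have hcell : ∀ k, ENNReal.ofReal (D * (Real.exp (-(c * a * b * T (x (k + 1)))) -
        Real.exp (-(c * a * b * T (x k))))) ≤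
      ∫⁻ ω in {ω | (∀ p ∈ Φ ω, P p ≤ ENNReal.ofReal (x (k + 1))) ∧
        ¬ ∀ p ∈ Φ ω, P p ≤ ENNReal.ofReal (x k)},
        expNeg (ENNReal.ofReal s * ((maxRatio P W (Φ ω))⁻¹ + 1)) ∂μ := by
    intro k
    set A := {ω | (∀ p ∈ Φ ω, P p ≤ ENNReal.ofReal (x (k + 1))) ∧
        ¬ ∀ p ∈ Φ ω, P p ≤ ENNReal.ofReal (x k)} with hA
    have hAm : MeasurableSet A := (h.measurableSet_forall_le hP _).inter
      (h.measurableSet_forall_le hP _).compl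
    set u := s / x k with hu
    have hu0 : 0 ≤ u := div_nonneg hs (hxpos k).le
    have step1 : ENNReal.ofReal (Real.exp (-(s * W / x k))) *
        ∫⁻ ω in A, expNeg (ENNReal.ofReal u * ∑' q : Φ ω, P q) ∂μ ≤
        ∫⁻ ω in A, expNeg (ENNReal.ofReal s * ((maxRatio P W (Φ ω))⁻¹ + 1)) ∂μ := by
      rw [← lintegral_const_mul' _ _ (by simp)]
      refine setLIntegral_mono' hAm fun ω hω => ?_
      have hω2 := hω.2
      push Not at hω2
      obtain ⟨p, hp, hpx⟩ := hω2
      have h3 := inv_maxRatio_add_one_le (P := P) (W := W) hp hpx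
      rw [← expNeg_ofReal (by have := hxpos k; positivity), ← expNeg_add]
      refine expNeg_antitone ?_
      calc ENNReal.ofReal s * ((maxRatio P W (Φ ω))⁻¹ + 1)
          ≤ ENNReal.ofReal s * (((∑' q : Φ ω, P q) + W) / ENNReal.ofReal (x k)) := by gcongr
        _ = _ := by
          rw [hu, ENNReal.ofReal_div_of_pos (hxpos k), ENNReal.ofReal_div_of_pos (hxpos k),
            ENNReal.ofReal_mul hs, ENNReal.ofReal_coe_nnreal]
          simp only [div_eq_mul_inv]
          ring
    refine le_trans ?_ step1
    rw [h.setLIntegral_expNeg_mul_tsum_Ioc hP u (hxm (Nat.le_add_right k 1)),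
      ← ENNReal.ofReal_mul (Real.exp_nonneg _)]
    refine ENNReal.ofReal_le_ofReal ?_
    have hk1 := (truncLaplace_sub_bounds (π := π) hP hu0 (hxpos k).le
      (hxm (Nat.le_add_right k 1))).1
    have hux : u * x (k + 1) = s * θ := by
      rw [hu, hxs]; have := (hxpos k).ne'; field_simp
    rw [hux, ← hTdef] at hk1
    have hk2 := h1 (x k) (hxge k)
    have hk3 := h2 (x k) (hxge k)
    rw [← hxs] at hk3
    rw [← hu] at hk2
    set t := T (x k)
    set t' := T (x (k + 1))
    have htt : t' ≤ t := hTanti (hxm (Nat.le_add_right k 1))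
    set g := truncLaplace π P u (x k)
    set g' := truncLaplace π P u (x (k + 1))
    have hc : (0 : ℝ) ≤ c := c.coe_nonneg
    have hW : Real.exp (-(s * W / x₀)) ≤ Real.exp (-(s * W / x k)) := by
      gcongr; exact hxge k
    have e1 : Real.exp (-(c * (1 - g'))) - Real.exp (-(c * (1 - g))) =
        Real.exp (-(c * (1 - g))) * (Real.exp (c * (g' - g)) - 1) := by
      rw [mul_sub (Real.exp _), ← Real.exp_add]; ring_nf
    have e2 : c * (g' - g) ≤ Real.exp (c * (g' - g)) - 1 := by
      linarith [Real.add_one_le_exp (c * (g' - g))]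
    -- Convexity in `e4` bounds the increment by the derivative at the smaller value `t'`; the
    -- factor `b` pays for passing from `t` to `t'`.
    have e3 : Real.exp (-(c * (b * (a * t')))) ≤ Real.exp (-(c * (1 - g))) := by
      refine Real.exp_le_exp.2 (neg_le_neg ?_)
      gcongr
      calc 1 - g ≤ a * t := hk2
        _ ≤ a * (b * t') := by gcongr
        _ = _ := by ring
    have e4 : Real.exp (-(c * a * b * t')) - Real.exp (-(c * a * b * t)) ≤
        Real.exp (-(c * (b * (a * t')))) * (c * a * b * (t - t')) := by
      have := Real.add_one_le_exp (-(c * a * b * (t - t')))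
      have e5 : Real.exp (-(c * a * b * t)) =
          Real.exp (-(c * (b * (a * t')))) * Real.exp (-(c * a * b * (t - t'))) := by
        rw [← Real.exp_add]; ring_nf
      have e6 : Real.exp (-(c * a * b * t')) = Real.exp (-(c * (b * (a * t')))) := by ring_nf
      rw [e5, e6]
      nlinarith [Real.exp_pos (-(c * (b * (a * t'))))]
    have hdt : 0 ≤ t - t' := sub_nonneg.2 htt
    calc D * (Real.exp (-(c * a * b * t')) - Real.exp (-(c * a * b * t)))
        ≤ D * (Real.exp (-(c * (b * (a * t')))) * (c * a * b * (t - t'))) := by gcongr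
      _ = Real.exp (-(s * W / x₀)) *
          (Real.exp (-(c * (b * (a * t')))) * (c * (Real.exp (-(s * θ)) * (t - t')))) := by
          rw [hD]; field_simp
      _ ≤ Real.exp (-(s * W / x k)) *
          (Real.exp (-(c * (1 - g))) * (Real.exp (c * (g' - g)) - 1)) := by
          gcongr
          exact le_trans (by gcongr) e2
      _ = _ := by rw [e1]
  have hsum : ∀ K, ENNReal.ofReal (D * (Real.exp (-(c * a * b * T (x K))) -
      Real.exp (-(c * a * b * T x₀)))) ≤
      ∫⁻ ω, expNeg (ENNReal.ofReal s * ((maxRatio P W (Φ ω))⁻¹ + 1)) ∂μ := by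
    intro K
    refine le_trans ?_ (setLIntegral_le_lintegral
      {ω | ∀ p ∈ Φ ω, P p ≤ ENNReal.ofReal (x K)} _)
    rw [h.setLIntegral_forall_le_eq_add_sum hP hxm]
    refine le_trans ?_ le_add_self
    refine le_trans ?_ (Finset.sum_le_sum fun k _ => hcell k)
    rw [← ENNReal.ofReal_sum_of_nonneg, ← Finset.mul_sum,
      Finset.sum_range_sub (fun k => Real.exp (-(c * a * b * T (x k)))), hx0]
    intro k _
    refine mul_nonneg hD0 (sub_nonneg.2 (Real.exp_le_exp.2 (neg_le_neg ?_)))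
    exact mul_le_mul_of_nonneg_left (hTanti (hxm (Nat.le_add_right k 1))) (by positivity)
  refine le_of_tendsto' (f := fun K => ENNReal.ofReal (D * (Real.exp (-(c * a * b * T (x K))) -
      Real.exp (-(c * a * b * T x₀))))) (x := atTop) ?_ hsum
  refine (ENNReal.continuous_ofReal.tendsto _).comp (Tendsto.const_mul _ (Tendsto.sub_const ?_ _))
  have hTx : Tendsto (fun K => T (x K)) atTop (𝓝 0) := (tendsto_tailProb hP hPt).comp hxt
  have := (Real.continuous_exp.tendsto _).comp (hTx.const_mul (c * a * b : ℝ)).neg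
  simpa [Function.comp_def] using this

/-- The same cells with M replaced by the upper endpoint x_(k+1). The event M ≤ x₀, on which nothing
is known about the tail, has probability exp(-cT(x₀)), which is the first summand of the bound. -/
lemma lintegral_expNeg_inv_maxRatio_le (h : IsPoissonProcess Φ (c • π) μ) (hP : Measurable P)
    (hPt : ∀ᵐ p ∂π, P p ≠ ∞) (W : ℝ≥0) {s θ x₀ a b : ℝ} (hs : 0 ≤ s) (hθ : 1 < θ) (hx₀ : 0 < x₀)
    (ha : 0 < a) (hb : 0 < b)
    (h1 : ∀ x, x₀ ≤ x → a * tailProb π P x ≤ 1 - truncLaplace π P (s / x) x)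
    (h2 : ∀ x, x₀ ≤ x → tailProb π P x ≤ b * tailProb π P (θ * x)) :
    ∫⁻ ω, expNeg (ENNReal.ofReal s * ((maxRatio P W (Φ ω))⁻¹ + 1)) ∂μ ≤
      ENNReal.ofReal (Real.exp (-(c * tailProb π P x₀)) + Real.exp (-(s / θ)) * (b / a)) := by
  set T := tailProb π P with hTdef
  have hTanti : Antitone T := tailProb_antitone
  set x : ℕ → ℝ := fun k => θ ^ k * x₀ with hxdef
  have hθ0 : 0 < θ := one_pos.trans hθ
  have hxm : Monotone x := fun i j hij =>
    mul_le_mul_of_nonneg_right (pow_le_pow_right₀ hθ.le hij) hx₀.le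
  have hx0 : x 0 = x₀ := by simp [x]
  have hxge : ∀ k, x₀ ≤ x k := fun k => hx0 ▸ hxm (Nat.zero_le k)
  have hxpos : ∀ k, 0 < x k := fun k => hx₀.trans_le (hxge k)
  have hxs : ∀ k, x (k + 1) = θ * x k := fun k => by simp only [x, pow_succ]; ring
  have hxt : Tendsto x atTop atTop :=
    (tendsto_pow_atTop_atTop_of_one_lt hθ).atTop_mul_const hx₀
  have hc : (0 : ℝ) ≤ c := c.coe_nonneg
  set D := Real.exp (-(s / θ)) * (b / a) with hD
  have hD0 : 0 ≤ D := by positivity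
  set κ := c * a / b with hκ
  have hκ0 : 0 ≤ κ := by positivity
  have hmono : ∀ k, Real.exp (-(κ * T (x k))) ≤ Real.exp (-(κ * T (x (k + 1)))) := fun k =>
    Real.exp_le_exp.2 (neg_le_neg (mul_le_mul_of_nonneg_left
      (hTanti (hxm (Nat.le_add_right k 1))) hκ0))
  have hcell : ∀ k, ∫⁻ ω in {ω | (∀ p ∈ Φ ω, P p ≤ ENNReal.ofReal (x (k + 1))) ∧
        ¬ ∀ p ∈ Φ ω, P p ≤ ENNReal.ofReal (x k)},
        expNeg (ENNReal.ofReal s * ((maxRatio P W (Φ ω))⁻¹ + 1)) ∂μ ≤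
      ENNReal.ofReal (D * (Real.exp (-(κ * T (x (k + 1)))) - Real.exp (-(κ * T (x k))))) := by
    intro k
    set A := {ω | (∀ p ∈ Φ ω, P p ≤ ENNReal.ofReal (x (k + 1))) ∧
        ¬ ∀ p ∈ Φ ω, P p ≤ ENNReal.ofReal (x k)} with hA
    have hAm : MeasurableSet A := (h.measurableSet_forall_le hP _).inter
      (h.measurableSet_forall_le hP _).compl
    set u := s / x (k + 1) with hu
    have hu0 : 0 ≤ u := div_nonneg hs (hxpos _).le
    have step1 : ∫⁻ ω in A, expNeg (ENNReal.ofReal s * ((maxRatio P W (Φ ω))⁻¹ + 1)) ∂μ ≤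
        ∫⁻ ω in A, expNeg (ENNReal.ofReal u * ∑' q : Φ ω, P q) ∂μ := by
      refine setLIntegral_mono' hAm fun ω hω => expNeg_antitone ?_
      have h3 := tsum_div_le_inv_maxRatio_add_one (W := W) (by simp) hω.1
      calc ENNReal.ofReal u * ∑' q : Φ ω, P q =
          ENNReal.ofReal s * ((∑' q : Φ ω, P q) / ENNReal.ofReal (x (k + 1))) := by
            rw [hu, ENNReal.ofReal_div_of_pos (hxpos _)]
            simp only [div_eq_mul_inv]
            ring
        _ ≤ _ := by gcongr
    refine step1.trans ?_
    rw [h.setLIntegral_expNeg_mul_tsum_Ioc hP u (hxm (Nat.le_add_right k 1))]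
    refine ENNReal.ofReal_le_ofReal ?_
    have hk1 := (truncLaplace_sub_bounds (π := π) hP hu0 (hxpos k).le
      (hxm (Nat.le_add_right k 1))).2
    have hux : u * x k = s / θ := by
      rw [hu, hxs]; have := (hxpos k).ne'; field_simp
    rw [hux, ← hTdef] at hk1
    have hk2 := h1 (x (k + 1)) (hxge _)
    have hk3 := h2 (x k) (hxge k)
    rw [← hxs] at hk3
    rw [← hu] at hk2
    set t := T (x k)
    set t' := T (x (k + 1))
    have htt : t' ≤ t := hTanti (hxm (Nat.le_add_right k 1))
    set g := truncLaplace π P u (x k)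
    set g' := truncLaplace π P u (x (k + 1))
    have hdt : 0 ≤ t - t' := sub_nonneg.2 htt
    have e1 : Real.exp (-(c * (1 - g'))) - Real.exp (-(c * (1 - g))) =
        Real.exp (-(c * (1 - g'))) * (1 - Real.exp (-(c * (g' - g)))) := by
      rw [mul_sub (Real.exp _), ← Real.exp_add]; ring_nf
    have e2 : 1 - Real.exp (-(c * (g' - g))) ≤ c * (Real.exp (-(s / θ)) * (t - t')) := by
      have : c * (g' - g) ≤ c * (Real.exp (-(s / θ)) * (t - t')) := by gcongr
      linarith [Real.add_one_le_exp (-(c * (g' - g)))]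
    -- For the upper bound the derivative must be taken at the larger value `t`, so `b` enters
    -- through κ = ca/b.
    have e3 : Real.exp (-(c * (1 - g'))) ≤ Real.exp (-(κ * t)) := by
      refine Real.exp_le_exp.2 (neg_le_neg ?_)
      calc κ * t ≤ κ * (b * t') := by gcongr
        _ = c * (a * t') := by rw [hκ]; field_simp
        _ ≤ _ := by gcongr
    have e4 : Real.exp (-(κ * t)) * (κ * (t - t')) ≤
        Real.exp (-(κ * t')) - Real.exp (-(κ * t)) := by
      have e5 : Real.exp (-(κ * t')) = Real.exp (-(κ * t)) * Real.exp (κ * (t - t')) := by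
        rw [← Real.exp_add]; ring_nf
      rw [e5]
      nlinarith [Real.add_one_le_exp (κ * (t - t')), Real.exp_pos (-(κ * t))]
    calc Real.exp (-(c * (1 - g'))) - Real.exp (-(c * (1 - g)))
        ≤ Real.exp (-(c * (1 - g'))) * (c * (Real.exp (-(s / θ)) * (t - t'))) := by
          rw [e1]; gcongr
      _ ≤ Real.exp (-(κ * t)) * (c * (Real.exp (-(s / θ)) * (t - t'))) := by gcongr
      _ = D * (Real.exp (-(κ * t)) * (κ * (t - t'))) := by
          rw [hD, hκ]; field_simp
      _ ≤ _ := by gcongr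
  have hsum : ∀ K, ∫⁻ ω, expNeg (ENNReal.ofReal s * ((maxRatio P W (Φ ω))⁻¹ + 1)) ∂μ ≤
      ENNReal.ofReal (Real.exp (-(c * T x₀))) + ENNReal.ofReal D +
        ENNReal.ofReal (1 - Real.exp (-(c * T (x K)))) := by
    intro K
    have hm := h.measurableSet_forall_le hP (ENNReal.ofReal (x K))
    have hone : ∀ A : Set Ω, ∫⁻ ω in A,
        expNeg (ENNReal.ofReal s * ((maxRatio P W (Φ ω))⁻¹ + 1)) ∂μ ≤ μ A := fun A => by
      rw [← setLIntegral_one]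
      exact lintegral_mono fun ω => expNeg_le_one _
    rw [← lintegral_add_compl _ hm, h.setLIntegral_forall_le_eq_add_sum hP hxm]
    gcongr
    · refine (hone _).trans ?_
      rw [hx0, h.measure_forall_le hP]
    · refine (Finset.sum_le_sum fun k _ => hcell k).trans ?_
      rw [← ENNReal.ofReal_sum_of_nonneg, ← Finset.mul_sum,
        Finset.sum_range_sub (fun k => Real.exp (-(κ * T (x k))))]
      · refine ENNReal.ofReal_le_ofReal (mul_le_of_le_one_right hD0 ?_)
        have : Real.exp (-(κ * T (x K))) ≤ 1 :=
          Real.exp_le_one_iff.2 (neg_nonpos.2 (mul_nonneg hκ0 (tailProb_nonneg _)))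
        linarith [Real.exp_pos (-(κ * T (x 0)))]
      · exact fun k _ => mul_nonneg hD0 (sub_nonneg.2 (hmono k))
    · refine (hone _).trans ?_
      rw [prob_compl_eq_one_sub hm, h.measure_forall_le hP,
        ENNReal.ofReal_sub _ (Real.exp_nonneg _), ENNReal.ofReal_one]
  rw [ENNReal.ofReal_add (Real.exp_nonneg _) hD0]
  refine ge_of_tendsto' (f := fun K => ENNReal.ofReal (Real.exp (-(c * T x₀))) +
    ENNReal.ofReal D + ENNReal.ofReal (1 - Real.exp (-(c * T (x K))))) (x := atTop) ?_ hsum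
  have hTx : Tendsto (fun K => T (x K)) atTop (𝓝 0) := (tendsto_tailProb hP hPt).comp hxt
  have h3 := (Real.continuous_exp.tendsto _).comp (hTx.const_mul (c : ℝ)).neg
  have h4 := (ENNReal.continuous_ofReal.tendsto _).comp (h3.const_sub 1)
  simpa [Function.comp_def] using h4.const_add (ENNReal.ofReal (Real.exp (-(c * T x₀))) +
    ENNReal.ofReal D)

end IsPoissonProcess

/-! ### Convergence of the Laplace transform, and slowly varying tails -/

namespace IsPoissonProcess

variable {Ω E : Type*} [MeasurableSpace Ω] [MeasurableSpace E]
  {Φ : ℝ≥0 → Ω → Set E} {π : Measure E} {μ : Measure Ω} {P : E → ℝ≥0∞}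
  [IsProbabilityMeasure π] [IsProbabilityMeasure μ] {V : ℝ≥0}

/-- Choose θ close to 1 first, then x₁ so large that the asymptotics of g and T hold beyond it up to
powers of θ. For fixed x₁ the terms exp(-cT(x₁)) and exp(-cabT(x₁)) vanish as c → ∞. -/
lemma tendsto_lintegral_expNeg_inv_maxRatio_add_one
    (h : ∀ lam, IsPoissonProcess (Φ lam) ((lam * V) • π) μ) (hV : 0 < V) (hP : Measurable P)
    (hPt : ∀ᵐ p ∂π, P p ≠ ∞) (W : ℝ≥0) {α s : ℝ} (hα : 0 ≤ α) (hα1 : α < 1)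
    (hT : RegularlyVarying (tailProb π P) (-α)) (hs : 0 ≤ s) :
    Tendsto (fun lam => ∫⁻ ω, expNeg (ENNReal.ofReal s * ((maxRatio P W (Φ lam ω))⁻¹ + 1)) ∂μ)
      atTop (𝓝 (ENNReal.ofReal (Real.exp (-s) / limitFactor α s))) := by
  set φ := limitFactor α s with hφ
  have hφ0 : 0 < φ := one_pos.trans_le (one_le_limitFactor hα hα1 hs)
  have hlim := tendsto_one_sub_truncLaplace_div hP hα hα1 hT hs
  obtain ⟨hpos, -, hreg⟩ := hT
  -- Any exponent above α would do: T(θx)/T(x) tends to θ^(-α) > θ^(-(α+1)), and θ^(α+1) still tends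
  -- to 1.
  have hb : ∀ θ : ℝ, 1 < θ → ∀ᶠ x in atTop,
      tailProb π P x ≤ θ ^ (α + 1) * tailProb π P (θ * x) := by
    intro θ hθ
    have hθ0 : 0 < θ := one_pos.trans hθ
    have h3 : θ ^ (-(α + 1)) < θ ^ (-α) := Real.rpow_lt_rpow_of_exponent_lt hθ (by linarith)
    filter_upwards [(hreg θ hθ0).eventually_const_lt h3, eventually_gt_atTop 0] with x hx hx0
    rw [lt_div_iff₀ (hpos x hx0), Real.rpow_neg hθ0.le, inv_mul_lt_iff₀ (by positivity)] at hx
    exact hx.le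
  have hexp : ∀ d : ℝ, 0 < d → Tendsto (fun lam : ℝ≥0 => Real.exp (-(lam * d))) atTop (𝓝 0) :=
    fun d hd => Real.tendsto_exp_atBot.comp (tendsto_neg_atTop_atBot.comp
      ((NNReal.tendsto_coe_atTop.2 tendsto_id).atTop_mul_const hd))
  refine tendsto_order.2 ⟨fun z hz => ?_, fun z hz => ?_⟩
  -- The extra θ⁻¹ is reserved for the noise factor exp(-sW/x₁), which exceeds it once x₁ is large.
  · have hcont : Tendsto (fun θ : ℝ => ENNReal.ofReal
        (θ⁻¹ * Real.exp (-(s * θ)) * (φ * θ * θ ^ (α + 1))⁻¹)) (𝓝[>] 1)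
        (𝓝 (ENNReal.ofReal (Real.exp (-s) / φ))) := by
      have : ContinuousAt (fun θ : ℝ => ENNReal.ofReal
          (θ⁻¹ * Real.exp (-(s * θ)) * (φ * θ * θ ^ (α + 1))⁻¹)) 1 := by
        refine ENNReal.continuous_ofReal.continuousAt.comp ?_
        refine ((continuousAt_inv₀ one_ne_zero).mul (by fun_prop)).mul (ContinuousAt.inv₀
          ((continuousAt_const.mul continuousAt_id).mul
            (Real.continuousAt_rpow_const _ _ (.inl one_ne_zero))) ?_)
        simpa using hφ0.ne'
      have h2 := this.tendsto
      simp only [inv_one, one_mul, mul_one, Real.one_rpow] at h2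
      rw [← div_eq_mul_inv] at h2
      exact h2.mono_left nhdsWithin_le_nhds
    obtain ⟨θ, hθz, hθ : 1 < θ⟩ :=
      ((hcont.eventually_const_lt hz).and self_mem_nhdsWithin).exists
    have hθ0 : 0 < θ := one_pos.trans hθ
    have hW : ∀ᶠ x : ℝ in atTop, θ⁻¹ < Real.exp (-(s * W / x)) := by
      have : Tendsto (fun x : ℝ => Real.exp (-(s * W / x))) atTop (𝓝 1) := by
        have h2 := (Real.continuous_exp.tendsto _).comp
          (tendsto_const_nhds.div_atTop (tendsto_id (α := ℝ) (x := atTop)) (a := s * W)).neg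
        simpa [Function.comp_def] using h2
      exact this.eventually_const_lt (inv_lt_one_of_one_lt₀ hθ)
    have ha : ∀ᶠ x in atTop, 1 - truncLaplace π P (s / x) x ≤ φ * θ * tailProb π P x := by
      filter_upwards [hlim.eventually_lt_const (lt_mul_of_one_lt_right hφ0 hθ),
        eventually_gt_atTop 0] with x hx hx0
      exact ((div_lt_iff₀ (hpos x hx0)).1 hx).le
    obtain ⟨x₁, hx₁⟩ := eventually_atTop.1 ((ha.and (hb θ hθ)).and (hW.and (eventually_gt_atTop 0)))
    have hx₁0 : 0 < x₁ := (hx₁ x₁ le_rfl).2.2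
    set a := φ * θ with had
    set b := θ ^ (α + 1) with hbd
    have ha0 : 0 < a := mul_pos hφ0 hθ0
    have hb0 : 0 < b := Real.rpow_pos_of_pos hθ0 _
    set G := Real.exp (-(s * W / x₁)) * Real.exp (-(s * θ)) * (a * b)⁻¹
    have hG : z < ENNReal.ofReal G := by
      refine hθz.trans_le (ENNReal.ofReal_le_ofReal ?_)
      have := (hx₁ x₁ le_rfl).2.1.le
      simp only [G]
      gcongr
    have hT1 := hpos x₁ hx₁0
    have hd : 0 < V * a * b * tailProb π P x₁ := by have : (0 : ℝ) < V := hV; positivity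
    have h4 : Tendsto (fun lam : ℝ≥0 => ENNReal.ofReal
        (G * (1 - Real.exp (-(lam * (V * a * b * tailProb π P x₁)))))) atTop
        (𝓝 (ENNReal.ofReal G)) := by
      have := ((hexp _ hd).const_sub 1).const_mul G
      rw [sub_zero, mul_one] at this
      exact (ENNReal.continuous_ofReal.tendsto _).comp this
    filter_upwards [h4.eventually_const_lt hG] with lam hlam
    refine hlam.trans_le ?_
    have h5 := (h lam).lintegral_expNeg_inv_maxRatio_ge hP hPt W hs hθ hx₁0 ha0 hb0
      (fun x hx => (hx₁ x hx).1.1) (fun x hx => (hx₁ x hx).1.2)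
    refine le_trans (le_of_eq ?_) h5
    congr 5
    push_cast; ring
  · have hcont : Tendsto (fun θ : ℝ => ENNReal.ofReal
        (Real.exp (-(s / θ)) * (θ ^ (α + 1) / (φ / θ)))) (𝓝[>] 1)
        (𝓝 (ENNReal.ofReal (Real.exp (-s) / φ))) := by
      have : ContinuousAt (fun θ : ℝ => ENNReal.ofReal
          (Real.exp (-(s / θ)) * (θ ^ (α + 1) / (φ / θ)))) 1 := by
        refine ENNReal.continuous_ofReal.continuousAt.comp ?_
        refine ContinuousAt.mul (Real.continuous_exp.continuousAt.comp
          (continuousAt_const.div continuousAt_id one_ne_zero).neg)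
          ((Real.continuousAt_rpow_const _ _ (.inl one_ne_zero)).div
            (continuousAt_const.div continuousAt_id one_ne_zero) ?_)
        simpa using hφ0.ne'
      have h2 := this.tendsto
      simp only [div_one, Real.one_rpow, mul_one_div] at h2
      exact h2.mono_left nhdsWithin_le_nhds
    obtain ⟨θ, hθz, hθ : 1 < θ⟩ :=
      ((hcont.eventually_lt_const hz).and self_mem_nhdsWithin).exists
    have hθ0 : 0 < θ := one_pos.trans hθ
    have ha : ∀ᶠ x in atTop, φ / θ * tailProb π P x ≤ 1 - truncLaplace π P (s / x) x := by
      filter_upwards [hlim.eventually_const_lt (div_lt_self hφ0 hθ),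
        eventually_gt_atTop 0] with x hx hx0
      exact ((lt_div_iff₀ (hpos x hx0)).1 hx).le
    obtain ⟨x₁, hx₁⟩ := eventually_atTop.1 ((ha.and (hb θ hθ)).and (eventually_gt_atTop 0))
    have hx₁0 : 0 < x₁ := (hx₁ x₁ le_rfl).2
    have hd : 0 < V * tailProb π P x₁ := mul_pos (NNReal.coe_pos.2 hV) (hpos x₁ hx₁0)
    have h4 : Tendsto (fun lam : ℝ≥0 => ENNReal.ofReal
        (Real.exp (-(lam * (V * tailProb π P x₁))) +
          Real.exp (-(s / θ)) * (θ ^ (α + 1) / (φ / θ)))) atTop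
        (𝓝 (ENNReal.ofReal (Real.exp (-(s / θ)) * (θ ^ (α + 1) / (φ / θ))))) := by
      have := (hexp _ hd).add_const (Real.exp (-(s / θ)) * (θ ^ (α + 1) / (φ / θ)))
      rw [zero_add] at this
      exact (ENNReal.continuous_ofReal.tendsto _).comp this
    filter_upwards [h4.eventually_lt_const hθz] with lam hlam
    refine lt_of_le_of_lt ?_ hlam
    have h5 := (h lam).lintegral_expNeg_inv_maxRatio_le hP hPt W hs hθ hx₁0 (div_pos hφ0 hθ0)
      (Real.rpow_pos_of_pos hθ0 (α + 1))
      (fun x hx => (hx₁ x hx).1.1) (fun x hx => (hx₁ x hx).1.2)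
    refine h5.trans (le_of_eq ?_)
    congr 4
    push_cast; ring

/-- The Laplace transform of the inverse of the signal to interference plus noise ratio
converges. -/
lemma tendsto_lintegral_expNeg_inv_maxRatio
    (h : ∀ lam, IsPoissonProcess (Φ lam) ((lam * V) • π) μ) (hV : 0 < V) (hP : Measurable P)
    (hPt : ∀ᵐ p ∂π, P p ≠ ∞) (W : ℝ≥0) {α s : ℝ} (hα : 0 ≤ α) (hα1 : α < 1)
    (hT : RegularlyVarying (tailProb π P) (-α)) (hs : 0 ≤ s) :
    Tendsto (fun lam => ∫⁻ ω, expNeg (ENNReal.ofReal s * (maxRatio P W (Φ lam ω))⁻¹) ∂μ)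
      atTop (𝓝 (ENNReal.ofReal (1 / limitFactor α s))) := by
  have h1 := tendsto_lintegral_expNeg_inv_maxRatio_add_one h hV hP hPt W hα hα1 hT hs
  have h2 := ENNReal.Tendsto.const_mul (a := ENNReal.ofReal (Real.exp s)) h1 (.inr (by simp))
  have hone : ENNReal.ofReal (Real.exp s) * ENNReal.ofReal (Real.exp (-s)) = 1 := by
    rw [← ENNReal.ofReal_mul (Real.exp_nonneg _), ← Real.exp_add]; simp
  have h3 : ENNReal.ofReal (Real.exp s) * ENNReal.ofReal (Real.exp (-s) / limitFactor α s) =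
      ENNReal.ofReal (1 / limitFactor α s) := by
    rw [div_eq_mul_one_div, ENNReal.ofReal_mul (Real.exp_nonneg _), ← mul_assoc, hone, one_mul]
  rw [h3] at h2
  refine h2.congr fun lam => ?_
  rw [← lintegral_const_mul' _ _ (by simp)]
  refine lintegral_congr fun ω => ?_
  rw [mul_add, mul_one, expNeg_add, expNeg_ofReal hs, mul_comm (expNeg _), ← mul_assoc, hone,
    one_mul]

/-- If the tail of the received power is slowly varying, then the signal to interference plus
noise ratio tends to infinity in probability. -/
theorem tendsto_measure_lt_maxRatio
    (h : ∀ lam, IsPoissonProcess (Φ lam) ((lam * V) • π) μ) (hV : 0 < V) (hP : Measurable P)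
    (hPt : ∀ᵐ p ∂π, P p ≠ ∞) (W : ℝ≥0) (hT : RegularlyVarying (tailProb π P) 0) (y : ℝ≥0) :
    Tendsto (fun lam => μ {ω | (y : ℝ≥0∞) < maxRatio P W (Φ lam ω)}) atTop (𝓝 1) := by
  have h1 := tendsto_lintegral_expNeg_inv_maxRatio h hV hP hPt W le_rfl one_pos
    (by simpa using hT) zero_le_one
  simp only [limitFactor_zero_left, ENNReal.ofReal_one, one_mul, div_one] at h1
  set e := expNeg (y : ℝ≥0∞)⁻¹
  have he : e < 1 := by
    rw [← expNeg_zero]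
    exact expNeg_strictAnti (ENNReal.inv_pos.2 (by simp))
  have he0 : 1 - e ≠ 0 := (tsub_pos_of_lt he).ne'
  -- A Markov-type bound: with R the ratio, exp(-1/R) ≤ e where R ≤ y and exp(-1/R) ≤ 1 elsewhere.
  -- The left side tends to 1 with the transform.
  have hle : ∀ lam, (∫⁻ ω, expNeg (maxRatio P W (Φ lam ω))⁻¹ ∂μ - e) / (1 - e) ≤
      μ {ω | (y : ℝ≥0∞) < maxRatio P W (Φ lam ω)} := by
    intro lam
    refine ENNReal.div_le_of_le_mul ?_
    rw [tsub_le_iff_right]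
    calc ∫⁻ ω, expNeg (maxRatio P W (Φ lam ω))⁻¹ ∂μ
        ≤ ∫⁻ ω, (e + {ω | (y : ℝ≥0∞) < maxRatio P W (Φ lam ω)}.indicator
            (fun _ => 1 - e) ω) ∂μ := by
          refine lintegral_mono fun ω => ?_
          by_cases hω : (y : ℝ≥0∞) < maxRatio P W (Φ lam ω)
          · rw [Set.indicator_of_mem (by exact hω), add_tsub_cancel_of_le he.le]
            exact expNeg_le_one _
          · rw [Set.indicator_of_notMem (by exact hω), add_zero]
            exact expNeg_antitone (ENNReal.inv_le_inv.2 (not_lt.1 hω))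
      _ = e + ∫⁻ ω, {ω | (y : ℝ≥0∞) < maxRatio P W (Φ lam ω)}.indicator (fun _ => 1 - e) ω ∂μ := by
          rw [lintegral_add_left measurable_const]; simp
      _ ≤ e + (1 - e) * μ {ω | (y : ℝ≥0∞) < maxRatio P W (Φ lam ω)} := by
          gcongr; exact lintegral_indicator_const_le _ _
      _ = _ := by rw [add_comm, mul_comm]
  refine tendsto_of_tendsto_of_tendsto_of_le_of_le ?_ tendsto_const_nhds hle fun _ => prob_le_one
  have h2 := ENNReal.Tendsto.div_const (b := 1 - e)
    (ENNReal.Tendsto.sub h1 (tendsto_const_nhds (x := e)) (.inl ENNReal.one_ne_top)) (.inr he0)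
  rwa [ENNReal.div_self he0 (ne_top_of_le_ne_top (by simp) tsub_le_self)] at h2

end IsPoissonProcess

/-! ### Convergence in law on the compact space [0, ∞] -/

/-- The continuous function `x ↦ exp (-1 / x)` on `[0, ∞]`. -/
noncomputable def expNegInv : C(ℝ≥0∞, ℝ) where
  toFun x := (expNeg x⁻¹).toReal
  continuous_toFun := by
    refine ENNReal.continuousOn_toReal.comp_continuous
      (continuous_expNeg.comp continuous_inv) fun x => expNeg_ne_top _

lemma expNegInv_apply (x : ℝ≥0∞) : expNegInv x = (expNeg x⁻¹).toReal := rfl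

lemma expNegInv_injective : Function.Injective expNegInv := by
  intro x y h
  rw [expNegInv_apply, expNegInv_apply,
    ENNReal.toReal_eq_toReal_iff' (expNeg_ne_top _) (expNeg_ne_top _)] at h
  exact inv_injective (expNeg_strictAnti.injective h)

lemma integral_expNegInv_pow (ν : Measure ℝ≥0∞) (n : ℕ) :
    ∫ x, (expNegInv ^ n) x ∂ν = (∫⁻ x, expNeg (n * x⁻¹) ∂ν).toReal := by
  have h : ∀ x, (expNegInv ^ n) x = (expNeg (n * x⁻¹)).toReal := fun x => by
    rw [ContinuousMap.pow_apply, expNegInv_apply, expNeg_nat_mul, ENNReal.toReal_pow]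
  simp_rw [h]
  refine integral_toReal ?_ (.of_forall fun x => (expNeg_ne_top _).lt_top)
  exact (measurable_expNeg.comp (measurable_inv.const_mul _)).aemeasurable

lemma integrable_continuousMap (ν : Measure ℝ≥0∞) [IsProbabilityMeasure ν] (g : C(ℝ≥0∞, ℝ)) :
    Integrable g ν :=
  (BoundedContinuousFunction.mkOfCompact g).integrable ν

/-- Stone–Weierstrass: exp(-1/x) is injective on [0, ∞], so the algebra it generates separates
points and is dense; the set of functions on which both integrals agree is closed and contains this
algebra. -/
lemma probabilityMeasure_eq_of_integral_expNegInv_pow {ν ν' : ProbabilityMeasure ℝ≥0∞}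
    (h : ∀ n : ℕ, ∫ x, (expNegInv ^ n) x ∂(ν : Measure ℝ≥0∞) =
      ∫ x, (expNegInv ^ n) x ∂(ν' : Measure ℝ≥0∞)) : ν = ν' := by
  have hclosed : IsClosed {g : C(ℝ≥0∞, ℝ) |
      ∫ x, g x ∂(ν : Measure ℝ≥0∞) = ∫ x, g x ∂(ν' : Measure ℝ≥0∞)} := by
    have hc : ∀ ν : ProbabilityMeasure ℝ≥0∞,
        Continuous fun g : C(ℝ≥0∞, ℝ) => ∫ x, g x ∂(ν : Measure ℝ≥0∞) := by
      intro ν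
      refine (LipschitzWith.of_dist_le_mul (K := 1) fun f g => ?_).continuous
      rw [dist_eq_norm, ← integral_sub (integrable_continuousMap _ _)
        (integrable_continuousMap _ _), NNReal.coe_one, one_mul]
      refine (norm_integral_le_of_norm_le_const (C := dist f g)
        (.of_forall fun x => ?_)).trans (by simp)
      rw [← dist_eq_norm]
      exact ContinuousMap.dist_apply_le_dist x
    exact isClosed_eq (hc ν) (hc ν')
  have hadjoin : ∀ g ∈ Algebra.adjoin ℝ {expNegInv},
      ∫ x, g x ∂(ν : Measure ℝ≥0∞) = ∫ x, g x ∂(ν' : Measure ℝ≥0∞) := by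
    intro g hg
    rw [Algebra.adjoin_singleton_eq_range_aeval] at hg
    obtain ⟨p, rfl⟩ := hg
    induction p using Polynomial.induction_on' with
    | add p q hp hq =>
      simp only [AlgHom.toRingHom_eq_coe, RingHom.coe_coe, map_add, ContinuousMap.add_apply] at *
      rw [integral_add (integrable_continuousMap _ _) (integrable_continuousMap _ _),
        integral_add (integrable_continuousMap _ _) (integrable_continuousMap _ _), hp, hq]
    | monomial n a =>
      simp only [AlgHom.toRingHom_eq_coe, RingHom.coe_coe, Polynomial.aeval_monomial,
        Algebra.algebraMap_eq_smul_one, smul_mul_assoc, one_mul, ContinuousMap.smul_apply,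
        smul_eq_mul]
      rw [integral_const_mul, integral_const_mul, h]
  have hsep : (Algebra.adjoin ℝ {expNegInv}).SeparatesPoints := fun x y hxy =>
    ⟨expNegInv, ⟨expNegInv, Algebra.self_mem_adjoin_singleton ℝ _, rfl⟩,
      fun h => hxy (expNegInv_injective h)⟩
  have hall : ∀ g : C(ℝ≥0∞, ℝ),
      ∫ x, g x ∂(ν : Measure ℝ≥0∞) = ∫ x, g x ∂(ν' : Measure ℝ≥0∞) := fun g =>
    closure_minimal (s := (Algebra.adjoin ℝ {expNegInv} : Set C(ℝ≥0∞, ℝ))) hadjoin hclosed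
      (ContinuousMap.continuousMap_mem_subalgebra_closure_of_separatesPoints _ hsep g)
  refine Subtype.ext ?_
  change (ν : Measure ℝ≥0∞) = ν'
  refine ext_of_forall_integral_eq_of_IsFiniteMeasure fun f => ?_
  exact hall f.toContinuousMap

/-- The probability measures on a compact space form a compact space, so tightness is automatic.
Every cluster point has the prescribed integrals, hence the cluster point is unique and is the
limit. -/
lemma exists_tendsto_of_tendsto_lintegral_expNeg {ι : Type*} {l : Filter ι} [l.NeBot]
    {ν : ι → ProbabilityMeasure ℝ≥0∞} {m : ℕ → ℝ≥0∞} (hm : ∀ n, m n ≠ ∞)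
    (h : ∀ n : ℕ, Tendsto (fun i => ∫⁻ x, expNeg (n * x⁻¹) ∂(ν i : Measure ℝ≥0∞)) l (𝓝 (m n))) :
    ∃ D : ProbabilityMeasure ℝ≥0∞, Tendsto ν l (𝓝 D) ∧
      ∀ n : ℕ, ∫⁻ x, expNeg (n * x⁻¹) ∂(D : Measure ℝ≥0∞) = m n := by
  have hclust : ∀ D, MapClusterPt D l ν → ∀ n : ℕ,
      ∫ x, (expNegInv ^ n) x ∂(D : Measure ℝ≥0∞) = (m n).toReal := by
    intro D hD n
    have h1 : MapClusterPt (∫ x, (expNegInv ^ n) x ∂(D : Measure ℝ≥0∞)) l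
        (fun i => ∫ x, (expNegInv ^ n) x ∂(ν i : Measure ℝ≥0∞)) :=
      hD.continuousAt_comp
        (ProbabilityMeasure.continuous_integral_continuousMap (expNegInv ^ n)).continuousAt
    have h2 : Tendsto (fun i => ∫ x, (expNegInv ^ n) x ∂(ν i : Measure ℝ≥0∞)) l
        (𝓝 (m n).toReal) := by
      simp_rw [integral_expNegInv_pow]
      exact (ENNReal.tendsto_toReal (hm n)).comp (h n)
    exact eq_of_nhds_neBot (h1.clusterPt.mono h2)
  obtain ⟨D, hD⟩ := exists_clusterPt_of_compactSpace (map ν l)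
  refine ⟨D, tendsto_nhds_of_unique_mapClusterPt fun D' hD' => ?_, fun n => ?_⟩
  · exact probabilityMeasure_eq_of_integral_expNegInv_pow fun n => by
      rw [hclust D' hD', hclust D hD]
  · have := hclust D hD n
    rw [integral_expNegInv_pow, ENNReal.toReal_eq_toReal_iff' _ (hm n)] at this
    · exact this
    · refine ne_top_of_le_ne_top (b := 1) (by simp) ?_
      calc _ ≤ ∫⁻ x, 1 ∂(D : Measure ℝ≥0∞) := lintegral_mono fun x => expNeg_le_one _
        _ = 1 := by simp

/-- A law on `[0, ∞]` such that the Laplace transform of the inverse is `1 / limitFactor α`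
is neither degenerate nor charges infinity. -/
lemma nondegenerate_of_lintegral_expNeg {D : Measure ℝ≥0∞} [IsProbabilityMeasure D] {α : ℝ}
    (hα : 0 < α) (hα1 : α < 1) (hD : ∀ n : ℕ, ∫⁻ x, expNeg (n * x⁻¹) ∂D =
      ENNReal.ofReal (1 / limitFactor α n)) : D {∞} = 0 ∧ ∀ x, D ≠ Measure.dirac x := by
  have hφ : ∀ n : ℕ, 1 ≤ limitFactor α n := fun n =>
    one_le_limitFactor hα.le hα1 (Nat.cast_nonneg n)
  have h0 : D {∞} = 0 := by
    -- At x = ∞ the integrand exp(-n/x) equals 1.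
    have hle : ∀ n : ℕ, D {∞} ≤ ENNReal.ofReal (1 / limitFactor α n) := by
      intro n
      rw [← hD, ← lintegral_indicator_one (measurableSet_singleton _)]
      refine lintegral_mono fun x => ?_
      by_cases hx : x = ∞ <;> simp [hx]
    have hlim : Tendsto (fun n : ℕ => limitFactor α n) atTop atTop := by
      refine tendsto_atTop_mono' _ ?_ ((tendsto_rpow_atTop hα).comp
        tendsto_natCast_atTop_atTop |>.atTop_div_const (Real.exp_pos 1))
      filter_upwards [eventually_ge_atTop 1] with n hn
      exact rpow_div_exp_le_limitFactor hα.le hα1 (by exact_mod_cast hn)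
    have h2 := (ENNReal.continuous_ofReal.tendsto _).comp
      ((tendsto_const_nhds (x := (1 : ℝ))).div_atTop hlim)
    rw [ENNReal.ofReal_zero] at h2
    exact le_antisymm (ge_of_tendsto' h2 hle) zero_le
  refine ⟨h0, fun x hx => ?_⟩
  have hxt : x ≠ ∞ := by
    rintro rfl
    rw [hx] at h0
    simp at h0
  have hpow : ∀ n : ℕ, expNeg x⁻¹ ^ n = ENNReal.ofReal (1 / limitFactor α n) := by
    intro n
    rw [← hD, hx, lintegral_dirac, expNeg_nat_mul]
  have hlt : (expNeg x⁻¹).toReal < 1 := by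
    rw [← ENNReal.toReal_one, ENNReal.toReal_lt_toReal (expNeg_ne_top _) ENNReal.one_ne_top,
      ← expNeg_zero]
    exact expNeg_strictAnti (ENNReal.inv_pos.2 hxt)
  -- For a point mass 1/φ(n) would be the n-th power of a number below 1, which is incompatible with
  -- linear growth of φ.
  have hbound : ∀ n : ℕ, 1 ≤ (1 + n * (1 - α)⁻¹) * (expNeg x⁻¹).toReal ^ n := by
    intro n
    have h3 := congrArg ENNReal.toReal (hpow n)
    have h4 := hφ n
    rw [ENNReal.toReal_pow, ENNReal.toReal_ofReal (by positivity)] at h3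
    rw [h3, mul_one_div, one_le_div (by positivity), ← div_eq_mul_inv]
    exact limitFactor_le hα1 (Nat.cast_nonneg n)
  have hr0 : 0 ≤ (expNeg x⁻¹).toReal := ENNReal.toReal_nonneg
  have h5 : Tendsto (fun n : ℕ => (1 + n * (1 - α)⁻¹) * (expNeg x⁻¹).toReal ^ n) atTop (𝓝 0) := by
    have h6 := tendsto_pow_atTop_nhds_zero_of_lt_one hr0 hlt
    have h7 := (tendsto_self_mul_const_pow_of_lt_one hr0 hlt).mul_const (1 - α)⁻¹
    have := h6.add h7
    rw [zero_mul, add_zero] at this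
    exact this.congr fun n => by ring
  exact absurd (ge_of_tendsto' h5 hbound) (by norm_num)

/-! ### Regularly varying tails: the limit law -/

namespace IsPoissonProcess

variable {Ω E : Type*} [MeasurableSpace Ω] [MeasurableSpace E]
  {Φ : ℝ≥0 → Ω → Set E} {π : Measure E} {μ : Measure Ω} {P : E → ℝ≥0∞}
  [IsProbabilityMeasure π] [IsProbabilityMeasure μ] {V : ℝ≥0}

/-- If the tail of the received power is regularly varying of index `-α`, `0 < α < 1`, then the
signal to interference plus noise ratio has a finite nondegenerate limit in distribution. -/
theorem exists_tendstoInDistribution_maxRatio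
    (h : ∀ lam, IsPoissonProcess (Φ lam) ((lam * V) • π) μ) (hV : 0 < V) (hP : Measurable P)
    (hPt : ∀ᵐ p ∂π, P p ≠ ∞) (W : ℝ≥0) {α : ℝ} (hα : 0 < α) (hα1 : α < 1)
    (hT : RegularlyVarying (tailProb π P) (-α)) :
    ∃ (D : Measure ℝ≥0∞) (_ : IsProbabilityMeasure D), D {∞} = 0 ∧
      (∀ x, D ≠ Measure.dirac x) ∧
      TendstoInDistribution (fun lam ω => maxRatio P W (Φ lam ω)) atTop id (fun _ => μ) D := by
  have hm : ∀ lam, AEMeasurable (fun ω => maxRatio P W (Φ lam ω)) μ := fun lam =>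
    (h lam).aemeasurable_maxRatio hP (Measure.ae_smul_measure hPt _) W
  obtain ⟨D, hD, hDn⟩ := exists_tendsto_of_tendsto_lintegral_expNeg (l := atTop)
    (ν := fun lam => ⟨μ.map fun ω => maxRatio P W (Φ lam ω),
      Measure.isProbabilityMeasure_map (hm lam)⟩)
    (m := fun n => ENNReal.ofReal (1 / limitFactor α n)) (fun n => ENNReal.ofReal_ne_top)
    (fun n => by
      refine (tendsto_lintegral_expNeg_inv_maxRatio h hV hP hPt W hα.le hα1 hT
        (Nat.cast_nonneg n)).congr fun lam => ?_
      rw [ENNReal.ofReal_natCast]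
      exact (lintegral_map' (f := fun x : ℝ≥0∞ => expNeg (n * x⁻¹))
        (measurable_expNeg.comp (measurable_inv.const_mul _)).aemeasurable (hm lam)).symm)
  obtain ⟨h0, hdeg⟩ := nondegenerate_of_lintegral_expNeg (D := D) hα hα1 hDn
  refine ⟨D, inferInstance, h0, hdeg, hm, aemeasurable_id, ?_⟩
  convert! hD using 2
  refine congrArg _ (Subtype.ext ?_)
  exact Measure.map_id

end IsPoissonProcess

/-! ### The pathloss function and the law of a random node -/

namespace Pathloss

variable {d : ℕ} (L : Pathloss d)

lemma R_le {i j : ℕ} (hij : i ≤ j) (hj : j ≤ L.K) : L.R i ≤ L.R j := by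
  induction j, hij using Nat.le_induction with
  | base => exact le_rfl
  | succ j _ ih => exact (ih (by omega)).trans (L.R_lt j (by omega)).le

lemma R_nonneg {k : ℕ} (hk : k ≤ L.K) : 0 ≤ L.R k := L.R_zero ▸ L.R_le (Nat.zero_le k) hk

lemma R_one_pos : 0 < L.R 1 := L.R_zero ▸ L.R_lt 0 L.one_le_K

lemma R_one_le : L.R 1 ≤ L.Rinf := L.R_le L.one_le_K le_rfl

lemma Rinf_pos : 0 < L.Rinf := L.R_one_pos.trans_le L.R_one_le

lemma l_eq {k : ℕ} (hk : k < L.K) {r : ℝ} (h1 : L.R k ≤ r) (h2 : r < L.R (k + 1)) :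
    L.l r = L.A k * r ^ L.β k := by
  rw [l, Finset.sum_eq_single_of_mem k (Finset.mem_range.2 hk)]
  · exact Set.indicator_of_mem (Set.mem_Ico.2 ⟨h1, h2⟩) _
  · intro j hj hjk
    rw [Finset.mem_range] at hj
    refine Set.indicator_of_notMem (fun h => ?_) _
    rcases lt_or_gt_of_ne hjk with hlt | hlt
    · exact absurd (h.2.trans_le (L.R_le hlt hk.le)) (not_lt.2 h1)
    · exact absurd (h2.trans_le (L.R_le hlt hj.le)) (not_lt.2 h.1)

lemma exists_slope {r : ℝ} (h0 : 0 ≤ r) (hr : r < L.Rinf) :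
    ∃ k < L.K, L.R k ≤ r ∧ r < L.R (k + 1) := by
  classical
  have hex : ∃ k, r < L.R k := ⟨L.K, hr⟩
  have hpos : Nat.find hex ≠ 0 := fun h => by
    have := Nat.find_spec hex
    rw [h, L.R_zero] at this
    exact absurd this (not_lt.2 h0)
  obtain ⟨k, hk⟩ := Nat.exists_eq_succ_of_ne_zero hpos
  have hle : Nat.find hex ≤ L.K := Nat.find_min' hex hr
  refine ⟨k, by omega, not_lt.1 (Nat.find_min hex (by omega)), ?_⟩
  have := Nat.find_spec hex
  rwa [hk] at this

lemma β_nonneg (hd : 1 ≤ d) {k : ℕ} (hk : k < L.K) : 0 ≤ L.β k := by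
  rcases Nat.eq_zero_or_pos k with rfl | h
  · exact L.β_zero
  · have h1 := L.le_β k h hk
    have h2 : (1 : ℝ) ≤ d := by exact_mod_cast hd
    linarith

lemma l_pos {r : ℝ} (h0 : 0 < r) (hr : r < L.Rinf) : 0 < L.l r := by
  obtain ⟨k, hk, h1, h2⟩ := L.exists_slope h0.le hr
  rw [L.l_eq hk h1 h2]
  exact mul_pos (L.A_pos k hk) (Real.rpow_pos_of_pos h0 _)

lemma l_nonneg (r : ℝ) : 0 ≤ L.l r := by
  refine Finset.sum_nonneg fun k hk => Set.indicator_nonneg (fun s hs => ?_) r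
  rw [Finset.mem_range] at hk
  exact mul_nonneg (L.A_pos k hk).le (Real.rpow_nonneg ((L.R_nonneg hk.le).trans hs.1) _)

lemma measurable_l : Measurable L.l := by
  unfold l
  refine Finset.measurable_sum _ fun k _ => Measurable.indicator ?_ measurableSet_Ico
  fun_prop

lemma exists_l_le (hd : 1 ≤ d) : ∃ M : ℝ, 0 < M ∧ ∀ r, L.l r ≤ M := by
  refine ⟨∑ k ∈ Finset.range L.K, L.A k * L.R (k + 1) ^ L.β k, ?_, fun r => ?_⟩
  · refine Finset.sum_pos (fun k hk => ?_) ⟨0, Finset.mem_range.2 L.one_le_K⟩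
    rw [Finset.mem_range] at hk
    exact mul_pos (L.A_pos k hk)
      (Real.rpow_pos_of_pos ((L.R_nonneg hk.le).trans_lt (L.R_lt k hk)) _)
  · refine Finset.sum_le_sum fun k hk => ?_
    rw [Finset.mem_range] at hk
    have h0 := L.R_nonneg hk.le
    have hA := (L.A_pos k hk).le
    refine Set.indicator_le' (g := fun _ => L.A k * L.R (k + 1) ^ L.β k) (fun s hs => ?_)
      (fun _ _ => ?_) r
    · exact mul_le_mul_of_nonneg_left
        (Real.rpow_le_rpow (h0.trans hs.1) hs.2.le (L.β_nonneg hd hk)) hA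
    · exact mul_nonneg hA (Real.rpow_nonneg (L.R_nonneg hk) _)

/-- All exponents are nonnegative, so every slope is at least its value at `R 1` there, and there
are finitely many. Thus only the first slope can bring the pathloss near 0. -/
lemma exists_le_l (hd : 1 ≤ d) :
    ∃ c : ℝ, 0 < c ∧ ∀ r, L.R 1 ≤ r → r < L.Rinf → c ≤ L.l r := by
  have hR := L.R_one_pos
  obtain ⟨k₀, hk₀, hmin⟩ := Finset.exists_min_image (Finset.range L.K)
    (fun k => L.A k * L.R 1 ^ L.β k) ⟨0, Finset.mem_range.2 L.one_le_K⟩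
  rw [Finset.mem_range] at hk₀
  refine ⟨L.A k₀ * L.R 1 ^ L.β k₀, mul_pos (L.A_pos k₀ hk₀) (Real.rpow_pos_of_pos hR _),
    fun r h1 h2 => ?_⟩
  obtain ⟨k, hk, h3, h4⟩ := L.exists_slope (hR.le.trans h1) h2
  rw [L.l_eq hk h3 h4]
  refine (hmin k (Finset.mem_range.2 hk)).trans ?_
  exact mul_le_mul_of_nonneg_left (Real.rpow_le_rpow hR.le h1 (L.β_nonneg hd hk))
    (L.A_pos k hk).le

/-- The law of the position of a random node. -/
noncomputable def positionLaw : Measure (EuclideanSpace ℝ (Fin d)) := cond volume L.domain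

lemma volume_domain_ne_top : volume L.domain ≠ ∞ := measure_closedBall_lt_top.ne

lemma volume_domain_ne_zero : volume L.domain ≠ 0 :=
  (Metric.measure_closedBall_pos volume 0 L.Rinf_pos).ne'

instance : IsProbabilityMeasure L.positionLaw :=
  cond_isProbabilityMeasure_of_finite L.volume_domain_ne_zero L.volume_domain_ne_top

/-- Removes the null sets on which `l` may vanish: the origin, and the boundary sphere, which lies
outside the half-open annuli defining `l`. -/
lemma ae_norm_positionLaw (hd : 1 ≤ d) :
    ∀ᵐ x ∂L.positionLaw, 0 < ‖x‖ ∧ ‖x‖ < L.Rinf := by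
  have : Nonempty (Fin d) := ⟨⟨0, hd⟩⟩
  have h1 : ∀ᵐ x ∂L.positionLaw, x ∈ L.domain := ae_cond_mem measurableSet_closedBall
  have hac : L.positionLaw ≪ volume := cond_absolutelyContinuous
  have h2 : ∀ᵐ x ∂L.positionLaw, x ∉ Metric.sphere (0 : EuclideanSpace ℝ (Fin d)) L.Rinf :=
    measure_eq_zero_iff_ae_notMem.1 (hac (Measure.addHaar_sphere _ _ _))
  have h3 : ∀ᵐ x ∂L.positionLaw, x ∉ ({0} : Set (EuclideanSpace ℝ (Fin d))) :=
    measure_eq_zero_iff_ae_notMem.1 (hac (measure_singleton _))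
  filter_upwards [h1, h2, h3] with x hx1 hx2 hx3
  refine ⟨norm_pos_iff.2 hx3, lt_of_le_of_ne (mem_closedBall_zero_iff.1 hx1) fun h => hx2 ?_⟩
  exact mem_sphere_zero_iff_norm.2 h

lemma measurable_l_norm :
    Measurable fun x : EuclideanSpace ℝ (Fin d) => L.l ‖x‖ := L.measurable_l.comp measurable_norm

lemma measurable_power : Measurable L.power := by
  unfold power
  exact (measurable_coe_nnreal_ennreal.comp measurable_snd).div
    (ENNReal.measurable_ofReal.comp (L.measurable_l_norm.comp measurable_fst))

variable (F : Measure ℝ≥0)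

/-- The joint law of the position and of the channel power of a random node. -/
noncomputable def nodeLaw : Measure (EuclideanSpace ℝ (Fin d) × ℝ≥0) := L.positionLaw.prod F

lemma ae_power_ne_top (hd : 1 ≤ d) : ∀ᵐ p ∂L.nodeLaw F, L.power p ≠ ∞ := by
  have h : ∀ᵐ p ∂L.nodeLaw F, 0 < ‖p.1‖ ∧ ‖p.1‖ < L.Rinf :=
    Measure.quasiMeasurePreserving_fst.ae (L.ae_norm_positionLaw hd)
  filter_upwards [h] with p hp
  exact ENNReal.div_ne_top (by simp) (ENNReal.ofReal_pos.2 (L.l_pos hp.1 hp.2)).ne'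

variable [IsProbabilityMeasure F]

instance : IsProbabilityMeasure (L.nodeLaw F) := by unfold nodeLaw; infer_instance

/-- Brings the intensity into the form c·π, with π a probability law, that the abstract results
require. -/
lemma intensity_eq (lam : ℝ≥0) : (lam • volume.restrict L.domain).prod F =
    (lam * (volume L.domain).toNNReal) • L.nodeLaw F := by
  have h1 : volume.restrict L.domain = (volume L.domain).toNNReal • L.positionLaw := by
    have h2 : ((volume L.domain).toNNReal : ℝ≥0∞) = volume L.domain :=
      ENNReal.coe_toNNReal L.volume_domain_ne_top
    rw [positionLaw, ProbabilityTheory.cond, ENNReal.smul_def, h2, smul_smul,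
      ENNReal.mul_inv_cancel L.volume_domain_ne_zero L.volume_domain_ne_top, one_smul]
  rw [h1, smul_smul, nodeLaw, ENNReal.smul_def, ENNReal.smul_def, Measure.prod_smul_left]

/-- Survives a vanishing pathloss because in [0, ∞] division by zero gives ∞ for m ≠ 0 and 0 for m =
0. -/
lemma lt_power_iff {t : ℝ} (ht : 0 ≤ t) (p : EuclideanSpace ℝ (Fin d) × ℝ≥0) :
    ENNReal.ofReal t < L.power p ↔ t * L.l ‖p.1‖ < p.2 := by
  have h0 := L.l_nonneg ‖p.1‖
  rw [power]
  rcases h0.eq_or_lt with h | h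
  · rw [← h, ENNReal.ofReal_zero, mul_zero]
    rcases eq_or_ne p.2 0 with hp | hp
    · simp [hp]
    · simp [ENNReal.div_zero, hp, pos_iff_ne_zero]
  · rw [ENNReal.lt_div_iff_mul_lt (.inl (ENNReal.ofReal_pos.2 h).ne') (.inl (by simp)),
      ← ENNReal.ofReal_mul ht, ← ENNReal.ofReal_coe_nnreal,
      ENNReal.ofReal_lt_ofReal_iff_of_nonneg (by positivity)]

end Pathloss

/-! ### Integrable power: almost sure convergence to zero -/

/-- A sum of powers of two is at most twice its largest term. -/
lemma tsum_two_pow_indicator_le (z : ℝ≥0∞) :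
    ∑' n : ℕ, (2 : ℝ≥0∞) ^ n * {z : ℝ≥0∞ | 2 ^ n < z}.indicator 1 z ≤ 2 * z := by
  refine ENNReal.tsum_le_of_sum_range_le fun N => ?_
  induction N with
  | zero => simp
  | succ N ih =>
    rw [Finset.sum_range_succ]
    by_cases hN : (2 : ℝ≥0∞) ^ N < z
    · rw [Set.indicator_of_mem (by exact hN), Pi.one_apply, mul_one]
      have h1 : ∀ M : ℕ, ∑ n ∈ Finset.range M, (2 : ℝ≥0∞) ^ n *
          {z : ℝ≥0∞ | 2 ^ n < z}.indicator 1 z ≤ 2 ^ M := by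
        intro M
        induction M with
        | zero => simp
        | succ M ihM =>
          rw [Finset.sum_range_succ, pow_succ, mul_two]
          gcongr
          exact mul_le_of_le_one_right' (Set.indicator_le' (fun _ _ => le_rfl)
            (fun _ _ => zero_le_one) z)
      calc _ ≤ (2 : ℝ≥0∞) ^ N + 2 ^ N := by gcongr; exact h1 N
        _ = 2 * 2 ^ N := by ring
        _ ≤ 2 * z := by gcongr
    · rw [Set.indicator_of_notMem (by exact hN), mul_zero, add_zero]
      exact ih

/-- Integrate the dyadic bound at z = P/ε. This is the Borel–Cantelli series for the event that the
maximum at intensity 2^n exceeds ε·2^n. -/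
lemma tsum_two_pow_mul_measure_ne_top {E : Type*} [MeasurableSpace E] {π : Measure E}
    {P : E → ℝ≥0∞} (hP : Measurable P) (hint : ∫⁻ p, P p ∂π ≠ ∞) {ε : ℝ} (hε : 0 < ε) :
    ∑' n : ℕ, (2 : ℝ≥0∞) ^ n * π {p | ENNReal.ofReal (ε * 2 ^ n) < P p} ≠ ∞ := by
  have hε' : ENNReal.ofReal ε ≠ 0 := (ENNReal.ofReal_pos.2 hε).ne'
  have hmeas : ∀ n : ℕ, Measurable fun p => (2 : ℝ≥0∞) ^ n *
      {z : ℝ≥0∞ | 2 ^ n < z}.indicator 1 (P p / ENNReal.ofReal ε) := fun n =>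
    ((measurable_one.indicator (measurableSet_lt measurable_const measurable_id)).comp
      (hP.div_const _)).const_mul _
  have h1 : ∀ n : ℕ, (2 : ℝ≥0∞) ^ n * π {p | ENNReal.ofReal (ε * 2 ^ n) < P p} =
      ∫⁻ p, (2 : ℝ≥0∞) ^ n *
        {z : ℝ≥0∞ | 2 ^ n < z}.indicator 1 (P p / ENNReal.ofReal ε) ∂π := by
    intro n
    rw [lintegral_const_mul' _ _ (by simp)]
    congr 1
    rw [← lintegral_indicator_one (measurableSet_const_lt hP _)]
    refine lintegral_congr fun p => ?_
    have : ENNReal.ofReal (ε * 2 ^ n) < P p ↔ 2 ^ n < P p / ENNReal.ofReal ε := by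
      rw [ENNReal.lt_div_iff_mul_lt (.inl hε') (.inl (by simp)),
        ENNReal.ofReal_mul hε.le, mul_comm, ENNReal.ofReal_pow two_pos.le, ENNReal.ofReal_ofNat]
    simp only [Set.indicator, Set.mem_ofPred_eq, this, Pi.one_apply]
  simp_rw [h1]
  rw [← lintegral_tsum fun n => (hmeas n).aemeasurable]
  refine ne_top_of_le_ne_top ?_ (lintegral_mono fun p => tsum_two_pow_indicator_le _)
  rw [lintegral_const_mul' _ _ (by simp)]
  simp_rw [div_eq_mul_inv]
  rw [lintegral_mul_const' _ _ (ENNReal.inv_ne_top.2 hε')]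
  exact ENNReal.mul_ne_top (by simp) (ENNReal.mul_ne_top hint (ENNReal.inv_ne_top.2 hε'))

lemma exists_tailProb_pos {E : Type*} [MeasurableSpace E] {π : Measure E} [IsProbabilityMeasure π]
    {P : E → ℝ≥0∞} (hne : ¬ P =ᵐ[π] 0) : ∃ δ : ℝ, 0 < δ ∧ 0 < tailProb π P δ := by
  by_contra! hcon
  refine hne ?_
  have h1 : ∀ n : ℕ, ∀ᵐ p ∂π, ¬ ENNReal.ofReal (1 / (n + 1)) < P p := by
    intro n
    have h0 : tailProb π P (1 / (n + 1)) = 0 :=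
      le_antisymm (hcon _ (by positivity)) (tailProb_nonneg _)
    have h2 : π {p | ENNReal.ofReal (1 / (n + 1)) < P p} = 0 := by
      rw [← ofReal_tailProb, h0, ENNReal.ofReal_zero]
    exact measure_eq_zero_iff_ae_notMem.1 h2
  filter_upwards [ae_all_iff.2 h1] with p hp
  have h2 := (ENNReal.continuous_ofReal.tendsto _).comp tendsto_one_div_add_atTop_nhds_zero_nat
  rw [ENNReal.ofReal_zero] at h2
  exact le_antisymm (ge_of_tendsto' h2 fun n => not_lt.1 (hp n)) zero_le

lemma maxRatio_le_of_bounds {E : Type*} {P : E → ℝ≥0∞} {W : ℝ≥0} {S : Set E} {a b : ℝ}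
    (ha : 0 ≤ a) (hab : a < b) (h1 : ∀ p ∈ S, P p ≤ ENNReal.ofReal a)
    (h2 : ENNReal.ofReal b ≤ ∑' q : S, P q) :
    maxRatio P W S ≤ ENNReal.ofReal (a / (b - a)) := by
  refine iSup₂_le fun p hp => ?_
  rw [tsum_eq_add_tsum_sdiff hp] at h2
  rw [ENNReal.ofReal_div_of_pos (sub_pos.2 hab)]
  refine ENNReal.div_le_div (h1 p hp) ?_
  rw [ENNReal.ofReal_sub _ ha, tsub_le_iff_left]
  calc ENNReal.ofReal b ≤ P p + ∑' q : ↥(S \ {p}), P q := h2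
    _ ≤ _ := by gcongr; exacts [h1 p hp, le_self_add]

namespace IsPoissonProcess

variable {Ω E : Type*} [MeasurableSpace Ω] [MeasurableSpace E] {π : Measure E} {μ : Measure Ω}
  {P : E → ℝ≥0∞} [IsProbabilityMeasure π] [IsProbabilityMeasure μ]

lemma measure_exists_lt_le {Φ : Ω → Set E} {c : ℝ≥0} (h : IsPoissonProcess Φ (c • π) μ)
    (hP : Measurable P) (y : ℝ) :
    μ {ω | ¬ ∀ p ∈ Φ ω, P p ≤ ENNReal.ofReal y} ≤ c * π {p | ENNReal.ofReal y < P p} := by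
  have h1 := prob_compl_eq_one_sub (μ := μ) (h.measurableSet_forall_le hP (ENNReal.ofReal y))
  rw [h.measure_forall_le hP] at h1
  calc μ {ω | ¬ ∀ p ∈ Φ ω, P p ≤ ENNReal.ofReal y}
      = 1 - ENNReal.ofReal (Real.exp (-(c * tailProb π P y))) := h1
    _ ≤ ENNReal.ofReal (c * tailProb π P y) := by
        rw [← ENNReal.ofReal_one, ← ENNReal.ofReal_sub _ (Real.exp_nonneg _)]
        refine ENNReal.ofReal_le_ofReal ?_
        linarith [Real.add_one_le_exp (-(c * tailProb π P y))]
    _ = _ := by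
        rw [ENNReal.ofReal_mul c.coe_nonneg, ENNReal.ofReal_coe_nnreal, ofReal_tailProb]

/-- Chernoff's bound with parameter 1 gives exp(-(1/2 - 1/e)cv), where 1/e < 1/2; the weaker bound
exp(-x) ≤ 1/x is already summable along c = 2^n V. -/
lemma measure_encard_le_le {Φ : Ω → Set E} {c : ℝ≥0} (h : IsPoissonProcess Φ (c • π) μ)
    {A : Set E} (hA : MeasurableSet A) {v : ℝ} (hv : 0 < v) (hv' : ENNReal.ofReal v ≤ π A)
    (hc : 0 < c) :
    μ {ω | ((Φ ω ∩ A).encard : ℝ≥0∞) ≤ ENNReal.ofReal (c * v / 2)} ≤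
      ENNReal.ofReal (1 / ((1 / 2 - Real.exp (-1)) * (c * v))) := by
  have hκ : Real.exp (-1) < 1 / 2 := by
    rw [Real.exp_neg, ← one_div]
    exact one_div_lt_one_div_of_lt two_pos (by linarith [Real.exp_one_gt_d9])
  have hcv : 0 < c * v := mul_pos (NNReal.coe_pos.2 hc) hv
  have hm : Measurable fun ω => ((Φ ω ∩ A).encard : ℝ≥0∞) :=
    (Measurable.of_discrete (f := fun n : ℕ∞ => (n : ℝ≥0∞))).comp (h.measurable_count A hA)
  have h1 := h.lintegral_expNeg_mul_encard hA
    (measure_ne_top _ _) 1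
  simp only [one_mul] at h1
  have h2 : expNeg 1 = ENNReal.ofReal (Real.exp (-1)) := by
    rw [← expNeg_ofReal zero_le_one, ENNReal.ofReal_one]
  have h3 : ∫⁻ ω, expNeg (Φ ω ∩ A).encard ∂μ ≤
      ENNReal.ofReal (Real.exp (-((1 - Real.exp (-1)) * (c * v)))) := by
    rw [h1, ← expNeg_ofReal (mul_nonneg (by linarith) hcv.le)]
    refine expNeg_antitone ?_
    rw [ENNReal.ofReal_mul (by linarith), ENNReal.ofReal_sub _ (Real.exp_nonneg _), h2,
      ENNReal.ofReal_one, ENNReal.ofReal_mul c.coe_nonneg, ENNReal.ofReal_coe_nnreal]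
    gcongr
    calc (c : ℝ≥0∞) * ENNReal.ofReal v ≤ c * π A := by gcongr
      _ = _ := rfl
  have h4 : ENNReal.ofReal (Real.exp (-(c * v / 2))) *
      μ {ω | ((Φ ω ∩ A).encard : ℝ≥0∞) ≤ ENNReal.ofReal (c * v / 2)} ≤
      ∫⁻ ω, expNeg (Φ ω ∩ A).encard ∂μ := by
    rw [← expNeg_ofReal (by positivity)]
    refine le_trans ?_ (mul_meas_ge_le_lintegral (measurable_expNeg.comp hm)
      (expNeg (ENNReal.ofReal (c * v / 2))))
    exact mul_le_mul_right (measure_mono fun ω hω => expNeg_antitone hω) _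
  have h5 := h4.trans h3
  have h6 : Real.exp (-((1 - Real.exp (-1)) * (c * v))) = Real.exp (-(c * v / 2)) *
      Real.exp (-((1 / 2 - Real.exp (-1)) * (c * v))) := by
    rw [← Real.exp_add]; ring_nf
  rw [h6, ENNReal.ofReal_mul (Real.exp_nonneg _),
    ENNReal.mul_le_mul_iff_right (ENNReal.ofReal_pos.2 (Real.exp_pos _)).ne' (by simp)] at h5
  refine h5.trans (ENNReal.ofReal_le_ofReal ?_)
  have hpos : 0 < (1 / 2 - Real.exp (-1)) * (c * v) := mul_pos (by linarith) hcv
  rw [Real.exp_neg, ← one_div]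
  have h7 := Real.add_one_le_exp ((1 / 2 - Real.exp (-1)) * (c * v))
  exact one_div_le_one_div_of_le hpos (by linarith)

/-- If the received power is integrable and densification adds nodes, then the signal to
interference plus noise ratio tends to `0` almost surely. -/
theorem ae_tendsto_maxRatio_zero {Φ : ℝ≥0 → Ω → Set E} {V : ℝ≥0}
    (h : ∀ lam, IsPoissonProcess (Φ lam) ((lam * V) • π) μ) (hV : 0 < V) (hP : Measurable P)
    (hint : ∫⁻ p, P p ∂π ≠ ∞) (hne : ¬ P =ᵐ[π] 0) (W : ℝ≥0)
    (hmono : ∀ᵐ ω ∂μ, Monotone fun lam => Φ lam ω) :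
    ∀ᵐ ω ∂μ, Tendsto (fun lam => maxRatio P W (Φ lam ω)) atTop (𝓝 0) := by
  obtain ⟨δ, hδ, hv⟩ := exists_tailProb_pos hne
  set v := tailProb π P δ with hvdef
  have hV0 : (0 : ℝ) < V := hV
  have hmax : ∀ ε : ℝ, 0 < ε →
      ∀ᵐ ω ∂μ, ∀ᶠ n : ℕ in atTop, ∀ p ∈ Φ (2 ^ n) ω, P p ≤ ENNReal.ofReal (ε * 2 ^ n) := by
    intro ε hε
    have h1 : ∑' n : ℕ, μ {ω | ¬ ∀ p ∈ Φ (2 ^ n) ω, P p ≤ ENNReal.ofReal (ε * 2 ^ n)} ≠ ∞ := by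
      refine ne_top_of_le_ne_top (ENNReal.mul_ne_top (ENNReal.coe_ne_top (r := V))
        (tsum_two_pow_mul_measure_ne_top hP hint hε)) ?_
      rw [← ENNReal.tsum_mul_left]
      refine ENNReal.tsum_le_tsum fun n => ((h _).measure_exists_lt_le hP _).trans (le_of_eq ?_)
      push_cast; ring
    filter_upwards [ae_eventually_notMem h1] with ω hω
    filter_upwards [hω] with n hn
    simpa using hn
  have hcount : ∀ᵐ ω ∂μ, ∀ᶠ n : ℕ in atTop,
      ENNReal.ofReal (2 ^ n * V * v / 2) ≤ (Φ (2 ^ n) ω ∩ {p | ENNReal.ofReal δ < P p}).encard := by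
    have h1 : ∑' n : ℕ, μ {ω | ((Φ (2 ^ n) ω ∩ {p | ENNReal.ofReal δ < P p}).encard : ℝ≥0∞) ≤
        ENNReal.ofReal (((2 ^ n * V : ℝ≥0) : ℝ) * v / 2)} ≠ ∞ := by
      have hs : Summable fun n : ℕ =>
          1 / ((1 / 2 - Real.exp (-1)) * (((2 ^ n * V : ℝ≥0) : ℝ) * v)) := by
        have := (summable_geometric_two).mul_left (1 / ((1 / 2 - Real.exp (-1)) * (V * v)))
        refine this.congr fun n => ?_
        push_cast
        rw [one_div_pow, one_div_mul_one_div]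
        congr 1
        ring
      refine ne_top_of_le_ne_top hs.tsum_ofReal_ne_top (ENNReal.tsum_le_tsum fun n => ?_)
      exact (h (2 ^ n)).measure_encard_le_le (measurableSet_const_lt hP _) hv
        (ofReal_tailProb _).le (by positivity)
    filter_upwards [ae_eventually_notMem h1] with ω hω
    filter_upwards [hω] with n hn
    have := (not_le.1 hn).le
    push_cast at this
    exact this
  -- At intensity 2^n at least 2^n·V·v/2 nodes have power above δ, so the sum of the powers is at
  -- least κ·2^n.
  set κ := δ * (V * v / 2) with hκdef
  have hκ : 0 < κ := by positivity
  -- For 2^n ≤ λ < 2^(n+1) the maximum is bounded at 2^(n+1) and the sum at 2^n. The 4 absorbs this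
  -- factor 2 and another 2 from subtracting the maximum from the sum, leaving a ratio at most 1/(k
  -- + 1).
  have hall : ∀ᵐ ω ∂μ, ∀ k : ℕ, ∀ᶠ n : ℕ in atTop, ∀ p ∈ Φ (2 ^ n) ω,
      P p ≤ ENNReal.ofReal (κ / (4 * (k + 1)) * 2 ^ n) :=
    ae_all_iff.2 fun k => hmax _ (by positivity)
  filter_upwards [hall, hcount, hmono] with ω h1 h2 h3
  refine ENNReal.tendsto_nhds_zero.2 fun η hη => ?_
  have h4 := (ENNReal.continuous_ofReal.tendsto _).comp tendsto_one_div_add_atTop_nhds_zero_nat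
  rw [ENNReal.ofReal_zero] at h4
  obtain ⟨k, hk⟩ := (h4.eventually_lt_const hη).exists
  obtain ⟨n₀, hn₀⟩ := eventually_atTop.1 ((h1 k).and h2)
  filter_upwards [eventually_ge_atTop ((2 : ℝ≥0) ^ n₀)] with lam hlam
  obtain ⟨n, hn1, hn2⟩ := exists_nat_pow_near
    ((one_le_pow₀ (one_le_two (α := ℝ≥0)) (n := n₀)).trans hlam) one_lt_two
  have hnn : n₀ ≤ n := by
    have := (pow_lt_pow_iff_right₀ (one_lt_two (α := ℝ≥0))).1 (hlam.trans_lt hn2)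
    omega
  have ha : ∀ p ∈ Φ lam ω, P p ≤ ENNReal.ofReal (κ / (4 * (k + 1)) * 2 ^ (n + 1)) := fun p hp =>
    (hn₀ (n + 1) (by omega)).1 p (h3 hn2.le hp)
  have hb : ENNReal.ofReal (κ * 2 ^ n) ≤ ∑' q : Φ lam ω, P q := by
    have hA := measurableSet_const_lt hP (ENNReal.ofReal δ)
    calc ENNReal.ofReal (κ * 2 ^ n)
        = ENNReal.ofReal δ * ENNReal.ofReal (2 ^ n * V * v / 2) := by
          rw [← ENNReal.ofReal_mul hδ.le, hκdef]; ring_nf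
      _ ≤ ENNReal.ofReal δ * (Φ lam ω ∩ {p | ENNReal.ofReal δ < P p}).encard := by
          gcongr
          refine (hn₀ n hnn).2.trans ?_
          have : (Φ (2 ^ n) ω ∩ {p | ENNReal.ofReal δ < P p}).encard ≤
              (Φ lam ω ∩ {p | ENNReal.ofReal δ < P p}).encard :=
            Set.encard_le_encard (Set.inter_subset_inter_left _ (h3 hn1))
          exact_mod_cast this
      _ = ∫⁻ q in {p | ENNReal.ofReal δ < P p}, ENNReal.ofReal δ ∂pointMeasure (Φ lam ω) := by
          rw [setLIntegral_const, pointMeasure_apply _ hA]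
      _ ≤ ∫⁻ q in {p | ENNReal.ofReal δ < P p}, P q ∂pointMeasure (Φ lam ω) :=
          setLIntegral_mono' hA fun q hq => hq.le
      _ ≤ ∫⁻ q, P q ∂pointMeasure (Φ lam ω) := setLIntegral_le_lintegral _ _
      _ = _ := lintegral_pointMeasure _ hP
  have h2n : (0 : ℝ) < 2 ^ n := by positivity
  have hk0 : (0 : ℝ) ≤ k := Nat.cast_nonneg k
  have hae : κ / (4 * (k + 1)) * 2 ^ (n + 1) = κ * 2 ^ n * (1 / (2 * (k + 1))) := by
    rw [pow_succ]; field_simp; ring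
  have hhalf : (1 : ℝ) / (2 * (k + 1)) ≤ 1 / 2 :=
    one_div_le_one_div_of_le two_pos (by linarith)
  have hκ2 : 0 < κ * 2 ^ n := by positivity
  refine (maxRatio_le_of_bounds (by positivity) ?_ ha hb).trans
    ((ENNReal.ofReal_le_ofReal ?_).trans hk.le)
  · rw [hae]; nlinarith
  · rw [hae, div_le_iff₀ (by nlinarith)]
    have h6 : κ * 2 ^ n * (1 / (2 * (k + 1))) = 1 / (k + 1) * (κ * 2 ^ n * (1 / 2)) := by
      field_simp
    calc κ * 2 ^ n * (1 / (2 * (k + 1))) = 1 / (k + 1) * (κ * 2 ^ n * (1 / 2)) := h6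
      _ ≤ _ := by gcongr; nlinarith

end IsPoissonProcess

/-! ### Dyadic tail bounds and moments -/

section Moments

lemma le_one_add_tsum_two_pow_indicator (z : ℝ≥0∞) :
    z ≤ 1 + ∑' n : ℕ, (2 : ℝ≥0∞) ^ n * {z : ℝ≥0∞ | 2 ^ n < z}.indicator 1 z := by
  have h1 : ∀ N : ℕ, min z (2 ^ N) ≤ 1 + ∑' n : ℕ, (2 : ℝ≥0∞) ^ n *
      {z : ℝ≥0∞ | 2 ^ n < z}.indicator 1 z := by
    intro N
    refine le_trans ?_ (add_le_add_right (ENNReal.sum_le_tsum (Finset.range N)) 1)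
    induction N with
    | zero => simp
    | succ N ih =>
      rw [Finset.sum_range_succ]
      by_cases hN : (2 : ℝ≥0∞) ^ N < z
      · rw [min_eq_right hN.le] at ih
        rw [Set.indicator_of_mem (by exact hN), Pi.one_apply, mul_one, ← add_assoc]
        refine (min_le_right _ _).trans ?_
        rw [pow_succ, mul_two]
        gcongr
      · have hz := not_lt.1 hN
        rw [Set.indicator_of_notMem (by exact hN), mul_zero, add_zero]
        rw [min_eq_left hz] at ih
        exact (min_le_left _ _).trans ih
  have h2 : Tendsto (fun N : ℕ => min z ((2 : ℝ≥0∞) ^ N)) atTop (𝓝 z) := by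
    have h3 : Tendsto (fun N : ℕ => (2 : ℝ≥0∞) ^ N) atTop (𝓝 ∞) :=
      ENNReal.tendsto_pow_atTop_nhds_top_iff.2 (by norm_num)
    simpa using (tendsto_const_nhds (x := z)).min h3
  exact le_of_tendsto' h2 h1

/-- Integrating `le_one_add_tsum_two_pow_indicator` bounds the mean by 1 + ∑ C(2q)^n. -/
lemma lintegral_ne_top_of_tailProb_le {E : Type*} [MeasurableSpace E] {π : Measure E}
    [IsProbabilityMeasure π] {X : E → ℝ≥0∞} (hX : Measurable X) {C q : ℝ} (hq0 : 0 ≤ q)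
    (hq : 2 * q < 1) (h : ∀ n : ℕ, tailProb π X (2 ^ n) ≤ C * q ^ n) : ∫⁻ p, X p ∂π ≠ ∞ := by
  have hmeas : ∀ n : ℕ, Measurable fun p => (2 : ℝ≥0∞) ^ n *
      {z : ℝ≥0∞ | 2 ^ n < z}.indicator 1 (X p) := fun n =>
    ((measurable_one.indicator (measurableSet_lt measurable_const measurable_id)).comp
      hX).const_mul _
  have hC : 0 ≤ C := by simpa using (tailProb_nonneg _).trans (h 0)
  have hterm : ∀ n : ℕ, ∫⁻ p, (2 : ℝ≥0∞) ^ n * {z : ℝ≥0∞ | 2 ^ n < z}.indicator 1 (X p) ∂π ≤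
      ENNReal.ofReal (C * (2 * q) ^ n) := by
    intro n
    have h1 : ∫⁻ p, {z : ℝ≥0∞ | 2 ^ n < z}.indicator 1 (X p) ∂π =
        ENNReal.ofReal (tailProb π X (2 ^ n)) := by
      rw [ofReal_tailProb, ← lintegral_indicator_one (measurableSet_const_lt hX _)]
      refine lintegral_congr fun p => ?_
      simp only [Set.indicator, Set.mem_ofPred_eq, ENNReal.ofReal_pow two_pos.le,
        ENNReal.ofReal_ofNat, Pi.one_apply]
    rw [lintegral_const_mul' _ _ (by simp), h1, ← ENNReal.ofReal_ofNat 2,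
      ← ENNReal.ofReal_pow two_pos.le, ← ENNReal.ofReal_mul (by positivity)]
    refine ENNReal.ofReal_le_ofReal ?_
    calc 2 ^ n * tailProb π X (2 ^ n) ≤ 2 ^ n * (C * q ^ n) := by gcongr; exact h n
      _ = _ := by rw [mul_pow]; ring
  have hsum : Summable fun n : ℕ => C * (2 * q) ^ n :=
    (summable_geometric_of_lt_one (by positivity) hq).mul_left C
  refine ne_top_of_le_ne_top ?_ (lintegral_mono fun p => le_one_add_tsum_two_pow_indicator (X p))
  rw [lintegral_add_left measurable_const, lintegral_tsum fun n => (hmeas n).aemeasurable]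
  exact ENNReal.add_ne_top.2 ⟨by simp,
    ne_top_of_le_ne_top hsum.tsum_ofReal_ne_top (ENNReal.tsum_le_tsum hterm)⟩

lemma exists_geometric_bound {h H : ℝ → ℝ} {q x₀ M : ℝ} (hle : ∀ x, h x ≤ 1) (hq0 : 0 < q)
    (hq1 : q ≤ 1) (hM : 0 ≤ M) (hpos : ∀ x, 0 < x → 0 < H x)
    (hH : ∀ x, x₀ ≤ x → H (2 * x) ≤ q * H x) (hhH : ∀ x, x₀ ≤ x → h x ≤ M * H x) :
    ∃ C, ∀ n : ℕ, h (2 ^ n) ≤ C * q ^ n := by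
  obtain ⟨N, hN⟩ := pow_unbounded_of_one_lt x₀ (one_lt_two (α := ℝ))
  have hH' : ∀ k : ℕ, H (2 ^ (N + k)) ≤ q ^ k * H (2 ^ N) := by
    intro k
    induction k with
    | zero => simp
    | succ k ih =>
      have hge : x₀ ≤ 2 ^ (N + k) :=
        hN.le.trans (pow_le_pow_right₀ one_le_two (Nat.le_add_right N k))
      calc H (2 ^ (N + (k + 1))) = H (2 * 2 ^ (N + k)) := by rw [← pow_succ']; rfl
        _ ≤ q * H (2 ^ (N + k)) := hH _ hge
        _ ≤ q * (q ^ k * H (2 ^ N)) := by gcongr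
        _ = _ := by ring
  have hHN := (hpos (2 ^ N) (by positivity)).le
  -- The summand 1 covers n < N, where only `h ≤ 1` is available.
  refine ⟨(M * H (2 ^ N) + 1) * (q ^ N)⁻¹, fun n => ?_⟩
  rcases le_or_gt N n with hn | hn
  · obtain ⟨k, rfl⟩ := Nat.exists_eq_add_of_le hn
    calc h (2 ^ (N + k)) ≤ M * H (2 ^ (N + k)) :=
          hhH _ (hN.le.trans (pow_le_pow_right₀ one_le_two hn))
      _ ≤ M * (q ^ k * H (2 ^ N)) := by gcongr; exact hH' k
      _ ≤ (M * H (2 ^ N) + 1) * q ^ k := by nlinarith [pow_pos hq0 k]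
      _ = _ := by rw [pow_add]; field_simp
  · calc h (2 ^ n) ≤ 1 := hle _
      _ ≤ (M * H (2 ^ N) + 1) * 1 := by nlinarith [mul_nonneg hM hHN]
      _ ≤ (M * H (2 ^ N) + 1) * ((q ^ N)⁻¹ * q ^ n) := by
          gcongr
          rw [inv_mul_eq_div, one_le_div (by positivity)]
          exact pow_le_pow_of_le_one hq0.le hq1 hn.le
      _ = _ := by ring

/-- A tail in one of the considered classes is either regularly varying with an index in
`[-1, 0]`, or decays faster than `x ^ (-κ)` for some `κ > 1`. -/
lemma ClassifiedTail.regularlyVarying_or_bound {h : ℝ → ℝ} (hh : ClassifiedTail h)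
    (hle : ∀ x, h x ≤ 1) :
    (∃ α : ℝ, 0 ≤ α ∧ α ≤ 1 ∧ RegularlyVarying h (-α)) ∨
      ∃ C q : ℝ, 0 ≤ q ∧ 2 * q < 1 ∧ ∀ n : ℕ, h (2 ^ n) ≤ C * q ^ n := by
  -- Any factor below 1/2 gives a summable dyadic series; 1/4 is a convenient choice.
  have hrapid : ∀ {H : ℝ → ℝ}, RapidlyVarying H →
      ∃ x₀, ∀ x, x₀ ≤ x → H (2 * x) ≤ 1 / 4 * H x := by
    rintro H ⟨hpos, -, hlim, -⟩
    obtain ⟨x₀, hx₀⟩ := eventually_atTop.1 (((hlim 2 one_lt_two).eventually_lt_const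
      (show (0 : ℝ) < 1 / 4 by norm_num)).and (eventually_gt_atTop 0))
    exact ⟨x₀, fun x hx => ((div_lt_iff₀ (hpos x (hx₀ x hx).2)).1 (hx₀ x hx).1).le⟩
  rcases hh with ⟨α, hα, hreg⟩ | hrap | ⟨H, hrap, ho⟩
  · rcases le_or_gt α 1 with h1 | h1
    · exact .inl ⟨α, hα, h1, hreg⟩
    · right
      have h2 : (2 : ℝ) ^ (-α) < 2 ^ (-1 : ℝ) :=
        Real.rpow_lt_rpow_of_exponent_lt one_lt_two (by linarith)
      rw [Real.rpow_neg_one] at h2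
      obtain ⟨q, hq1, hq2⟩ := exists_between h2
      have hq0 : 0 < q := (Real.rpow_pos_of_pos two_pos _).trans hq1
      obtain ⟨hpos, -, hlim⟩ := hreg
      obtain ⟨x₀, hx₀⟩ := eventually_atTop.1 (((hlim 2 two_pos).eventually_lt_const hq1).and
        (eventually_gt_atTop 0))
      obtain ⟨C, hC⟩ := exists_geometric_bound (H := h) (x₀ := x₀) hle hq0 (by linarith)
        zero_le_one hpos
        (fun x hx => ((div_lt_iff₀ (hpos x (hx₀ x hx).2)).1 (hx₀ x hx).1).le)
        (fun x _ => (one_mul (h x)).ge)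
      exact ⟨C, q, hq0.le, by linarith, hC⟩
  · right
    obtain ⟨x₀, hx₀⟩ := hrapid hrap
    obtain ⟨C, hC⟩ := exists_geometric_bound (H := h) (x₀ := x₀) hle
      (by norm_num : (0 : ℝ) < 1 / 4) (by norm_num) zero_le_one hrap.1 hx₀
      (fun x _ => (one_mul (h x)).ge)
    exact ⟨C, 1 / 4, by norm_num, by norm_num, hC⟩
  · right
    obtain ⟨x₀, hx₀⟩ := hrapid hrap
    obtain ⟨x₁, hx₁⟩ := eventually_atTop.1
      ((ho.bound one_pos).and (eventually_gt_atTop (0 : ℝ)))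
    obtain ⟨C, hC⟩ := exists_geometric_bound (H := H) (h := h) (x₀ := max x₀ x₁) hle
      (by norm_num : (0 : ℝ) < 1 / 4) (by norm_num) zero_le_one hrap.1
      (fun x hx => hx₀ x ((le_max_left _ _).trans hx))
      (fun x hx => by
        have h1 := hx₁ x ((le_max_right _ _).trans hx)
        have h2 := h1.1
        rw [Real.norm_of_nonneg (hrap.1 x h1.2).le] at h2
        exact (Real.le_norm_self _).trans h2)
    exact ⟨C, 1 / 4, by norm_num, by norm_num, hC⟩

end Moments

/-! ### The tail of the channel power -/

section ChannelTail

variable {F : Measure ℝ≥0}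

lemma channelTail_nonneg (t : ℝ) : 0 ≤ channelTail F t := ENNReal.toReal_nonneg

lemma tailProb_coe_eq_channelTail {t : ℝ} (ht : 0 ≤ t) :
    tailProb F (fun m : ℝ≥0 => (m : ℝ≥0∞)) t = channelTail F t := by
  unfold tailProb channelTail
  congr 3
  ext m
  simp only
  rw [← ENNReal.ofReal_coe_nnreal, ENNReal.ofReal_lt_ofReal_iff_of_nonneg ht]

variable [IsProbabilityMeasure F]

lemma channelTail_le_one (t : ℝ) : channelTail F t ≤ 1 := ENNReal.toReal_mono (by simp) prob_le_one

lemma channelTail_antitone : Antitone (channelTail F) := fun _ _ h =>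
  ENNReal.toReal_mono (measure_ne_top _ _) (measure_mono fun _ hp => h.trans_lt hp)

lemma ne_ae_zero_of_ne_dirac (hF : F ≠ Measure.dirac 0) : ¬ ∀ᵐ m ∂F, m = 0 := by
  intro h
  refine hF ?_
  have h1 : F.map id = F.map (fun _ => 0) := Measure.map_congr h
  rw [Measure.map_id, Measure.map_const, measure_univ, one_smul] at h1
  exact h1

end ChannelTail

/-! ### The law of the pathloss near zero -/

namespace Pathloss

variable {d : ℕ} (L : Pathloss d)

/-- The distribution function of the pathloss of a random node. -/
noncomputable def lossCDF (z : ℝ) : ℝ := (L.positionLaw {x | L.l ‖x‖ < z}).toReal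

lemma lossCDF_nonneg (z : ℝ) : 0 ≤ L.lossCDF z := ENNReal.toReal_nonneg

lemma lossCDF_le_one (z : ℝ) : L.lossCDF z ≤ 1 := ENNReal.toReal_mono (by simp) prob_le_one

lemma lossCDF_mono : Monotone L.lossCDF := fun _ _ h =>
  ENNReal.toReal_mono (measure_ne_top _ _) (measure_mono fun _ hp => lt_of_lt_of_le hp h)

lemma ofReal_lossCDF (z : ℝ) :
    ENNReal.ofReal (L.lossCDF z) = L.positionLaw {x | L.l ‖x‖ < z} :=
  ENNReal.ofReal_toReal (measure_ne_top _ _)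

lemma measurableSet_l_lt (z : ℝ) :
    MeasurableSet {x : EuclideanSpace ℝ (Fin d) | L.l ‖x‖ < z} :=
  measurableSet_lt L.measurable_l_norm measurable_const

lemma exists_lossCDF_eq_zero (hd : 1 ≤ d) (hβ : L.β 0 = 0) : ∃ z₀ : ℝ, 0 < z₀ ∧
    L.lossCDF z₀ = 0 := by
  obtain ⟨c, hc, hcl⟩ := L.exists_le_l hd
  refine ⟨min c (L.A 0), lt_min hc (L.A_pos 0 L.one_le_K), ?_⟩
  have : L.positionLaw {x | L.l ‖x‖ < min c (L.A 0)} = 0 := by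
    rw [measure_eq_zero_iff_ae_notMem]
    filter_upwards [L.ae_norm_positionLaw hd] with x hx hlt
    rcases lt_or_ge ‖x‖ (L.R 1) with h | h
    · have h1 : L.l ‖x‖ < min c (L.A 0) := hlt
      rw [L.l_eq L.one_le_K (by rw [L.R_zero]; exact hx.1.le) h, hβ, Real.rpow_zero,
        mul_one] at h1
      exact absurd h1 (not_lt.2 (min_le_right _ _))
    · exact absurd hlt (not_lt.2 ((min_le_left _ _).trans (hcl _ h hx.2)))
  rw [lossCDF, this, ENNReal.toReal_zero]

/-- For small z only the first slope matters, so {l < z} is, up to a null set, the ball of radius ρ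
= (z/A₀)^(1/β₀), whose volume is proportional to ρ^d. -/
lemma exists_lossCDF_eq (hd : 1 ≤ d) (hβ : 0 < L.β 0) : ∃ C z₀ : ℝ, 0 < C ∧ 0 < z₀ ∧
    ∀ z, 0 ≤ z → z ≤ z₀ → L.lossCDF z = C * z ^ (d / L.β 0) := by
  have hne : Nonempty (Fin d) := ⟨⟨0, hd⟩⟩
  obtain ⟨c, hc, hcl⟩ := L.exists_le_l hd
  have hA := L.A_pos 0 L.one_le_K
  have hR := L.R_one_pos
  have hdpos : (0 : ℝ) < d := by exact_mod_cast hd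
  set κ : ℝ := ((volume L.domain)⁻¹ *
    volume (Metric.ball (0 : EuclideanSpace ℝ (Fin d)) 1)).toReal with hκ
  have hκt : (volume L.domain)⁻¹ * volume (Metric.ball (0 : EuclideanSpace ℝ (Fin d)) 1) ≠ ∞ :=
    ENNReal.mul_ne_top (ENNReal.inv_ne_top.2 L.volume_domain_ne_zero) measure_ball_lt_top.ne
  have hκ0 : 0 < κ := ENNReal.toReal_pos
    (mul_ne_zero (ENNReal.inv_ne_zero.2 L.volume_domain_ne_top)
      (Metric.measure_ball_pos volume _ one_pos).ne') hκt
  have hz₀ : 0 < min c (L.A 0 * L.R 1 ^ L.β 0) := by positivity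
  refine ⟨κ * ((L.A 0)⁻¹) ^ (d / L.β 0), min c (L.A 0 * L.R 1 ^ L.β 0), by positivity, hz₀,
    fun z hz hzz => ?_⟩
  set ρ := (z / L.A 0) ^ (1 / L.β 0) with hρ
  have hρ0 : 0 ≤ ρ := by positivity
  have hρβ : ρ ^ L.β 0 = z / L.A 0 := by
    rw [hρ, ← Real.rpow_mul (by positivity), one_div_mul_cancel hβ.ne', Real.rpow_one]
  have hρR : ρ ≤ L.R 1 := by
    rw [← Real.rpow_le_rpow_iff hρ0 hR.le hβ, hρβ, div_le_iff₀ hA, mul_comm]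
    exact hzz.trans (min_le_right _ _)
  have hset : L.positionLaw {x | L.l ‖x‖ < z} = L.positionLaw (Metric.ball 0 ρ) := by
    refine measure_congr ?_
    filter_upwards [L.ae_norm_positionLaw hd] with x hx
    refine propext ?_
    change L.l ‖x‖ < z ↔ x ∈ Metric.ball 0 ρ
    rw [mem_ball_zero_iff]
    rcases lt_or_ge ‖x‖ (L.R 1) with h | h
    · rw [L.l_eq L.one_le_K (by rw [L.R_zero]; exact hx.1.le) h,
        ← Real.rpow_lt_rpow_iff hx.1.le hρ0 hβ, hρβ, lt_div_iff₀ hA, mul_comm]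
    · exact iff_of_false (not_lt.2 ((hzz.trans (min_le_left _ _)).trans (hcl _ h hx.2)))
        (not_lt.2 (hρR.trans h))
  have hsub : L.domain ∩ Metric.ball 0 ρ = Metric.ball 0 ρ := by
    refine Set.inter_eq_right.2 fun x hx => ?_
    rw [mem_ball_zero_iff] at hx
    exact mem_closedBall_zero_iff.2 (hx.le.trans (hρR.trans L.R_one_le))
  have hvol : L.positionLaw (Metric.ball 0 ρ) = ENNReal.ofReal (ρ ^ d) * ((volume L.domain)⁻¹ *
      volume (Metric.ball (0 : EuclideanSpace ℝ (Fin d)) 1)) := by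
    rw [positionLaw, cond_apply (show MeasurableSet L.domain from measurableSet_closedBall), hsub,
      Measure.addHaar_ball _ _ hρ0,
      finrank_euclideanSpace, Fintype.card_fin]
    ring
  rw [lossCDF, hset, hvol, ENNReal.toReal_mul, ENNReal.toReal_ofReal (by positivity), ← hκ,
    ← Real.rpow_natCast, hρ, ← Real.rpow_mul (by positivity), div_eq_mul_inv z,
    Real.mul_rpow hz (by positivity), one_div_mul_eq_div]
  ring

lemma lintegral_inv_l_ne_top_of_exponent_eq_zero (hd : 1 ≤ d) (hβ : L.β 0 = 0) :
    ∫⁻ x, (ENNReal.ofReal (L.l ‖x‖))⁻¹ ∂L.positionLaw ≠ ∞ := by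
  obtain ⟨z₀, hz₀, h0⟩ := L.exists_lossCDF_eq_zero hd hβ
  have h1 : L.positionLaw {x | L.l ‖x‖ < z₀} = 0 := by
    rw [← ofReal_lossCDF, h0, ENNReal.ofReal_zero]
  have h2 : ∫⁻ x, (ENNReal.ofReal (L.l ‖x‖))⁻¹ ∂L.positionLaw ≤
      ∫⁻ x, (ENNReal.ofReal z₀)⁻¹ ∂L.positionLaw := by
    refine lintegral_mono_ae ?_
    filter_upwards [measure_eq_zero_iff_ae_notMem.1 h1] with x hx
    exact ENNReal.inv_le_inv.2 (ENNReal.ofReal_le_ofReal (not_lt.1 hx))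
  refine ne_top_of_le_ne_top ?_ h2
  rw [lintegral_const, measure_univ, mul_one]
  exact ENNReal.inv_ne_top.2 (ENNReal.ofReal_pos.2 hz₀).ne'

lemma exists_lossCDF_le (hd : 1 ≤ d) (hβ : 0 < L.β 0) : ∃ C : ℝ, 0 < C ∧
    ∀ z, 0 ≤ z → L.lossCDF z ≤ C * z ^ (d / L.β 0) := by
  obtain ⟨C, z₀, hC, hz₀, h⟩ := L.exists_lossCDF_eq hd hβ
  refine ⟨max C ((z₀⁻¹) ^ (d / L.β 0)), lt_max_of_lt_left hC, fun z hz => ?_⟩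
  rcases le_or_gt z z₀ with hzz | hzz
  · rw [h z hz hzz]
    gcongr
    exact le_max_left _ _
  · calc L.lossCDF z ≤ 1 := L.lossCDF_le_one z
      _ ≤ (z₀⁻¹ * z) ^ (d / L.β 0) := by
          refine Real.one_le_rpow ?_ (by positivity)
          rw [inv_mul_eq_div]
          exact (one_le_div hz₀).2 hzz.le
      _ = (z₀⁻¹) ^ (d / L.β 0) * z ^ (d / L.β 0) := Real.mul_rpow (by positivity) hz
      _ ≤ _ := by gcongr; exact le_max_right _ _

/-- The tail of 1/l at 2^n is at most C·2^(-nd/β₀), and d/β₀ > 1 makes this ratio smaller than 1/2.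
-/
lemma lintegral_inv_l_ne_top (hd : 1 ≤ d) (hβ : 0 < L.β 0) (hγ : 1 < d / L.β 0) :
    ∫⁻ x, (ENNReal.ofReal (L.l ‖x‖))⁻¹ ∂L.positionLaw ≠ ∞ := by
  obtain ⟨C, hC, h⟩ := L.exists_lossCDF_le hd hβ
  have hq : (2 : ℝ) ^ (-(d / L.β 0)) < 2 ^ (-1 : ℝ) :=
    Real.rpow_lt_rpow_of_exponent_lt one_lt_two (by linarith)
  rw [Real.rpow_neg_one] at hq
  refine lintegral_ne_top_of_tailProb_le (C := C) (q := 2 ^ (-(d / L.β 0)))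
    (ENNReal.measurable_ofReal.comp L.measurable_l_norm).inv (by positivity) (by linarith)
    fun n => ?_
  have h1 : tailProb L.positionLaw (fun x => (ENNReal.ofReal (L.l ‖x‖))⁻¹) (2 ^ n) =
      L.lossCDF ((2 ^ n)⁻¹) := by
    unfold tailProb lossCDF
    congr 3
    ext x
    rw [ENNReal.lt_inv_iff_lt_inv, ← ENNReal.ofReal_inv_of_pos (by positivity),
      ENNReal.ofReal_lt_ofReal_iff (by positivity)]
  rw [h1]
  refine (h _ (by positivity)).trans (le_of_eq ?_)
  rw [Real.inv_rpow (by positivity), ← Real.rpow_natCast 2, ← Real.rpow_natCast (2 ^ _),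
    ← Real.rpow_mul two_pos.le, ← Real.rpow_mul two_pos.le, ← Real.rpow_neg two_pos.le]
  congr 2
  ring

variable (F : Measure ℝ≥0)

lemma powerTail_eq_tailProb : L.powerTail F = tailProb (L.nodeLaw F) L.power := rfl

variable [IsProbabilityMeasure F]

lemma lintegral_power : ∫⁻ p, L.power p ∂L.nodeLaw F =
    (∫⁻ x, (ENNReal.ofReal (L.l ‖x‖))⁻¹ ∂L.positionLaw) * ∫⁻ m, (m : ℝ≥0∞) ∂F := by
  rw [nodeLaw, ← lintegral_prod_mul (f := fun x => (ENNReal.ofReal (L.l ‖x‖))⁻¹)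
    (g := fun m : ℝ≥0 => (m : ℝ≥0∞))
    (ENNReal.measurable_ofReal.comp L.measurable_l_norm).inv.aemeasurable
    measurable_coe_nnreal_ennreal.aemeasurable]
  refine lintegral_congr fun p => ?_
  rw [power, div_eq_mul_inv, mul_comm]

lemma measurableSet_mul_l_lt (t : ℝ) :
    MeasurableSet {p : EuclideanSpace ℝ (Fin d) × ℝ≥0 | t * L.l ‖p.1‖ < p.2} :=
  measurableSet_lt ((L.measurable_l_norm.comp measurable_fst).const_mul t)
    (measurable_subtype_coe.comp measurable_snd)

lemma ofReal_powerTail {t : ℝ} (ht : 0 ≤ t) : ENNReal.ofReal (L.powerTail F t) =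
    L.nodeLaw F {p | t * L.l ‖p.1‖ < p.2} := by
  rw [powerTail_eq_tailProb, ofReal_tailProb]
  simp_rw [L.lt_power_iff ht]

/-- Conditioning on the channel power; used when small pathlosses drive the tail.
`powerTail_eq_integral_channelTail` conditions on the position instead, for the case in which the
channel drives it. -/
lemma ofReal_powerTail_eq_lintegral_lossCDF {t : ℝ} (ht : 0 < t) :
    ENNReal.ofReal (L.powerTail F t) = ∫⁻ m, ENNReal.ofReal (L.lossCDF (m / t)) ∂F := by
  rw [L.ofReal_powerTail F ht.le, nodeLaw, Measure.prod_apply_symm (L.measurableSet_mul_l_lt t)]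
  refine lintegral_congr fun m => ?_
  rw [ofReal_lossCDF]
  congr 1
  ext x
  simp only [Set.mem_preimage, Set.mem_ofPred_eq]
  rw [lt_div_iff₀ ht, mul_comm]

lemma powerTail_eq_integral_channelTail {t : ℝ} (ht : 0 ≤ t) :
    L.powerTail F t = ∫ x, channelTail F (t * L.l ‖x‖) ∂L.positionLaw := by
  have h1 : ENNReal.ofReal (L.powerTail F t) =
      ∫⁻ x, F {m | t * L.l ‖x‖ < m} ∂L.positionLaw := by
    rw [L.ofReal_powerTail F ht, nodeLaw, Measure.prod_apply (L.measurableSet_mul_l_lt t)]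
    rfl
  have hm : AEMeasurable (fun x => F {m | t * L.l ‖x‖ < m}) L.positionLaw :=
    (measurable_measure_prodMk_left (ν := F) (L.measurableSet_mul_l_lt t)).aemeasurable
  have h2 := integral_toReal hm (.of_forall fun x => measure_lt_top _ _)
  rw [← h1, ENNReal.toReal_ofReal (show 0 ≤ L.powerTail F t from tailProb_nonneg _)] at h2
  exact h2.symm

lemma integrable_channelTail (t : ℝ) :
    Integrable (fun x => channelTail F (t * L.l ‖x‖)) L.positionLaw := by
  refine Integrable.of_bound (C := 1) (channelTail_antitone.measurable.comp
    (L.measurable_l_norm.const_mul t)).aestronglyMeasurable (.of_forall fun x => ?_)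
  rw [Real.norm_of_nonneg (channelTail_nonneg _)]
  exact channelTail_le_one _

end Pathloss

/-! ### Regular variation of the power tail and finiteness of its mean -/

/-- An antitone function that is asymptotic to `c * t ^ (-γ)` is regularly varying. -/
lemma RegularlyVarying.of_tendsto_rpow_mul {h : ℝ → ℝ} (hanti : Antitone h) {γ c : ℝ}
    (hc : 0 < c) (hlim : Tendsto (fun t : ℝ => t ^ γ * h t) atTop (𝓝 c)) :
    RegularlyVarying h (-γ) := by
  refine ⟨fun x _ => ?_, hanti.measurable.aemeasurable, fun s hs => ?_⟩
  · obtain ⟨t, ht, ht0, hxt⟩ := ((hlim.eventually_const_lt hc).and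
      ((eventually_gt_atTop 0).and (eventually_ge_atTop x))).exists
    exact (pos_of_mul_pos_right ht (Real.rpow_nonneg ht0.le γ)).trans_le (hanti hxt)
  · have h1 : Tendsto (fun t : ℝ => (s * t) ^ γ * h (s * t)) atTop (𝓝 c) :=
      hlim.comp (tendsto_id.const_mul_atTop hs)
    have h2 := (h1.div hlim hc.ne').const_mul (s ^ (-γ))
    rw [div_self hc.ne', mul_one] at h2
    refine h2.congr' ?_
    filter_upwards [eventually_gt_atTop 0] with t ht
    have h3 := Real.rpow_pos_of_pos hs γ
    have h4 := Real.rpow_pos_of_pos ht γ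
    rw [Pi.div_apply, Real.mul_rpow hs.le ht.le, Real.rpow_neg hs.le, mul_assoc, mul_div_assoc,
      mul_div_mul_left _ _ h4.ne', inv_mul_cancel_left₀ h3.ne']

namespace Pathloss

variable {d : ℕ} (L : Pathloss d) (F : Measure ℝ≥0) [IsProbabilityMeasure F]

lemma powerTail_antitone : Antitone (L.powerTail F) :=
  tailProb_antitone (π := L.nodeLaw F)

lemma measurable_lossCDF : Measurable L.lossCDF := L.lossCDF_mono.measurable

lemma ofReal_rpow_mul_powerTail {t : ℝ} (ht : 0 < t) (γ : ℝ) :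
    ENNReal.ofReal (t ^ γ * L.powerTail F t) =
      ∫⁻ m : ℝ≥0, ENNReal.ofReal (t ^ γ * L.lossCDF (m / t)) ∂F := by
  have h0 := Real.rpow_nonneg ht.le γ
  rw [ENNReal.ofReal_mul h0, L.ofReal_powerTail_eq_lintegral_lossCDF F ht,
    ← lintegral_const_mul' _ _ ENNReal.ofReal_ne_top]
  simp_rw [ENNReal.ofReal_mul h0]

variable {F}

/-- If the channel power has a moment of order `d / β₀`, the power tail decays like
`t ^ (-d / β₀)`. -/
lemma regularlyVarying_powerTail_of_moment (hd : 1 ≤ d) (hβ : 0 < L.β 0)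
    (hF : ¬ ∀ᵐ m ∂F, m = 0)
    (hm : ∫⁻ m : ℝ≥0, ENNReal.ofReal ((m : ℝ) ^ (d / L.β 0)) ∂F ≠ ∞) :
    RegularlyVarying (L.powerTail F) (-(d / L.β 0)) := by
  set γ : ℝ := d / L.β 0 with hγ
  have hγ0 : 0 < γ := div_pos (by exact_mod_cast hd) hβ
  obtain ⟨C, z₀, hC, hz₀, heq⟩ := L.exists_lossCDF_eq hd hβ
  obtain ⟨C', hC', hle⟩ := L.exists_lossCDF_le hd hβ
  have hmeas : Measurable fun m : ℝ≥0 => (m : ℝ) ^ γ := by fun_prop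
  set c : ℝ≥0∞ := ∫⁻ m : ℝ≥0, ENNReal.ofReal (C * (m : ℝ) ^ γ) ∂F with hc
  have hfin : ∀ a : ℝ, 0 ≤ a → ∫⁻ m : ℝ≥0, ENNReal.ofReal (a * (m : ℝ) ^ γ) ∂F ≠ ∞ := by
    intro a ha
    simp_rw [ENNReal.ofReal_mul ha]
    rw [lintegral_const_mul' _ _ ENNReal.ofReal_ne_top]
    exact ENNReal.mul_ne_top ENNReal.ofReal_ne_top hm
  have hc0 : c ≠ 0 := by
    rw [hc, Ne, lintegral_eq_zero_iff (hmeas.const_mul C).ennreal_ofReal]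
    refine fun h => hF ?_
    filter_upwards [h] with m hm0
    by_contra hne
    have hmpos : (0 : ℝ) < m := by exact_mod_cast pos_iff_ne_zero.2 hne
    exact absurd (ENNReal.ofReal_eq_zero.1 hm0)
      (not_le.2 (mul_pos hC (Real.rpow_pos_of_pos hmpos γ)))
  have hlim : Tendsto (fun t : ℝ => ENNReal.ofReal (t ^ γ * L.powerTail F t)) atTop (𝓝 c) := by
    -- For fixed m the integrand equals C·m^γ once m/t ≤ z₀, and it is dominated by C'·m^γ
    -- throughout.
    have h1 : Tendsto (fun t : ℝ => ∫⁻ m : ℝ≥0, ENNReal.ofReal (t ^ γ * L.lossCDF (m / t)) ∂F)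
        atTop (𝓝 c) := by
      refine tendsto_lintegral_filter_of_dominated_convergence
        (fun m : ℝ≥0 => ENNReal.ofReal (C' * (m : ℝ) ^ γ)) (.of_forall fun t => ?_) ?_
        (hfin C' hC'.le) (.of_forall fun m => ?_)
      · exact ((L.measurable_lossCDF.comp
          (measurable_subtype_coe.div_const t)).const_mul _).ennreal_ofReal
      · filter_upwards [eventually_gt_atTop 0] with t ht
        refine .of_forall fun m => ENNReal.ofReal_le_ofReal ?_
        have h2 := Real.rpow_pos_of_pos ht γ
        calc t ^ γ * L.lossCDF (m / t) ≤ t ^ γ * (C' * (m / t) ^ γ) := by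
              gcongr
              exact hle _ (by positivity)
          _ = C' * (m : ℝ) ^ γ := by
              rw [Real.div_rpow m.coe_nonneg ht.le]
              field_simp
      · refine tendsto_const_nhds.congr' ?_
        filter_upwards [eventually_gt_atTop 0, eventually_ge_atTop (m / z₀)] with t ht htm
        have h2 := Real.rpow_pos_of_pos ht γ
        rw [heq _ (by positivity) ((div_le_comm₀ hz₀ ht).1 htm), ← hγ,
          Real.div_rpow m.coe_nonneg ht.le]
        congr 1
        field_simp
    refine h1.congr' ?_
    filter_upwards [eventually_gt_atTop 0] with t ht
    exact (L.ofReal_rpow_mul_powerTail F ht γ).symm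
  refine RegularlyVarying.of_tendsto_rpow_mul (L.powerTail_antitone F)
    (ENNReal.toReal_pos hc0 (hfin C hC.le)) ?_
  refine ((ENNReal.tendsto_toReal (hfin C hC.le)).comp hlim).congr' ?_
  filter_upwards [eventually_gt_atTop 0] with t ht
  exact ENNReal.toReal_ofReal (mul_nonneg (Real.rpow_nonneg ht.le γ) (tailProb_nonneg _))

/-- Restricting to m ≤ z₀t, where the power law for the pathloss is exact, leaves the truncated
moment E[C·m^γ; m ≤ z₀t] with γ = d/β₀. It increases to ∞; the measure `ν` expresses this as
continuity from below. -/
lemma tendsto_rpow_mul_powerTail_atTop (hd : 1 ≤ d) (hβ : 0 < L.β 0)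
    (hm : ∫⁻ m : ℝ≥0, ENNReal.ofReal ((m : ℝ) ^ (d / L.β 0)) ∂F = ∞) :
    Tendsto (fun t : ℝ => t ^ (d / L.β 0) * L.powerTail F t) atTop atTop := by
  set γ : ℝ := d / L.β 0 with hγ
  obtain ⟨C, z₀, hC, hz₀, heq⟩ := L.exists_lossCDF_eq hd hβ
  set ν : Measure ℝ≥0 := F.withDensity fun m => ENNReal.ofReal (C * (m : ℝ) ^ γ) with hν
  set s : ℝ → Set ℝ≥0 := fun t => {m | (m : ℝ) ≤ z₀ * t} with hs
  have hs_mono : Monotone s := fun a b hab m hma =>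
    le_trans hma (mul_le_mul_of_nonneg_left hab hz₀.le)
  have hs_meas : ∀ t, MeasurableSet (s t) := fun t =>
    measurableSet_le measurable_subtype_coe measurable_const
  have hs_univ : ⋃ t, s t = Set.univ := by
    refine Set.eq_univ_of_forall fun m => Set.mem_iUnion.2 ⟨m / z₀, ?_⟩
    change (m : ℝ) ≤ z₀ * (m / z₀)
    rw [mul_div_cancel₀ _ hz₀.ne']
  have hν_univ : ν Set.univ = ∞ := by
    rw [hν, withDensity_apply _ .univ, Measure.restrict_univ]
    simp_rw [ENNReal.ofReal_mul hC.le]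
    rw [lintegral_const_mul' _ _ ENNReal.ofReal_ne_top, hm,
      ENNReal.mul_top (ENNReal.ofReal_pos.2 hC).ne']
  have hlim := tendsto_measure_iUnion_atTop (μ := ν) hs_mono
  rw [hs_univ, hν_univ] at hlim
  refine ENNReal.tendsto_ofReal_nhds_top.1 (tendsto_nhds_top_mono hlim ?_)
  filter_upwards [eventually_gt_atTop 0] with t ht
  simp only [Function.comp_apply]
  rw [L.ofReal_rpow_mul_powerTail F ht γ, hν, withDensity_apply _ (hs_meas t)]
  refine le_trans (setLIntegral_mono' (hs_meas t) fun m hmt => ?_) (setLIntegral_le_lintegral _ _)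
  have h2 := Real.rpow_pos_of_pos ht γ
  rw [heq _ (by positivity) ((div_le_iff₀ ht).2 hmt), ← hγ, Real.div_rpow m.coe_nonneg ht.le]
  refine le_of_eq (congrArg ENNReal.ofReal ?_)
  field_simp

lemma powerTail_pos (hd : 1 ≤ d) (hpos : ∀ x, 0 < x → 0 < channelTail F x) {t : ℝ}
    (ht : 0 < t) : 0 < L.powerTail F t := by
  obtain ⟨M, hM, hlM⟩ := L.exists_l_le hd
  rw [L.powerTail_eq_integral_channelTail F ht.le]
  calc 0 < channelTail F (t * M) := hpos _ (by positivity)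
    _ = ∫ _, channelTail F (t * M) ∂L.positionLaw := by simp
    _ ≤ _ := integral_mono (integrable_const _) (L.integrable_channelTail F t) fun x =>
        channelTail_antitone (mul_le_mul_of_nonneg_left (hlM _) ht.le)

/-- If nodes with a small pathloss contribute negligibly, then the power tail inherits the regular
variation of the channel tail. -/
lemma regularlyVarying_powerTail_of_channelTail (hd : 1 ≤ d) {α : ℝ}
    (hreg : RegularlyVarying (channelTail F) (-α))
    (hneg : ∀ a : ℝ, 0 < a → Tendsto (fun t => L.lossCDF (a / t) / L.powerTail F t) atTop (𝓝 0)) :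
    RegularlyVarying (L.powerTail F) (-α) := by
  have hpos := fun t (ht : 0 < t) => L.powerTail_pos (F := F) hd hreg.1 ht
  refine ⟨hpos, (L.powerTail_antitone F).measurable.aemeasurable, fun c hc => ?_⟩
  set b : ℝ := c ^ (-α) with hb
  have hb0 : 0 < b := Real.rpow_pos_of_pos hc _
  -- Split the positions by whether t·l < x₀. Beyond x₀ the channel tails are within ε of their
  -- limiting ratio; below it the error is at most 1 + b, on an event of probability `L.lossCDF (x₀
  -- / t)`.
  have key : ∀ ε : ℝ, 0 < ε → ∃ a : ℝ, 0 < a ∧ ∀ t, 0 < t →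
      |L.powerTail F (c * t) - b * L.powerTail F t| ≤
        ε * L.powerTail F t + (1 + b) * L.lossCDF (a / t) := by
    intro ε hε
    obtain ⟨x₀, hx₀⟩ := eventually_atTop.1 (((hreg.2.2 c hc).eventually
      (Metric.ball_mem_nhds _ hε)).and (eventually_gt_atTop 0))
    have hx₀pos : 0 < x₀ := (hx₀ x₀ le_rfl).2
    refine ⟨x₀, hx₀pos, fun t ht => ?_⟩
    have hptw : ∀ u : ℝ, |channelTail F (c * u) - b * channelTail F u| ≤
        ε * channelTail F u + (1 + b) * (Set.Iio x₀).indicator (fun _ => (1 : ℝ)) u := by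
      intro u
      have h0 := channelTail_nonneg (F := F) u
      have h1 := channelTail_le_one (F := F) u
      have h0' := channelTail_nonneg (F := F) (c * u)
      have h1' := channelTail_le_one (F := F) (c * u)
      rcases lt_or_ge u x₀ with hu | hu
      · rw [Set.indicator_of_mem (show u ∈ Set.Iio x₀ from hu), abs_le]
        constructor <;> nlinarith [mul_nonneg hε.le h0, mul_nonneg hb0.le h0]
      · obtain ⟨h2, h3⟩ := hx₀ u hu
        have h4 := hreg.1 u h3
        rw [Set.indicator_of_notMem (show u ∉ Set.Iio x₀ from not_lt.2 hu), mul_zero, add_zero]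
        rw [Real.dist_eq] at h2
        have h5 : channelTail F (c * u) - b * channelTail F u =
            (channelTail F (c * u) / channelTail F u - b) * channelTail F u := by
          field_simp
        rw [h5, abs_mul, abs_of_pos h4]
        exact mul_le_mul_of_nonneg_right h2.le h0
    have hset : {x : EuclideanSpace ℝ (Fin d) | L.l ‖x‖ < x₀ / t} =
        (fun x => t * L.l ‖x‖) ⁻¹' Set.Iio x₀ := by
      ext x
      simp only [Set.mem_preimage, Set.mem_ofPred_eq, Set.mem_Iio]
      rw [lt_div_iff₀ ht, mul_comm]
    have hind : (fun x : EuclideanSpace ℝ (Fin d) =>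
        (Set.Iio x₀).indicator (fun _ => (1 : ℝ)) (t * L.l ‖x‖)) =
        {x : EuclideanSpace ℝ (Fin d) | L.l ‖x‖ < x₀ / t}.indicator 1 := by
      rw [hset]
      rfl
    have hindint : Integrable (fun x : EuclideanSpace ℝ (Fin d) =>
        (Set.Iio x₀).indicator (fun _ => (1 : ℝ)) (t * L.l ‖x‖)) L.positionLaw := by
      rw [hind]
      exact (integrable_const (1 : ℝ)).indicator (L.measurableSet_l_lt _)
    have hI1 := L.integrable_channelTail F t
    have hI2 := L.integrable_channelTail F (c * t)
    rw [L.powerTail_eq_integral_channelTail F ht.le,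
      L.powerTail_eq_integral_channelTail F (mul_pos hc ht).le]
    have hcdf : L.lossCDF (x₀ / t) = ∫ x : EuclideanSpace ℝ (Fin d),
        (Set.Iio x₀).indicator (fun _ => (1 : ℝ)) (t * L.l ‖x‖) ∂L.positionLaw := by
      rw [hind, integral_indicator_one (L.measurableSet_l_lt _)]
      rfl
    rw [hcdf, ← integral_const_mul, ← integral_const_mul, ← integral_const_mul,
      ← integral_sub hI2 (hI1.const_mul b), ← integral_add (hI1.const_mul ε)
        (hindint.const_mul (1 + b))]
    refine (abs_integral_le_integral_abs).trans (integral_mono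
      (hI2.sub (hI1.const_mul b)).abs ((hI1.const_mul ε).add (hindint.const_mul (1 + b)))
      fun x => ?_)
    simp only [mul_assoc]
    exact hptw (t * L.l ‖x‖)
  refine Metric.tendsto_atTop'.2 fun ε hε => ?_
  obtain ⟨a, ha, hka⟩ := key (ε / 2) (half_pos hε)
  have h1 := ((hneg a ha).const_mul (1 + b))
  rw [mul_zero] at h1
  obtain ⟨N, hN⟩ := eventually_atTop.1
    ((h1.eventually_lt_const (half_pos hε)).and (eventually_gt_atTop 0))
  refine ⟨N, fun t ht => ?_⟩
  obtain ⟨h2, h3⟩ := hN t (le_of_lt ht)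
  have h4 := hpos t h3
  have h5 := hka t h3
  rw [Real.dist_eq]
  have h6 : L.powerTail F (c * t) / L.powerTail F t - b =
      (L.powerTail F (c * t) - b * L.powerTail F t) / L.powerTail F t := by
    field_simp
  rw [h6, abs_div, abs_of_pos h4, div_lt_iff₀ h4]
  rw [← mul_div_assoc, div_lt_iff₀ h4] at h2
  linarith

lemma lintegral_coe_ne_top_of_moment {γ : ℝ} (hγ : 1 ≤ γ)
    (hm : ∫⁻ m : ℝ≥0, ENNReal.ofReal ((m : ℝ) ^ γ) ∂F ≠ ∞) :
    ∫⁻ m : ℝ≥0, (m : ℝ≥0∞) ∂F ≠ ∞ := by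
  refine ne_top_of_le_ne_top (ENNReal.add_ne_top.2 ⟨ENNReal.one_ne_top, hm⟩) ?_
  calc ∫⁻ m : ℝ≥0, (m : ℝ≥0∞) ∂F ≤ ∫⁻ m : ℝ≥0, 1 + ENNReal.ofReal ((m : ℝ) ^ γ) ∂F := by
        refine lintegral_mono fun m => ?_
        rw [← ENNReal.ofReal_coe_nnreal, ← ENNReal.ofReal_one,
          ← ENNReal.ofReal_add zero_le_one (Real.rpow_nonneg m.coe_nonneg γ)]
        refine ENNReal.ofReal_le_ofReal ?_
        rcases le_total (m : ℝ) 1 with h | h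
        · exact h.trans (le_add_of_nonneg_right (Real.rpow_nonneg m.coe_nonneg γ))
        · have := Real.rpow_le_rpow_of_exponent_le h hγ
          rw [Real.rpow_one] at this
          linarith
    _ = _ := by
        rw [lintegral_add_left measurable_const]
        simp

lemma moment_ne_top_of_lintegral_coe {γ : ℝ} (hγ0 : 0 ≤ γ) (hγ : γ ≤ 1)
    (hm : ∫⁻ m : ℝ≥0, (m : ℝ≥0∞) ∂F ≠ ∞) :
    ∫⁻ m : ℝ≥0, ENNReal.ofReal ((m : ℝ) ^ γ) ∂F ≠ ∞ := by
  refine ne_top_of_le_ne_top (ENNReal.add_ne_top.2 ⟨ENNReal.one_ne_top, hm⟩) ?_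
  calc ∫⁻ m : ℝ≥0, ENNReal.ofReal ((m : ℝ) ^ γ) ∂F ≤ ∫⁻ m : ℝ≥0, 1 + (m : ℝ≥0∞) ∂F := by
        refine lintegral_mono fun m => ?_
        have h0 := m.coe_nonneg
        rw [← ENNReal.ofReal_coe_nnreal, ← ENNReal.ofReal_one,
          ← ENNReal.ofReal_add zero_le_one h0]
        refine ENNReal.ofReal_le_ofReal ?_
        rcases le_total (m : ℝ) 1 with h | h
        · have := Real.rpow_le_one h0 h hγ0
          linarith
        · have := Real.rpow_le_rpow_of_exponent_le h hγ
          rw [Real.rpow_one] at this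
          linarith
    _ = _ := by
        rw [lintegral_add_left measurable_const]
        simp

/-- Under the tail hypotheses, the power has a finite mean as soon as its tail is not regularly
varying with an index in `[-1, 0]`. -/
lemma lintegral_power_ne_top (hd : 1 ≤ d) (hF : ¬ ∀ᵐ m ∂F, m = 0)
    (hcl : ClassifiedTail (channelTail F) ∨ ClassifiedTail (L.powerTail F))
    (hno : ∀ α : ℝ, 0 ≤ α → α ≤ 1 → ¬ RegularlyVarying (L.powerTail F) (-α)) :
    ∫⁻ p, L.power p ∂L.nodeLaw F ≠ ∞ := by
  have hβ0 : L.β 0 = 0 ∨ 0 < L.β 0 := L.β_zero.eq_or_lt.imp_left Eq.symm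
  -- The mean factorises, so only E[1/l] is at stake. If d/β₀ ≤ 1, the moment of order d/β₀ is
  -- finite as well and the power tail has the excluded index -d/β₀.
  have hmean : ∫⁻ m : ℝ≥0, (m : ℝ≥0∞) ∂F ≠ ∞ → ∫⁻ p, L.power p ∂L.nodeLaw F ≠ ∞ := by
    intro hm
    rw [lintegral_power]
    refine ENNReal.mul_ne_top ?_ hm
    rcases hβ0 with hβ | hβ
    · exact L.lintegral_inv_l_ne_top_of_exponent_eq_zero hd hβ
    · rcases lt_or_ge 1 (d / L.β 0) with hγ | hγ
      · exact L.lintegral_inv_l_ne_top hd hβ hγ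
      · have hγ0 : 0 ≤ d / L.β 0 := by positivity
        exact absurd (L.regularlyVarying_powerTail_of_moment hd hβ hF
          (moment_ne_top_of_lintegral_coe hγ0 hγ hm)) (hno _ hγ0 hγ)
  rcases hcl with hcl | hcl
  · rcases hcl.regularlyVarying_or_bound channelTail_le_one with ⟨α, hα0, hα1, hreg⟩ |
      ⟨C, q, hq0, hq, hb⟩
    · rcases hβ0 with hβ | hβ
      · refine absurd (L.regularlyVarying_powerTail_of_channelTail hd hreg fun a ha => ?_)
          (hno α hα0 hα1)
        obtain ⟨z₀, hz₀, hz⟩ := L.exists_lossCDF_eq_zero hd hβ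
        refine tendsto_const_nhds.congr' ?_
        filter_upwards [eventually_gt_atTop 0, eventually_ge_atTop (a / z₀)] with t ht hat
        rw [le_antisymm ((L.lossCDF_mono ((div_le_comm₀ hz₀ ht).1 hat)).trans_eq hz)
          (L.lossCDF_nonneg _), zero_div]
      -- An infinite moment makes the power tail heavier than t^(-d/β₀), the order of small
      -- pathlosses, so it inherits the excluded index of the channel. A finite moment gives index
      -- -d/β₀, which is excluded unless d/β₀ > 1, and then E m is finite.
      · by_cases hm : ∫⁻ m : ℝ≥0, ENNReal.ofReal ((m : ℝ) ^ (d / L.β 0)) ∂F = ∞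
        · refine absurd (L.regularlyVarying_powerTail_of_channelTail hd hreg fun a ha => ?_)
            (hno α hα0 hα1)
          obtain ⟨C, hC, hle⟩ := L.exists_lossCDF_le hd hβ
          have h1 := (L.tendsto_rpow_mul_powerTail_atTop hd hβ hm).const_div_atTop
            (C * a ^ (d / L.β 0))
          refine squeeze_zero' ?_ ?_ h1
          · exact .of_forall fun t => div_nonneg (L.lossCDF_nonneg _) (tailProb_nonneg _)
          · filter_upwards [eventually_gt_atTop 0] with t ht
            have h2 := Real.rpow_pos_of_pos ht (d / L.β 0)
            have h3 := L.powerTail_pos hd hreg.1 ht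
            rw [← div_div]
            gcongr
            refine (hle _ (by positivity)).trans (le_of_eq ?_)
            rw [Real.div_rpow ha.le ht.le, mul_div_assoc]
        · rcases lt_or_ge 1 (d / L.β 0) with hγ | hγ
          · exact hmean (lintegral_coe_ne_top_of_moment hγ.le hm)
          · exact absurd (L.regularlyVarying_powerTail_of_moment hd hβ hF hm)
              (hno _ (by positivity) hγ)
    · refine hmean (lintegral_ne_top_of_tailProb_le (C := C) measurable_coe_nnreal_ennreal hq0 hq
        fun n => ?_)
      rw [tailProb_coe_eq_channelTail (by positivity)]
      exact hb n
  · rcases hcl.regularlyVarying_or_bound (fun x => tailProb_le_one (π := L.nodeLaw F) _) with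
      ⟨α, hα0, hα1, hreg⟩ | ⟨C, q, hq0, hq, hb⟩
    · exact absurd hreg (hno α hα0 hα1)
    · exact lintegral_ne_top_of_tailProb_le L.measurable_power hq0 hq hb

lemma not_ae_power_eq_zero (hF : ¬ ∀ᵐ m ∂F, m = 0) : ¬ L.power =ᵐ[L.nodeLaw F] 0 := by
  intro h
  refine hF ?_
  have h1 : ∀ᵐ p ∂L.nodeLaw F, p.2 = 0 := by
    filter_upwards [h] with p hp
    rw [Pi.zero_apply, power, ENNReal.div_eq_zero_iff] at hp
    simpa using hp
  have h2 : ∀ᵐ m ∂(L.nodeLaw F).map Prod.snd, m = 0 :=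
    (ae_map_iff measurable_snd.aemeasurable (measurableSet_singleton 0)).2 h1
  rwa [nodeLaw, Measure.map_snd_prod, measure_univ, one_smul] at h2

end Pathloss

theorem theorem2 {d : ℕ} (hd : 1 ≤ d) (L : Pathloss d)
    (F : Measure ℝ≥0) [IsProbabilityMeasure F] (hF : F ≠ Measure.dirac 0) (W : ℝ≥0)
    {Ω : Type*} [MeasurableSpace Ω] (μ : Measure Ω) [IsProbabilityMeasure μ]
    (Φ : ℝ≥0 → Ω → Set (EuclideanSpace ℝ (Fin d) × ℝ≥0))
    (hΦ : ∀ lam : ℝ≥0,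
      IsPoissonProcess (Φ lam) ((lam • volume.restrict L.domain).prod F) μ) :
    (RegularlyVarying (L.powerTail F) 0 →
      ∀ y : ℝ≥0, Tendsto (fun lam => μ {ω | (y : ℝ≥0∞) < L.sinr W (Φ lam ω)}) atTop (𝓝 1)) ∧
    (∀ α : ℝ, 0 < α → α < 1 → RegularlyVarying (L.powerTail F) (-α) →
      ∃ (D : Measure ℝ≥0∞) (_ : IsProbabilityMeasure D), D {∞} = 0 ∧
        (∀ x, D ≠ Measure.dirac x) ∧
        TendstoInDistribution (fun lam ω => L.sinr W (Φ lam ω)) atTop id (fun _ => μ) D) ∧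
    ((ClassifiedTail (channelTail F) ∨ ClassifiedTail (L.powerTail F)) →
      (∀ α : ℝ, 0 ≤ α → α ≤ 1 → ¬ RegularlyVarying (L.powerTail F) (-α)) →
      (∀ᵐ ω ∂μ, Monotone fun lam => Φ lam ω) →
      ∀ᵐ ω ∂μ, Tendsto (fun lam => L.sinr W (Φ lam ω)) atTop (𝓝 0)) := by
  have h : ∀ lam : ℝ≥0, IsPoissonProcess (Φ lam)
      ((lam * (volume L.domain).toNNReal) • L.nodeLaw F) μ := fun lam =>
    L.intensity_eq F lam ▸ hΦ lam
  have hV : 0 < (volume L.domain).toNNReal :=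
    ENNReal.toNNReal_pos L.volume_domain_ne_zero L.volume_domain_ne_top
  have hF0 := ne_ae_zero_of_ne_dirac hF
  refine ⟨fun hT y => ?_, fun α hα hα1 hT => ?_, fun hcl hno hmono => ?_⟩
  -- `L.sinr` is by definition `maxRatio L.power`, so the abstract results apply as they stand.
  · exact IsPoissonProcess.tendsto_measure_lt_maxRatio h hV L.measurable_power
      (L.ae_power_ne_top F hd) W hT y
  · exact IsPoissonProcess.exists_tendstoInDistribution_maxRatio h hV L.measurable_power
      (L.ae_power_ne_top F hd) W hα hα1 hT
  · exact IsPoissonProcess.ae_tendsto_maxRatio_zero h hV L.measurable_power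
      (L.lintegral_power_ne_top hd hF0 hcl hno) (L.not_ae_power_eq_zero hF0) W hmono
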